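/- **Setting.** Base stations (BSs) and users of a cellular network live in the plane; the typical user is at the origin $o$. Parameters: BS density $\lambda>0$, user density $\lambda_u>0$, a measurable LOS probability $h:\mathbb R\to[0,1]$, path losses $\ell_L(r)=\beta r^{\alpha_L}$ and $\ell_N(r)=\beta r^{\alpha_N}$ ($\beta,\alpha_L,\alpha_N>0$) for LOS and NLOS links, transmit powers $P_b,P_u>0$, noise power $\sigma^2>0$, SINR thresholds $\Gamma_{cs},\Gamma_{ra}>0$, $M$ BS beams and $N$ user beams with $N\mid M$, and $N_{pa}\ge 1$ preambles. A user antenna of beamwidth $\theta<2\pi$ has main and side lobe gains $G(\theta)=\frac{2\pi}{\theta}\frac{\gamma}{\gamma+1}$, $g(\theta)=\frac{2\pi}{2\pi-\theta}\frac{1}{\gamma+1}$ with $\gamma=\frac{2\pi}{C_0(2\pi-\theta)}$, $C_0>0$; $G(2\pi)=1$, $g(2\pi)=0$ (no side lobe). A BS sweeping $m$ beams has main lobe gain $m$ and no side lobe. Write $G=G(2\pi/N)$, $g=g(2\pi/N)$. The protocol is one of: baseline $(M_{cs},N_{cs},M_{ra})=(M,N,M)$; fast RA $(M,N,1)$; fast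 CS $(m_{cs},N,M)$ with $N\le m_{cs}\le M$ and $N\mid m_{cs}$; omni RX $(M,1,1)$. Put $K=K_{cs}=\max(M_{cs},N_{cs})$, $q=K/N$, and let $S_j$ be the $j$-th BS sector, i.e. the points with angle in $[\frac{2\pi(j-1)}{K},\frac{2\pi j}{K})$. A link of length $r$ is LOS with probability $h(r)$, independently; fading powers are i.i.d. unit-mean exponential. **Cell search.** The BSs form a Poisson point process (PPP) of density $\lambda$. Let $Z_j$ be the minimum path loss to a BS in $S_j$. Sector $j$ is detected if $$\frac{F_j/Z_j}{\sum_{x} F_x/\ell(x)+\sigma^2/(P_bM_{cs}G(2\pi/N_{cs}))}\ge\Gamma_{cs},$$ where $F_j$ is the fading of the BS attaining $Z_j$ and the sum is over the BSs in $S_j$ of path loss $>Z_j$. Cell search succeeds ($e_0=1$) if some sector is detected; $Z_0$ is the smallest $Z_j$ over detected sectors, and the BS attaining it is the tagged BS. **Approximations (the model for the later phases).** The CCDF is computed under the following approximations. (i) Random access: users with successful cell search are a PPP of density $\lambda_u\mathbb P(e_0=1)$, each with a uniformly chosen preamble, and this process, seen from the tagged BS, is independent of the BSs; the association cell of the tagged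 BS has area $1.28/\lambda$, and a collision occurs if a user in the cell has the preamble of the typical user and is received under the same one of the $M_{ra}$ BS beams (each of probability $1/M_{ra}$). The preamble SINR is $$\frac{P_uM_{ra}G\,F/Z_0}{\sum_u P_uM_{ra}\big(G\delta_u+g(1-\delta_u)\big)F_u/\ell(u)+\sigma^2},$$ where the sum is over users with the same preamble in the sector of width $2\pi/M_{ra}$ of the BS receive beam, and $\delta_u$ indicates that the main lobe of $u$ covers the tagged BS: i.i.d. of mean $1/N$, except that for omni RX all users point in the direction of the user beam in which the typical user sees the tagged BS. Collision and preamble SINR are computed from independent copies of the user process. Random access succeeds ($\delta_0=1$) if there is no collision and the preamble SINR is at least $\Gamma_{ra}$. (ii) Data: all BSs are active, each BS beam covers the typical user with probability $1/M$ independently, and, given the outcome of cell search, the interfering BSs are taken from a fresh copy of the marked BS process, independent of all the above, in which only those with path loss $>Z_0$ are kept in detected sectors and all are kept in undetected sectors: $$\mathrm{SINR}_{DL}=\frac{P_bMG\,F_0/Z_0}{I_1+I_2+I_3+I_4+\sigma^2},$$ where $I_1,I_2$ (gain $P_bMG$) come from the detected, undetected sectors contained in the user beam (of width $2\pi/N$)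 containing the tagged BS, and $I_3,I_4$ (gain $P_bMg$) from the detected, undetected sectors outside it; $F_0$ is a fresh fading. **Functions.** With $\ell_L^{-1}(z)=(z/\beta)^{1/\alpha_L}$, $\ell_N^{-1}(z)=(z/\beta)^{1/\alpha_N}$ and $e^{-\infty}=0$, $$V(z,T,\lambda')=\exp\Big\{-2\pi\lambda'\Big(\int_{\ell_L^{-1}(z)}^\infty\frac{Tz\,h(r)\,r\,dr}{Tz+\ell_L(r)}+\int_{\ell_N^{-1}(z)}^\infty\frac{Tz(1-h(r))\,r\,dr}{Tz+\ell_N(r)}\Big)\Big\},$$ and $U(z,T,\lambda')$ is the same with both integrals from $0$; $$f_{Z_1}(z)=\frac{2\pi\lambda}{K}\Big[\tfrac{1}{\alpha_L}\beta^{-2/\alpha_L}z^{2/\alpha_L-1}h(\ell_L^{-1}(z))+\tfrac{1}{\alpha_N}\beta^{-2/\alpha_N}z^{2/\alpha_N-1}(1-h(\ell_N^{-1}(z)))\Big]e^{-\frac{2\pi\lambda}{K}\left(\int_0^{\ell_L^{-1}(z)}h(r)r\,dr+\int_0^{\ell_N^{-1}(z)}(1-h(r))r\,dr\right)};$$ $\tilde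 P(z)=\exp\big(-\frac{\Gamma_{cs}z\sigma^2}{P_bM_{cs}G(2\pi/N_{cs})}\big)V(z,\Gamma_{cs},\frac{\lambda}{K})$, $P(z)=\int_z^\infty\tilde P f_{Z_1}$, $P=P(0)$, $\hat P=1-(1-P)^K$, $P_{co}=\exp\big(-\frac{1.28\lambda_u\hat P}{\lambda N_{pa}M_{ra}}\big)$, $$P_{ra}(z)=\exp\Big(-\frac{\Gamma_{ra}z\sigma^2}{P_uM_{ra}G}\Big)U\Big(z,\Gamma_{ra},\frac{\lambda_u\hat P}{NM_{ra}N_{pa}}\Big)U\Big(z,\frac gG\Gamma_{ra},\big(1-\tfrac1N\big)\frac{\lambda_u\hat P}{M_{ra}N_{pa}}\Big),$$ $\eta_{IA}=\int_0^\infty K\,(P(z)+1-P)^{K-1}\tilde P(z)P_{co}P_{ra}(z)f_{Z_1}(z)\,dz$. **Lemma.** In this model, if $\mathbb P(e_0\delta_0=1)>0$, then $\eta_{IA}>0$ and, for every $\Gamma\ge0$, the integral below converges and $$\mathbb P(\mathrm{SINR}_{DL}\ge\Gamma\mid e_0\delta_0=1)=\frac1{\eta_{IA}}\int_0^\infty e^{-\frac{\Gamma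 z\sigma^2}{P_bMG}}K\Big[V(z,\Gamma,\tfrac{\lambda}{MK})P(z)+U(z,\Gamma,\tfrac{\lambda}{MK})(1-P)\Big]^{q-1}\Big[P(z)V(z,\tfrac gG\Gamma,\tfrac{\lambda}{MK})+(1-P)U(z,\tfrac gG\Gamma,\tfrac{\lambda}{MK})\Big]^{K-q}V(z,\Gamma,\tfrac{\lambda}{MK})\tilde P(z)P_{ra}(z)P_{co}f_{Z_1}(z)\,dz.$$ -/

import Mathlib

open MeasureTheory ProbabilityTheory Set
open scoped ENNReal Real

namespace MmWave

noncomputable section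

/-! ## Poisson point processes -/

/-- `X` is a Poisson point process on `E` with intensity measure `L`, realised as a random counting
measure: almost surely a countable sum of unit masses, with Poisson distributed numbers of points in
measurable sets of finite intensity and independent numbers of points in disjoint sets. -/
structure IsPPP {Ω E : Type*} [MeasurableSpace Ω] [MeasurableSpace E]
    (X : Ω → Measure E) (L : Measure E) (μ : Measure Ω) : Prop where
  measurable : Measurable X
  counting : ∀ᵐ ω ∂μ, ∃ (I : Set ℕ) (x : I → E), X ω = Measure.sum fun i => Measure.dirac (x i)
  poisson : ∀ B : Set E, MeasurableSet B → L B ≠ ∞ → ∀ n : ℕ,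
    μ {ω | X ω B = (n : ℝ≥0∞)} =
      ENNReal.ofReal (Real.exp (-(L B).toReal) * (L B).toReal ^ n / (n.factorial : ℝ))
  indep : ∀ (n : ℕ) (B : Fin n → Set E), (∀ i, MeasurableSet (B i)) →
    Pairwise (fun i j => Disjoint (B i) (B j)) → iIndepFun (fun i ω => X ω (B i)) μ

/-- The law of an indicator that equals `true` with probability `1 / n`. -/
def coin (n : ℕ) : Measure Bool :=
  ENNReal.ofReal (1 / (n : ℝ)) • Measure.dirac true +
    ENNReal.ofReal (1 - 1 / (n : ℝ)) • Measure.dirac false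

/-- `exp (-a)` for `a ∈ [0, ∞]`, with `exp (-∞) = 0`. -/
def expNeg (a : ℝ≥0∞) : ℝ := if a = ∞ then 0 else Real.exp (-a.toReal)

/-! ## Geometry; the plane is `ℂ` and the typical user is at the origin -/

/-- The infinite sector with apex `u` of the points seen from `u` at an angle in `[θ₁, θ₂)`. -/
def sector (u : ℂ) (θ₁ θ₂ : ℝ) : Set ℂ :=
  {x | ∃ r : ℝ, 0 < r ∧ ∃ θ ∈ Ico θ₁ θ₂, x = u + (r : ℂ) * Complex.exp ((θ : ℂ) * Complex.I)}

/-! ## Antenna gains -/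

/-- Main lobe gain with beamwidth `θ` for the user antenna constant `C₀`, with
`γ = 2π / (C₀ (2π - θ))`; for `θ = 2π` the antenna is omnidirectional (`γ = ∞`) with gain `1`. -/
def mainGain (C₀ θ : ℝ) : ℝ :=
  if θ = 2 * π then 1
  else
    let γ := 2 * π / (C₀ * (2 * π - θ))
    2 * π / θ * (γ / (γ + 1))

/-- Side lobe gain; an omnidirectional antenna has no side lobe. -/
def sideGain (C₀ θ : ℝ) : ℝ :=
  if θ = 2 * π then 0
  else
    let γ := 2 * π / (C₀ * (2 * π - θ))
    2 * π / (2 * π - θ) * (1 / (γ + 1))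

/-! ## Protocols and parameters -/

/-- The four initial access protocols; `fastCS m` sweeps `m` wide BS beams during cell search. -/
inductive Protocol where
  | baseline
  | fastRA
  | fastCS (m : ℕ)
  | omniRX

/-- System parameters. -/
structure Params where
  /-- BS density -/
  lam : ℝ
  /-- user density -/
  lamU : ℝ
  /-- LOS probability as a function of the link length -/
  h : ℝ → ℝ
  /-- path loss at unit distance -/
  β : ℝ
  /-- LOS path loss exponent -/
  αL : ℝ
  /-- NLOS path loss exponent -/
  αN : ℝ
  /-- BS transmit power -/
  Pb : ℝ
  /-- user transmit power -/
  Pu : ℝ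
  /-- thermal noise power `σ²` -/
  noise : ℝ
  /-- constant of the user antenna pattern -/
  C₀ : ℝ
  /-- number of BS beams -/
  M : ℕ
  /-- number of user beams -/
  N : ℕ
  /-- number of random access preambles -/
  Npa : ℕ
  /-- detection threshold in cell search -/
  Γcs : ℝ
  /-- detection threshold in random access -/
  Γra : ℝ
  /-- the protocol in use -/
  protocol : Protocol

/-- Admissible parameters. For the fast cell search protocol, `N` divides the number of wide beams, so
that every user beam is a union of BS sectors (that is, `K_cs / N` is an integer). -/
structure Params.Valid (p : Params) : Prop where
  lam_pos : 0 < p.lam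
  lamU_pos : 0 < p.lamU
  h_meas : Measurable p.h
  h_nonneg : ∀ r, 0 ≤ p.h r
  h_le_one : ∀ r, p.h r ≤ 1
  β_pos : 0 < p.β
  αL_pos : 0 < p.αL
  αN_pos : 0 < p.αN
  Pb_pos : 0 < p.Pb
  Pu_pos : 0 < p.Pu
  noise_pos : 0 < p.noise
  C₀_pos : 0 < p.C₀
  M_pos : 0 < p.M
  N_pos : 0 < p.N
  N_dvd_M : p.N ∣ p.M
  Npa_pos : 0 < p.Npa
  Γcs_pos : 0 < p.Γcs
  Γra_pos : 0 < p.Γra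
  fastCS_range : ∀ m, p.protocol = Protocol.fastCS m → p.N ≤ m ∧ m ≤ p.M ∧ p.N ∣ m

namespace Params

variable (p : Params)

/-- Number of BS beam directions searched in cell search. -/
def Mcs : ℕ :=
  match p.protocol with
  | .baseline => p.M
  | .fastRA => p.M
  | .fastCS m => m
  | .omniRX => p.M

/-- Number of user beam directions searched in cell search. -/
def Ncs : ℕ :=
  match p.protocol with
  | .baseline => p.N
  | .fastRA => p.N
  | .fastCS _ => p.N
  | .omniRX => 1

/-- Number of BS receive beam directions in random access. -/
def Mra : ℕ :=
  match p.protocol with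
  | .baseline => p.M
  | .fastRA => 1
  | .fastCS _ => p.M
  | .omniRX => 1

/-- Number of BS sectors. -/
def Kcs : ℕ := max p.Mcs p.Ncs

/-- Number of BS sectors in a user beam. -/
def q : ℕ := p.Kcs / p.N

/-- The `j`-th BS sector seen from the typical user. -/
def bsSector (j : Fin p.Kcs) : Set ℂ :=
  sector 0 (2 * π * (j : ℝ) / p.Kcs) (2 * π * ((j : ℝ) + 1) / p.Kcs)

/-- Main lobe gain of the user with its beamwidth for data, `2π / N`. -/
def G : ℝ := mainGain p.C₀ (2 * π / p.N)

/-- Side lobe gain of the user with beamwidth `2π / N`. -/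
def g : ℝ := sideGain p.C₀ (2 * π / p.N)

/-- Main lobe gain of the user in cell search, with beamwidth `2π / N_cs`. -/
def Gcs : ℝ := mainGain p.C₀ (2 * π / p.Ncs)

/-! ### The functions in the analytical expression -/

/-- LOS path loss at distance `r`. -/
def lossL (r : ℝ) : ℝ := p.β * r ^ p.αL

/-- NLOS path loss at distance `r`. -/
def lossN (r : ℝ) : ℝ := p.β * r ^ p.αN

/-- Distance of a LOS link with path loss `z`. -/
def invL (z : ℝ) : ℝ := (z / p.β) ^ (1 / p.αL)

/-- Distance of a NLOS link with path loss `z`. -/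
def invN (z : ℝ) : ℝ := (z / p.β) ^ (1 / p.αN)

/-- The special function `V(z, T, λ)`. -/
def V (z T lam : ℝ) : ℝ :=
  expNeg (ENNReal.ofReal (2 * π * lam) *
    ((∫⁻ r in Ioi (p.invL z), ENNReal.ofReal (T * z * p.h r * r / (T * z + p.lossL r))) +
      ∫⁻ r in Ioi (p.invN z), ENNReal.ofReal (T * z * (1 - p.h r) * r / (T * z + p.lossN r))))

/-- The special function `U(z, T, λ)`. -/
def U (z T lam : ℝ) : ℝ :=
  expNeg (ENNReal.ofReal (2 * π * lam) *
    ((∫⁻ r in Ioi (0 : ℝ), ENNReal.ofReal (T * z * p.h r * r / (T * z + p.lossL r))) +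
      ∫⁻ r in Ioi (0 : ℝ), ENNReal.ofReal (T * z * (1 - p.h r) * r / (T * z + p.lossN r))))

/-- The density of the minimum path loss in a BS sector. -/
def fZ₁ (z : ℝ) : ℝ :=
  (2 * π * p.lam / p.Kcs * (1 / p.αL) * (1 / p.β) ^ (2 / p.αL) * z ^ (2 / p.αL - 1) * p.h (p.invL z)
      + 2 * π * p.lam / p.Kcs * (1 / p.αN) * (1 / p.β) ^ (2 / p.αN) * z ^ (2 / p.αN - 1) *
        (1 - p.h (p.invN z)))
    * Real.exp (-(2 * π * p.lam / p.Kcs * ∫ r in (0 : ℝ)..p.invL z, p.h r * r))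
    * Real.exp (-(2 * π * p.lam / p.Kcs * ∫ r in (0 : ℝ)..p.invN z, (1 - p.h r) * r))

/-- Conditional detection probability of a BS sector with minimum path loss `z`. -/
def Ptilde (z : ℝ) : ℝ :=
  Real.exp (-(p.Γcs * z * p.noise / (p.Pb * p.Mcs * p.Gcs))) * p.V z p.Γcs (p.lam / p.Kcs)

/-- Probability that a BS sector is detected and has minimum path loss at least `z`. -/
def Ptail (z : ℝ) : ℝ := ∫ t in Ioi z, p.Ptilde t * p.fZ₁ t

/-- Detection probability of a BS sector. -/
def Pdet : ℝ := ∫ t in Ioi (0 : ℝ), p.Ptilde t * p.fZ₁ t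

/-- Cell search success probability. -/
def Phat : ℝ := 1 - (1 - p.Pdet) ^ p.Kcs

/-- Probability of no preamble collision. -/
def Pco : ℝ := Real.exp (-(1.28 * p.lamU * p.Phat / (p.lam * p.Npa * p.Mra)))

/-- Probability that the preamble is received over path loss `z`. -/
def Pra (z : ℝ) : ℝ :=
  Real.exp (-(p.Γra * z * p.noise / (p.Pu * p.Mra * p.G)))
    * p.U z p.Γra (p.lamU * p.Phat / (p.N * p.Mra * p.Npa))
    * p.U z (p.g / p.G * p.Γra) ((1 - 1 / (p.N : ℝ)) * (p.lamU * p.Phat / (p.Mra * p.Npa)))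

/-- The initial access success probability. -/
def etaIA : ℝ :=
  ∫ z in Ioi (0 : ℝ), p.Kcs * (p.Ptail z + 1 - p.Pdet) ^ (p.Kcs - 1) * p.Ptilde z * p.Pco * p.Pra z
    * p.fZ₁ z

/-! ### The probabilistic model -/

/-- A link is the relative position of its far end with its LOS (`true`) or NLOS (`false`) status. -/
def loss (y : ℂ × Bool) : ℝ := if y.2 then p.lossL ‖y.1‖ else p.lossN ‖y.1‖

/-- Intensity of the links to a homogeneous Poisson process of density `lam`: the LOS tier has
intensity `lam * h(‖x‖)`, the NLOS tier `lam * (1 - h(‖x‖))`. -/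
def linkIntensity (lam : ℝ) : Measure (ℂ × Bool) :=
  (volume.withDensity fun x : ℂ => ENNReal.ofReal (lam * p.h ‖x‖)).prod (Measure.dirac true) +
    (volume.withDensity fun x : ℂ => ENNReal.ofReal (lam * (1 - p.h ‖x‖))).prod (Measure.dirac false)

/-- The random elements of the model. Points of a process carry their marks as further coordinates. -/
structure Network (Ω : Type*) where
  /-- BSs in cell search, with fading power -/
  cs : Ω → Measure ((ℂ × Bool) × ℝ)
  /-- users relevant for preamble collision (position relative to the tagged BS), with their preamble
  and the BS receive beam under which they are received -/
  co : Ω → Measure (ℂ × Fin p.Npa × Fin p.Mra)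
  /-- users in random access (position relative to the tagged BS), with preamble, indicator of the
  user's main lobe covering the tagged BS, and fading power -/
  ra : Ω → Measure ((ℂ × Bool) × Fin p.Npa × Bool × ℝ)
  /-- BSs in data transmission, with indicator of the BS beam covering the typical user, and fading
  power -/
  dl : Ω → Measure ((ℂ × Bool) × Bool × ℝ)
  /-- preamble of the typical user -/
  preamble : Ω → Fin p.Npa
  /-- fading power of the typical user's preamble at the tagged BS -/
  fadingRA : Ω → ℝ
  /-- fading power of the tagged BS's data signal at the typical user -/
  fadingDL : Ω → ℝ

namespace Network

variable {p} {Ω : Type*} (X : p.Network Ω)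

/-! #### Cell search -/

/-- Minimum path loss in the `j`-th BS sector (`∞` if there is no BS). -/
def minLoss (j : Fin p.Kcs) (ω : Ω) : ℝ≥0∞ :=
  sInf {z | X.cs ω {y | y.1.1 ∈ p.bsSector j ∧ ENNReal.ofReal (p.loss y.1) ≤ z} ≠ 0}

/-- SINR of the synchronization signal of the BS with the minimum path loss in the `j`-th sector. -/
def sinrSS (j : Fin p.Kcs) (ω : Ω) : ℝ≥0∞ :=
  ((∫⁻ y in {y | y.1.1 ∈ p.bsSector j ∧ ENNReal.ofReal (p.loss y.1) = X.minLoss j ω},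
      ENNReal.ofReal y.2 ∂(X.cs ω)) / X.minLoss j ω) /
    ((∫⁻ y in {y | y.1.1 ∈ p.bsSector j ∧ X.minLoss j ω < ENNReal.ofReal (p.loss y.1)},
        ENNReal.ofReal (y.2 / p.loss y.1) ∂(X.cs ω)) +
      ENNReal.ofReal (p.noise / (p.Pb * p.Mcs * p.Gcs)))

open Classical in
/-- The detected BS sectors. -/
def detected (ω : Ω) : Finset (Fin p.Kcs) :=
  Finset.univ.filter fun j => ENNReal.ofReal p.Γcs ≤ X.sinrSS j ω

/-- Cell search success, `e₀ = 1`. -/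
def csSuccess : Set Ω := {ω | (X.detected ω).Nonempty}

/-- Path loss `Z₀` to the tagged BS (`∞` if cell search fails). -/
def servingLoss (ω : Ω) : ℝ≥0∞ := ⨅ j ∈ X.detected ω, X.minLoss j ω

open Classical in
/-- The BS sectors in the user beam that contains the tagged BS: those of index in
`{n q, …, n q + q - 1}` for the same `n` as the sector of the tagged BS. -/
def mainLobe (ω : Ω) : Finset (Fin p.Kcs) :=
  Finset.univ.filter fun i =>
    ∃ j ∈ X.detected ω, X.minLoss j ω = X.servingLoss ω ∧ (i : ℕ) / p.q = (j : ℕ) / p.q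

/-! #### Random access -/

/-- No other user of the association cell `cell` of the tagged BS is received under its `m`-th
beam with the preamble of the typical user. -/
def noCollision (cell : Set ℂ) (m : Fin p.Mra) : Set Ω :=
  {ω | X.co ω {y | y.1 ∈ cell ∧ y.2.1 = X.preamble ω ∧ y.2.2 = m} = 0}

/-- Whether the main lobe of an interfering user covers the tagged BS. With omnidirectional reception
in cell search, users sweep synchronously in random access, and all of them point in the direction of the
typical user's beam towards the tagged BS; otherwise the direction is random. -/
def covers (ω : Ω) (x : ℂ) (δ : Bool) : Prop :=
  match p.protocol with
  | .omniRX => ∃ i ∈ X.mainLobe ω, -x ∈ p.bsSector i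
  | _ => δ = true

open Classical in
/-- SINR of the typical user's preamble at the tagged BS, which receives under its `m`-th beam. -/
def sinrRA (m : Fin p.Mra) (ω : Ω) : ℝ≥0∞ :=
  (ENNReal.ofReal (p.Pu * p.Mra * p.G * X.fadingRA ω) / X.servingLoss ω) /
    ((∫⁻ y in {y | y.1.1 ∈ sector 0 (2 * π * (m : ℝ) / p.Mra) (2 * π * ((m : ℝ) + 1) / p.Mra) ∧
          y.2.1 = X.preamble ω},
        ENNReal.ofReal (p.Pu * p.Mra * (if X.covers ω y.1.1 y.2.2.1 then p.G else p.g) *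
          y.2.2.2 / p.loss y.1) ∂(X.ra ω)) +
      ENNReal.ofReal p.noise)

/-- Initial access success, `e₀ δ₀ = 1`. -/
def iaSuccess (cell : Set ℂ) (m : Fin p.Mra) : Set Ω :=
  X.csSuccess ∩ X.noCollision cell m ∩ {ω | ENNReal.ofReal p.Γra ≤ X.sinrRA m ω}

/-! #### Data transmission -/

/-- Data phase interference received with user gain `gain` from BSs in the `i`-th BS sector with path
loss larger than `z`. -/
def sectorInterference (i : Fin p.Kcs) (z : ℝ≥0∞) (gain : ℝ) (ω : Ω) : ℝ≥0∞ :=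
  ∫⁻ y in {y | y.1.1 ∈ p.bsSector i ∧ z < ENNReal.ofReal (p.loss y.1) ∧ y.2.1 = true},
    ENNReal.ofReal (p.Pb * p.M * gain * y.2.2 / p.loss y.1) ∂(X.dl ω)

/-- Data phase interference from the sectors in the main lobe (detected, undetected) and in the side
lobe (detected, undetected); interferers in detected sectors have path loss larger than `Z₀`. -/
def interferenceDL (ω : Ω) : ℝ≥0∞ :=
  (∑ i ∈ X.mainLobe ω ∩ X.detected ω, X.sectorInterference i (X.servingLoss ω) p.G ω) +
  (∑ i ∈ X.mainLobe ω \ X.detected ω, X.sectorInterference i 0 p.G ω) +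
  (∑ i ∈ X.detected ω \ X.mainLobe ω, X.sectorInterference i (X.servingLoss ω) p.g ω) +
  (∑ i ∈ (X.mainLobe ω ∪ X.detected ω)ᶜ, X.sectorInterference i 0 p.g ω)

/-- Downlink data SINR of the typical user. -/
def sinrDL (ω : Ω) : ℝ≥0∞ :=
  (ENNReal.ofReal (p.Pb * p.M * p.G * X.fadingDL ω) / X.servingLoss ω) /
    (X.interferenceDL ω + ENNReal.ofReal p.noise)

/-! #### Laws -/

/-- Laws of the random elements. The products in the intensities express that the marks are independent
of the positions and of each other. Users are active in random access if they succeed in cell search, so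
their density is `lamU` times the probability of cell search success. -/
structure HasLaw [MeasurableSpace Ω] (μ : Measure Ω) : Prop where
  cs_ppp : IsPPP X.cs ((p.linkIntensity p.lam).prod (expMeasure 1)) μ
  co_ppp : IsPPP X.co
    ((ENNReal.ofReal (p.lamU * μ.real X.csSuccess) • (volume : Measure ℂ)).prod
      ((uniformOn univ).prod (uniformOn univ))) μ
  ra_ppp : IsPPP X.ra
    ((p.linkIntensity (p.lamU * μ.real X.csSuccess)).prod
      ((uniformOn univ).prod ((coin p.N).prod (expMeasure 1)))) μ
  dl_ppp : IsPPP X.dl ((p.linkIntensity p.lam).prod ((coin p.M).prod (expMeasure 1))) μ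
  preamble_meas : Measurable X.preamble
  preamble_law : μ.map X.preamble = uniformOn univ
  fadingRA_meas : Measurable X.fadingRA
  fadingRA_law : μ.map X.fadingRA = expMeasure 1
  fadingDL_meas : Measurable X.fadingDL
  fadingDL_law : μ.map X.fadingDL = expMeasure 1
  indep : iIndep
    ![MeasurableSpace.comap X.cs inferInstance, MeasurableSpace.comap X.co inferInstance,
      MeasurableSpace.comap X.ra inferInstance, MeasurableSpace.comap X.dl inferInstance,
      MeasurableSpace.comap X.preamble inferInstance, MeasurableSpace.comap X.fadingRA inferInstance,
      MeasurableSpace.comap X.fadingDL inferInstance] μ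

end Network

end Params

end

end MmWave

/-! Two facts turn every SINR condition into an explicit integral. An exponential variable exceeds
an independent `I` with probability `E exp (-I)` (`expMeasure_ge`, `measure_le_exp`), and the
Laplace functional of a Poisson process is `E exp (-∫ f dX) = exp (-∫ (1 - exp (-f)) dL)`
(`IsPPP.lintegral_lap_lintegral`). When `f` is `T z / l` times an exponential mark, the mark average
of `1 - exp (-f)` is `T z / (T z + l)`; integrated over all links this gives `U`, and over the links
of path loss above `z` it gives `V`.

The delicate phase is cell search, where the SINR of a sector refers to the random point of minimum
path loss. The Mecke formula (`IsPPP.lintegral_lintegral`) replaces a sum over the points of the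
process by an integral over the position of one point added to the configuration. The added point is
the minimum exactly when no other point of its sector has path loss at most its own, and its own
fading then meets the threshold with a probability given by the interference Laplace transform. A
single application of the Laplace functional handles both requirements, so the path loss of a
detected sector has density `Ptilde * fZ₁` (`Valid.lintegral_detLoss`). The Mecke formula itself
follows from the Laplace functional by differentiation in the direction of an indicator, together
with the fact that a random measure is determined by its Laplace functional (`measure_measure_ext`).
The latter fact also makes restrictions to disjoint sets independent (`IsPPP.iIndepFun_restrict`).

Hence the path losses of the `K` sectors, set to `∞` when a sector is undetected, are independent
and identically distributed, with an atom `1 - P` at `∞` and no other atom. Almost surely there are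
no ties, so on success exactly one sector serves. The later phases use random elements independent
of cell search, and their conditional probability given the losses is a product
(`HasLaw.measure_laterSuccess`). Given serving loss `z`, each other sector must be detected above
`z`, contributing `V` times `P(z)`, or undetected, contributing `U` times `1 - P`. Of these sectors
`q - 1` share the user beam of the serving one and `K - q` do not, and all `K` choices of the
serving sector contribute equally. This gives the joint probability (`HasLaw.measure_success`). At
threshold `0` it is `etaIA` (`Valid.etaIA_eq`), and the theorem is the quotient.

A technical point recurs: integrals against a random measure over a set that itself varies must be
jointly measurable, which holds for s-finite kernels. The kernel `tame` is s-finite and almost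
surely fixes the Poisson configuration, with or without an added point. -/

namespace MmWave

noncomputable section

open Filter Topology

/-! ## The function `a ↦ exp (-a)` on `[0, ∞]` -/

/-- `exp (-a)` for `a ∈ [0, ∞]`, as an extended nonnegative real. -/
def lap (a : ℝ≥0∞) : ℝ≥0∞ := ENNReal.ofReal (expNeg a)

lemma expNeg_nonneg (a : ℝ≥0∞) : 0 ≤ expNeg a := by
  unfold expNeg; split_ifs <;> positivity

lemma expNeg_le_one (a : ℝ≥0∞) : expNeg a ≤ 1 := by
  unfold expNeg
  split_ifs
  · exact zero_le_one
  · exact Real.exp_le_one_iff.2 (by simp)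

lemma expNeg_add (a b : ℝ≥0∞) : expNeg (a + b) = expNeg a * expNeg b := by
  unfold expNeg
  by_cases ha : a = ∞
  · simp [ha]
  by_cases hb : b = ∞
  · simp [hb]
  simp only [ENNReal.add_eq_top, ha, hb, or_self, if_false]
  rw [← Real.exp_add, ENNReal.toReal_add ha hb]
  congr 1; ring

@[simp] lemma expNeg_zero : expNeg 0 = 1 := by simp [expNeg]

lemma expNeg_ofReal {x : ℝ} (hx : 0 ≤ x) : expNeg (ENNReal.ofReal x) = Real.exp (-x) := by
  simp [expNeg, ENNReal.toReal_ofReal hx]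

@[simp] lemma lap_zero : lap 0 = 1 := by simp [lap]

@[simp] lemma lap_top : lap ∞ = 0 := by simp [lap, expNeg]

lemma lap_add (a b : ℝ≥0∞) : lap (a + b) = lap a * lap b := by
  rw [lap, expNeg_add, ENNReal.ofReal_mul (expNeg_nonneg _)]; rfl

lemma lap_sum {ι : Type*} (s : Finset ι) (f : ι → ℝ≥0∞) :
    lap (∑ i ∈ s, f i) = ∏ i ∈ s, lap (f i) := by
  classical
  induction s using Finset.induction_on with
  | empty => simp
  | insert a s ha ih => rw [Finset.sum_insert ha, Finset.prod_insert ha, lap_add, ih]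

lemma lap_le_one (a : ℝ≥0∞) : lap a ≤ 1 := by
  simpa [lap] using ENNReal.ofReal_le_ofReal (expNeg_le_one a)

lemma lap_ne_top (a : ℝ≥0∞) : lap a ≠ ∞ := ENNReal.ofReal_ne_top

lemma lap_ofReal {x : ℝ} (hx : 0 ≤ x) : lap (ENNReal.ofReal x) = ENNReal.ofReal (Real.exp (-x)) := by
  rw [lap, expNeg_ofReal hx]

lemma lap_antitone : Antitone lap := by
  intro a b hab
  obtain ⟨c, rfl⟩ := exists_add_of_le hab
  rw [lap_add]
  exact mul_le_of_le_one_right' (lap_le_one c)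

/-- From `1 + a ≤ exp a`; the right side tends to `0` at `∞`, which gives continuity of `lap` there.
-/
lemma lap_le_inv (a : ℝ≥0∞) : lap a ≤ (1 + a)⁻¹ := by
  by_cases ha : a = ∞
  · simp [ha]
  lift a to NNReal using ha
  rw [lap, expNeg, if_neg ENNReal.coe_ne_top, Real.exp_neg, ENNReal.ofReal_inv_of_pos (Real.exp_pos _)]
  refine ENNReal.inv_le_inv.2 ?_
  have : (1 : ℝ≥0∞) + a = ENNReal.ofReal (1 + a) := by
    rw [ENNReal.ofReal_add zero_le_one (NNReal.coe_nonneg a)]; simp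
  rw [this]
  refine ENNReal.ofReal_le_ofReal ?_
  have := Real.add_one_le_exp (a : ℝ)
  simp only [ENNReal.coe_toReal]
  linarith

/-- Continuity includes the point `∞`, so limits pass through `lap` even when the integrals inside
are infinite. -/
lemma continuous_lap : Continuous lap := by
  rw [continuous_iff_continuousAt]
  intro a
  by_cases ha : a = ∞
  · subst ha
    have h : Tendsto (fun a : ℝ≥0∞ => (1 + a)⁻¹) (𝓝 ∞) (𝓝 0) := by
      have : Continuous (fun a : ℝ≥0∞ => (1 + a)⁻¹) := by fun_prop
      simpa using this.tendsto ∞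
    rw [ContinuousAt, lap_top]
    exact tendsto_of_tendsto_of_tendsto_of_le_of_le tendsto_const_nhds h
      (fun _ => zero_le) lap_le_inv
  · have h1 : ContinuousAt (fun a : ℝ≥0∞ => ENNReal.ofReal (Real.exp (-a.toReal))) a :=
      ENNReal.continuous_ofReal.continuousAt.comp
        (Real.continuous_exp.continuousAt.comp (ENNReal.tendsto_toReal ha).neg)
    refine h1.congr ?_
    filter_upwards [isOpen_ne.mem_nhds ha] with b hb
    simp only [lap, expNeg]
    rw [if_neg hb]

lemma measurable_lap : Measurable lap := continuous_lap.measurable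

lemma measurable_expNeg : Measurable expNeg := by
  unfold expNeg
  exact Measurable.ite (measurableSet_singleton _) measurable_const (by fun_prop)

/-! ## The exponential law of unit mean -/

instance : IsProbabilityMeasure (expMeasure 1) := isProbabilityMeasure_expMeasure one_pos

lemma lintegral_expMeasure (f : ℝ → ℝ≥0∞) :
    ∫⁻ x, f x ∂(expMeasure 1) = ∫⁻ x in Ioi 0, ENNReal.ofReal (Real.exp (-x)) * f x := by
  have h : expMeasure 1 = volume.withDensity (exponentialPDF 1) := rfl
  rw [h, lintegral_withDensity_eq_lintegral_mul_non_measurable volume (f := exponentialPDF 1)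
    (measurable_exponentialPDFReal 1).ennreal_ofReal (by simp [exponentialPDF])]
  -- The density equals `1` at the origin while the integral on the right is over the open
  -- half-line; the two differ on a null set only.
  have h2 : ∀ x : ℝ, x ≠ 0 → (exponentialPDF 1 * f) x =
      (Ioi 0).indicator (fun x => ENNReal.ofReal (Real.exp (-x)) * f x) x := by
    intro x hx0
    rcases lt_or_gt_of_ne hx0 with hx | hx
    · simp [exponentialPDF_of_neg hx, hx.le]
    · simp [exponentialPDF_of_nonneg hx.le, hx]
  rw [← lintegral_indicator measurableSet_Ioi]
  refine lintegral_congr_ae ?_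
  filter_upwards [Measure.ae_ne volume (0 : ℝ)] with x hx using h2 x hx

lemma lintegral_Ioi_exp_neg {s : ℝ} (hs : 0 < s) (r : ℝ) :
    ∫⁻ x in Ioi r, ENNReal.ofReal (Real.exp (-(s * x))) = ENNReal.ofReal (Real.exp (-(s * r)) / s) := by
  have hi : IntegrableOn (fun x => Real.exp (-(s * x))) (Ioi r) := by
    simpa [neg_mul] using exp_neg_integrableOn_Ioi r hs
  rw [← ofReal_integral_eq_lintegral_ofReal hi (Eventually.of_forall fun _ => by positivity)]
  congr 1
  have := integral_exp_mul_Ioi (a := -s) (by linarith) r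
  simp only [neg_mul] at this
  rw [this]; field_simp

/-- This tail formula is where Laplace transforms enter: with `a` an independent interference term,
averaging over `a` gives its Laplace transform. The value `a = ∞` is consistent because no real is
mapped to `∞`. -/
lemma expMeasure_ge (a : ℝ≥0∞) : expMeasure 1 {x | a ≤ ENNReal.ofReal x} = lap a := by
  by_cases ha : a = ∞
  · simp [ha]
  by_cases h0 : a = 0
  · simp [h0]
  have hm : MeasurableSet {x : ℝ | a ≤ ENNReal.ofReal x} :=
    measurableSet_le measurable_const (by fun_prop)
  have hset : {x : ℝ | a ≤ ENNReal.ofReal x} = Ici a.toReal := by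
    ext x
    change a ≤ _ ↔ a.toReal ≤ x
    rcases lt_or_ge x 0 with hx | hx
    · have := ENNReal.toReal_nonneg (a := a)
      simp only [ENNReal.ofReal_of_nonpos hx.le, nonpos_iff_eq_zero, h0, false_iff, not_le]
      linarith
    · exact ENNReal.le_ofReal_iff_toReal_le ha hx
  have hpos : 0 < a.toReal := ENNReal.toReal_pos h0 ha
  rw [← lintegral_indicator_one hm, lintegral_expMeasure, hset]
  have : ∀ x, ENNReal.ofReal (Real.exp (-x)) * (Ici a.toReal).indicator 1 x =
      (Ici a.toReal).indicator (fun x => ENNReal.ofReal (Real.exp (-x))) x := by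
    intro x; by_cases hx : x ∈ Ici a.toReal <;> simp [hx]
  simp_rw [this]
  rw [setLIntegral_indicator measurableSet_Ici,
    inter_eq_left.2 (show Ici a.toReal ⊆ Ioi 0 from fun x hx => lt_of_lt_of_le hpos hx), ← setLIntegral_congr Ioi_ae_eq_Ici]
  have := lintegral_Ioi_exp_neg one_pos a.toReal
  simp only [one_mul, div_one] at this
  rw [this, lap, expNeg, if_neg ha]

lemma lintegral_lap_expMeasure {s : ℝ} (hs : 0 ≤ s) :
    ∫⁻ x, lap (ENNReal.ofReal (s * x)) ∂(expMeasure 1) = ENNReal.ofReal (1 / (1 + s)) := by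
  rw [lintegral_expMeasure]
  have : ∀ x ∈ Ioi (0 : ℝ), ENNReal.ofReal (Real.exp (-x)) * lap (ENNReal.ofReal (s * x)) =
      ENNReal.ofReal (Real.exp (-((1 + s) * x))) := by
    intro x hx
    rw [lap_ofReal (mul_nonneg hs (le_of_lt hx)), ← ENNReal.ofReal_mul (Real.exp_pos _).le,
      ← Real.exp_add]
    congr 2; ring
  rw [setLIntegral_congr_fun measurableSet_Ioi this, lintegral_Ioi_exp_neg (by positivity)]
  simp

/-- With `s = T z / l` the value is `T z / (T z + l)`, the kernel in `U` and `V`. -/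
lemma lintegral_one_sub_lap_expMeasure {s : ℝ} (hs : 0 ≤ s) :
    ∫⁻ x, (1 - lap (ENNReal.ofReal (s * x))) ∂(expMeasure 1) = ENNReal.ofReal (s / (1 + s)) := by
  have hm : Measurable fun x : ℝ => lap (ENNReal.ofReal (s * x)) :=
    measurable_lap.comp (by fun_prop)
  rw [lintegral_sub hm _ (Eventually.of_forall fun x => lap_le_one _), lintegral_lap_expMeasure hs]
  · simp only [lintegral_const, measure_univ, mul_one]
    rw [← ENNReal.ofReal_one, ← ENNReal.ofReal_sub _ (by positivity)]
    congr 1; field_simp; ring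
  · rw [lintegral_lap_expMeasure hs]; exact ENNReal.ofReal_ne_top

end

end MmWave


namespace MmWave

noncomputable section

open Filter Topology

/-! ## Laplace functional of a Poisson point process -/

/-- The Poisson generating function, from the exponential series at `l * t`. It is used at `t = 1`
for total mass and at `t = exp (-c)` for Laplace transforms. -/
lemma hasSum_poisson_mul_pow (l t : ℝ) :
    HasSum (fun n : ℕ => Real.exp (-l) * l ^ n / (n.factorial : ℝ) * t ^ n)
      (Real.exp (-(l * (1 - t)))) := by
  have h := (NormedSpace.expSeries_div_hasSum_exp (𝔸 := ℝ) (l * t)).mul_left (Real.exp (-l))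
  have h2 : Real.exp (-l) * NormedSpace.exp (l * t) = Real.exp (-(l * (1 - t))) := by
    rw [← Real.exp_eq_exp_ℝ, ← Real.exp_add]; congr 1; ring
  rw [h2] at h
  refine h.congr_fun fun n => ?_
  rw [mul_pow]; ring

variable {Ω E : Type*} [MeasurableSpace Ω] [MeasurableSpace E]
  {X : Ω → Measure E} {L : Measure E} {μ : Measure Ω}

lemma IsPPP.measurable_apply (h : IsPPP X L μ) {B : Set E} (hB : MeasurableSet B) :
    Measurable fun ω => X ω B :=
  (Measure.measurable_coe hB).comp h.measurable

lemma IsPPP.measurable_lintegral (h : IsPPP X L μ) {f : E → ℝ≥0∞} (hf : Measurable f) :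
    Measurable fun ω => ∫⁻ x, f x ∂(X ω) :=
  (Measure.measurable_lintegral hf).comp h.measurable

/-- The Poisson weights sum to `1`, so the events of having `n` points exhaust the space up to a
null set. -/
lemma IsPPP.ae_exists_nat [IsProbabilityMeasure μ] (h : IsPPP X L μ) {B : Set E}
    (hB : MeasurableSet B) (hL : L B ≠ ∞) : ∀ᵐ ω ∂μ, ∃ n : ℕ, X ω B = n := by
  have hm : ∀ n : ℕ, MeasurableSet {ω | X ω B = (n : ℝ≥0∞)} := fun n =>
    h.measurable_apply hB (measurableSet_singleton _)
  have hd : Pairwise (Function.onFun Disjoint fun n : ℕ => {ω | X ω B = (n : ℝ≥0∞)}) := by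
    intro i j hij
    refine Set.disjoint_left.2 fun ω hi hj => hij ?_
    have hi' : X ω B = i := hi
    have hj' : X ω B = j := hj
    exact_mod_cast hi'.symm.trans hj'
  have hs := hasSum_poisson_mul_pow (L B).toReal 1
  simp only [one_pow, mul_one, sub_self, mul_zero, neg_zero, Real.exp_zero] at hs
  have h1 : μ (⋃ n : ℕ, {ω | X ω B = (n : ℝ≥0∞)}) = 1 := by
    rw [measure_iUnion hd hm]
    simp_rw [h.poisson B hB hL]
    rw [← ENNReal.ofReal_tsum_of_nonneg (fun n => by positivity) hs.summable, hs.tsum_eq]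
    simp
  have := (prob_compl_eq_zero_iff (MeasurableSet.iUnion hm)).2 h1
  filter_upwards [measure_eq_zero_iff_ae_notMem.1 this] with ω hω
  simpa using hω

/-- The generating function at `exp (-c)`. The value `c = ∞` is allowed and yields the void
probability, since `∞ * 0 = 0`. -/
lemma IsPPP.lintegral_lap_apply [IsProbabilityMeasure μ] (h : IsPPP X L μ) {B : Set E}
    (hB : MeasurableSet B) (hL : L B ≠ ∞) (c : ℝ≥0∞) :
    ∫⁻ ω, lap (c * X ω B) ∂μ = lap (L B * (1 - lap c)) := by
  have hm : ∀ n : ℕ, MeasurableSet {ω | X ω B = (n : ℝ≥0∞)} := fun n =>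
    h.measurable_apply hB (measurableSet_singleton _)
  have hlapn : ∀ n : ℕ, lap (c * n) = lap c ^ n := by
    intro n
    have := lap_sum (Finset.range n) (fun _ => c)
    simpa [mul_comm] using this
  have h1 : ∀ᵐ ω ∂μ, lap (c * X ω B) =
      ∑' n : ℕ, {ω | X ω B = (n : ℝ≥0∞)}.indicator (fun _ => lap c ^ n) ω := by
    filter_upwards [h.ae_exists_nat hB hL] with ω ⟨n, hn⟩
    rw [tsum_eq_single n]
    · rw [indicator_of_mem (show ω ∈ {ω | X ω B = (n : ℝ≥0∞)} from hn), hn, hlapn]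
    · intro k hk
      refine indicator_of_notMem (fun hk' => hk ?_) _
      have hk'' : X ω B = k := hk'
      exact_mod_cast hk''.symm.trans hn
  rw [lintegral_congr_ae h1, lintegral_tsum fun n => (measurable_const.indicator (hm n)).aemeasurable]
  simp_rw [lintegral_indicator_const (hm _), h.poisson B hB hL]
  have hs := hasSum_poisson_mul_pow (L B).toReal (expNeg c)
  have : ∀ n : ℕ, lap c ^ n * ENNReal.ofReal
      (Real.exp (-(L B).toReal) * (L B).toReal ^ n / (n.factorial : ℝ)) =
      ENNReal.ofReal (Real.exp (-(L B).toReal) * (L B).toReal ^ n / (n.factorial : ℝ) * expNeg c ^ n) := by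
    intro n
    rw [lap, ← ENNReal.ofReal_pow (expNeg_nonneg c), mul_comm, ENNReal.ofReal_mul (by positivity)]
  simp_rw [this]
  have hn := expNeg_nonneg c
  rw [← ENNReal.ofReal_tsum_of_nonneg (fun n => by positivity) hs.summable, hs.tsum_eq,
    ← lap_ofReal (mul_nonneg ENNReal.toReal_nonneg (sub_nonneg.2 (expNeg_le_one c))),
    ENNReal.ofReal_mul ENNReal.toReal_nonneg, ENNReal.ofReal_toReal hL,
    ENNReal.ofReal_sub _ hn, ENNReal.ofReal_one]
  rfl

lemma IsPPP.lintegral_lap_sum [IsProbabilityMeasure μ] (h : IsPPP X L μ) {ι : Type*}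
    (s : Finset ι) (B : ι → Set E) (hB : ∀ i, MeasurableSet (B i))
    (hd : ∀ i j, i ≠ j → Disjoint (B i) (B j)) (hL : ∀ i ∈ s, L (B i) ≠ ∞) (c : ι → ℝ≥0∞) :
    ∫⁻ ω, lap (∑ i ∈ s, c i * X ω (B i)) ∂μ = lap (∑ i ∈ s, L (B i) * (1 - lap (c i))) := by
  have e := s.equivFin.symm
  have hi := h.indep s.card (fun i => B (e i)) (fun i => hB _)
    (fun i j hij => hd _ _ fun h' => hij (e.injective (Subtype.ext h')))
  have hsum : ∀ f : ι → ℝ≥0∞, ∑ i ∈ s, f i = ∑ k : Fin s.card, f (e k) := by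
    intro f
    rw [← Finset.sum_coe_sort s f]
    exact (Equiv.sum_comp e (fun i : s => f i)).symm
  simp_rw [hsum, lap_sum]
  have hi2 : iIndepFun (fun k ω => lap (c (e k) * X ω (B (e k)))) μ :=
    hi.comp (fun k x => lap (c (e k) * x)) (fun k => measurable_lap.comp (by fun_prop))
  rw [lintegral_prod_eq_prod_lintegral_of_indepFun _ _ hi2
    (fun k => measurable_lap.comp ((h.measurable_apply (hB _)).const_mul _))]
  exact Finset.prod_congr rfl fun k _ => h.lintegral_lap_apply (hB _) (hL _ (e k).2) _

/-- The level sets are disjoint, so the counts on them are independent. Only nonzero levels are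
used, because the zero level may have infinite intensity. -/
lemma IsPPP.lintegral_lap_simpleFunc [IsProbabilityMeasure μ] (h : IsPPP X L μ)
    (f : SimpleFunc E ℝ≥0∞) (hf : L {x | f x ≠ 0} ≠ ∞) :
    ∫⁻ ω, lap (∫⁻ x, f x ∂(X ω)) ∂μ = lap (∫⁻ x, (1 - lap (f x)) ∂L) := by
  classical
  have h1 : ∀ ν : Measure E, ∫⁻ x, f x ∂ν = ∑ c ∈ f.range.filter (· ≠ 0), c * ν (f ⁻¹' {c}) := by
    intro ν
    rw [SimpleFunc.lintegral_eq_lintegral, SimpleFunc.lintegral_eq_of_subset']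
    intro x hx
    simp only [Finset.mem_sdiff, Finset.mem_singleton] at hx
    exact Finset.mem_filter.2 hx
  have h2 : ∫⁻ x, (1 - lap (f x)) ∂L = ∑ c ∈ f.range.filter (· ≠ 0), L (f ⁻¹' {c}) * (1 - lap c) := by
    have : ∀ x, 1 - lap (f x) = (f.map fun c => 1 - lap c) x := fun x => rfl
    simp_rw [this]
    rw [SimpleFunc.lintegral_eq_lintegral, SimpleFunc.map_lintegral, Finset.sum_filter]
    refine Finset.sum_congr rfl fun c _ => ?_
    by_cases hc : c = 0
    · simp [hc]
    · simp [hc, mul_comm]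
  simp_rw [h1]
  rw [h2]
  refine h.lintegral_lap_sum _ (fun c => f ⁻¹' {c}) (fun c => f.measurableSet_preimage _) ?_ ?_
    (fun c => c)
  · intro i j hij
    exact Disjoint.preimage _ (by simpa using hij)
  · intro c hc
    refine measure_ne_top_of_subset ?_ hf
    intro x hx
    have hx' : f x = c := hx
    simpa [hx'] using (Finset.mem_filter.1 hc).2

/-- Simple functions supported on sets of finite intensity increase to `f`. The left side converges
by domination by `1`, the right side by monotonicity. Since `f` may take the value `∞`, void events
are covered as well. -/
theorem IsPPP.lintegral_lap_lintegral [IsProbabilityMeasure μ] [SigmaFinite L] (h : IsPPP X L μ)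
    {f : E → ℝ≥0∞} (hf : Measurable f) :
    ∫⁻ ω, lap (∫⁻ x, f x ∂(X ω)) ∂μ = lap (∫⁻ x, (1 - lap (f x)) ∂L) := by
  let F : ℕ → SimpleFunc E ℝ≥0∞ := fun n => (SimpleFunc.eapprox f n).restrict (spanningSets L n)
  have hFx : ∀ n x, F n x = (spanningSets L n).indicator (SimpleFunc.eapprox f n) x := fun n x => by
    rw [SimpleFunc.restrict_apply _ (measurableSet_spanningSets L n)]
  have hmono : Monotone fun n => (F n : E → ℝ≥0∞) := by
    intro m n hmn x
    simp only [hFx]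
    by_cases hx : x ∈ spanningSets L m
    · rw [indicator_of_mem hx, indicator_of_mem (monotone_spanningSets L hmn hx)]
      exact SimpleFunc.monotone_eapprox f hmn x
    · rw [indicator_of_notMem hx]; exact zero_le
  have hlim : ∀ x, Tendsto (fun n => F n x) atTop (𝓝 (f x)) := by
    intro x
    refine (SimpleFunc.tendsto_eapprox hf x).congr' ?_
    have : x ∈ ⋃ n, spanningSets L n := by simp
    obtain ⟨N, hN⟩ := mem_iUnion.1 this
    filter_upwards [eventually_ge_atTop N] with n hn
    rw [hFx, indicator_of_mem (monotone_spanningSets L hn hN)]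
  have hfin : ∀ n, L {x | F n x ≠ 0} ≠ ∞ := by
    intro n
    refine measure_ne_top_of_subset ?_ (measure_spanningSets_lt_top L n).ne
    intro x hx
    by_contra hx'
    exact hx (by rw [hFx, indicator_of_notMem hx'])
  have hconv : ∀ (ν : Measure E), Tendsto (fun n => ∫⁻ x, F n x ∂ν) atTop (𝓝 (∫⁻ x, f x ∂ν)) :=
    fun ν => lintegral_tendsto_of_tendsto_of_monotone (fun n => (F n).measurable.aemeasurable)
      (Eventually.of_forall fun x m n hmn => hmono hmn x) (Eventually.of_forall hlim)
  have hlhs : Tendsto (fun n => ∫⁻ ω, lap (∫⁻ x, F n x ∂(X ω)) ∂μ) atTop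
      (𝓝 (∫⁻ ω, lap (∫⁻ x, f x ∂(X ω)) ∂μ)) := by
    refine tendsto_lintegral_of_dominated_convergence (fun _ => 1)
      (fun n => measurable_lap.comp (h.measurable_lintegral (F n).measurable))
      (fun n => Eventually.of_forall fun ω => lap_le_one _) (by simp)
      (Eventually.of_forall fun ω => (continuous_lap.tendsto _).comp (hconv (X ω)))
  have hrhs : Tendsto (fun n => lap (∫⁻ x, (1 - lap (F n x)) ∂L)) atTop
      (𝓝 (lap (∫⁻ x, (1 - lap (f x)) ∂L))) := by
    refine (continuous_lap.tendsto _).comp ?_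
    refine lintegral_tendsto_of_tendsto_of_monotone
      (fun n => ((measurable_lap.comp (F n).measurable).const_sub 1).aemeasurable)
      (Eventually.of_forall fun x m n hmn => tsub_le_tsub_left (lap_antitone (hmono hmn x)) _)
      (Eventually.of_forall fun x => ?_)
    exact ENNReal.Tendsto.sub tendsto_const_nhds ((continuous_lap.tendsto _).comp (hlim x))
      (Or.inl ENNReal.one_ne_top)
  refine tendsto_nhds_unique hlhs (hrhs.congr fun n => ?_)
  exact (h.lintegral_lap_simpleFunc (F n) (hfin n)).symm

end

end MmWave


namespace MmWave

noncomputable section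

open Filter Topology

/-! ## Finite measures are determined by Laplace transforms -/

/-- Two finite measures on the σ-algebra generated by a family `g` of `[0, ∞]`-valued functions that
contains `0` and is closed under addition agree if the integrals of `exp (-g i)` agree. -/
theorem measure_ext_of_lintegral_lap {Ω ι : Type*} [m : MeasurableSpace Ω] {μ₁ μ₂ : Measure Ω}
    [IsFiniteMeasure μ₁] [IsFiniteMeasure μ₂] (g : ι → Ω → ℝ≥0∞)
    (h0 : ∃ k, ∀ ω, g k ω = 0) (hadd : ∀ i j, ∃ k, ∀ ω, g k ω = g i ω + g j ω)
    (hgen : m = ⨆ i, MeasurableSpace.comap (g i) inferInstance)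
    (h : ∀ i, ∫⁻ ω, lap (g i ω) ∂μ₁ = ∫⁻ ω, lap (g i ω) ∂μ₂) : μ₁ = μ₂ := by
  have hg : ∀ i, Measurable (g i) := fun i => by
    rw [measurable_iff_comap_le]
    exact (le_iSup (fun i => MeasurableSpace.comap (g i) inferInstance) i).trans hgen.ge
  have hreal : ∀ (ν : Measure Ω) [IsFiniteMeasure ν] i,
      ∫ ω, expNeg (g i ω) ∂ν = (∫⁻ ω, lap (g i ω) ∂ν).toReal := fun ν _ i =>
    integral_eq_lintegral_of_nonneg_ae (Eventually.of_forall fun _ => expNeg_nonneg _)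
      (measurable_expNeg.comp (hg i)).aestronglyMeasurable
  -- Finitely many of the functions `exp (-g i)` map into a compact cube, where bounded continuous
  -- functions can be handled by a separating subalgebra.
  let Φ : (t : Finset ι) → Ω → (t → unitInterval) := fun t ω i =>
    ⟨expNeg (g i ω), expNeg_nonneg _, expNeg_le_one _⟩
  have hΦ : ∀ t, Measurable (Φ t) := fun t =>
    measurable_pi_lambda _ fun i => (measurable_expNeg.comp (hg i)).subtype_mk
  have hlaw : ∀ t, μ₁.map (Φ t) = μ₂.map (Φ t) := by
    intro t
    let c : t → BoundedContinuousFunction (t → unitInterval) ℝ := fun i =>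
      BoundedContinuousFunction.mkOfCompact ⟨fun x => (x i : ℝ), by fun_prop⟩
    let A : StarSubalgebra ℝ (BoundedContinuousFunction (t → unitInterval) ℝ) :=
      { Algebra.adjoin ℝ (range c) with
        star_mem' := fun {a} ha => by rwa [show star a = a from by ext; simp] }
    refine ext_of_forall_mem_subalgebra_integral_eq_of_polish (A := A) ?_ ?_
    · intro x y hxy
      obtain ⟨i, hi⟩ := Function.ne_iff.1 hxy
      refine ⟨fun x => (x i : ℝ), ⟨⟨fun x => (x i : ℝ), by fun_prop⟩, ?_, rfl⟩, fun h' => hi (Subtype.ext h')⟩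
      exact ⟨c i, Algebra.subset_adjoin (mem_range_self i), rfl⟩
    · intro f hf
      -- By closure under addition, a monomial in the coordinates pulls back to `exp (-g k)` for a
      -- single `k`, so its integrals agree by hypothesis; general elements of the algebra follow by
      -- linearity.
      have hf' : f ∈ Submodule.span ℝ ((Submonoid.closure (range c) : Submonoid _) : Set _) := by
        rw [← Algebra.adjoin_eq_span]; exact hf
      have hmap : ∀ (ν : Measure Ω) (f : BoundedContinuousFunction (t → unitInterval) ℝ),
          ∫ x, f x ∂(ν.map (Φ t)) = ∫ ω, f (Φ t ω) ∂ν := fun ν f =>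
        integral_map (hΦ t).aemeasurable f.continuous.aestronglyMeasurable
      clear hf
      induction hf' using Submodule.span_induction with
      | mem f hf =>
        have : ∃ k, ∀ ω, f (Φ t ω) = expNeg (g k ω) := by
          induction hf using Submonoid.closure_induction with
          | mem f hf => obtain ⟨i, rfl⟩ := hf; exact ⟨i, fun ω => rfl⟩
          | one => obtain ⟨k, hk⟩ := h0; exact ⟨k, fun ω => by simp [hk]⟩
          | mul f₁ f₂ _ _ h₁ h₂ =>
            obtain ⟨k₁, h₁⟩ := h₁
            obtain ⟨k₂, h₂⟩ := h₂
            obtain ⟨k, hk⟩ := hadd k₁ k₂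
            exact ⟨k, fun ω => by rw [hk, expNeg_add, ← h₁, ← h₂]; rfl⟩
        obtain ⟨k, hk⟩ := this
        simp_rw [hmap, hk, hreal, h k]
      | zero => simp
      | add f₁ f₂ _ _ h₁ h₂ =>
        have hi : ∀ (ν : Measure (t → unitInterval)) [IsFiniteMeasure ν]
          (f : BoundedContinuousFunction (t → unitInterval) ℝ), Integrable f ν := fun ν _ f =>
          f.integrable ν
        simp only [BoundedContinuousFunction.coe_add, Pi.add_apply]
        rw [integral_add (hi _ _) (hi _ _), integral_add (hi _ _) (hi _ _)]
        rw [h₁, h₂]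
      | smul a f _ h₁ =>
        simp only [BoundedContinuousFunction.coe_smul]
        rw [integral_smul, integral_smul, h₁]
  -- A measurable left inverse of `expNeg`, by which events about the `g i` become events about the
  -- cube.
  let ψ : unitInterval → ℝ≥0∞ := fun x => if (x : ℝ) = 0 then ∞ else ENNReal.ofReal (-Real.log x)
  have hψ : Measurable ψ := by
    refine Measurable.ite (measurable_subtype_coe (measurableSet_singleton _)) measurable_const ?_
    exact (Real.measurable_log.comp measurable_subtype_coe).neg.ennreal_ofReal
  have hψe : ∀ a : ℝ≥0∞, ψ ⟨expNeg a, expNeg_nonneg a, expNeg_le_one a⟩ = a := by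
    intro a
    simp only [ψ, expNeg]
    by_cases ha : a = ∞
    · simp [ha]
    · simp [ha]
  -- Finite intersections of events about single `g i` form a generating π-system, and each is a
  -- preimage under some `Φ t`.
  refine ext_of_generate_finite
    (piiUnionInter (fun i => {s | MeasurableSet[MeasurableSpace.comap (g i) inferInstance] s}) univ)
    ?_ (isPiSystem_piiUnionInter _ (fun i => ?_) _) ?_ ?_
  · refine hgen.trans ((?_ : _ = _).trans (generateFrom_piiUnionInter_measurableSet
      (fun i => MeasurableSpace.comap (g i) inferInstance) univ).symm)
    simp
  · exact @MeasurableSpace.isPiSystem_measurableSet _ (MeasurableSpace.comap (g i) inferInstance)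
  · rintro s ⟨t, -, f, hf, rfl⟩
    have : ∀ i : t, ∃ A : Set ℝ≥0∞, MeasurableSet A ∧ g i ⁻¹' A = f i := fun i => hf i i.2
    choose A hA hAf using this
    have hs : ⋂ i ∈ t, f i = Φ t ⁻¹' (⋂ i : t, (fun x : t → unitInterval => ψ (x i)) ⁻¹' A i) := by
      ext ω
      simp only [mem_iInter, mem_preimage, Φ, hψe]
      constructor
      · intro h' i
        have := h' i i.2
        rwa [← hAf i] at this
      · intro h' i hi
        have := h' ⟨i, hi⟩
        rw [← hAf ⟨i, hi⟩]
        exact this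
    have hm : MeasurableSet (⋂ i : t, (fun x : t → unitInterval => ψ (x i)) ⁻¹' A i) :=
      MeasurableSet.iInter fun i => (hψ.comp (measurable_pi_apply i)) (hA i)
    rw [hs, ← Measure.map_apply (hΦ t) hm, ← Measure.map_apply (hΦ t) hm, hlaw t]
  · obtain ⟨k, hk⟩ := h0
    simpa [hk] using h k

/-- The functions `ν ↦ ∫ f dν` generate the σ-algebra on measures. -/
lemma measurableSpace_measure_eq_iSup_lintegral {E : Type*} [MeasurableSpace E] :
    (Measure.instMeasurableSpace : MeasurableSpace (Measure E)) =
      ⨆ f : {f : E → ℝ≥0∞ // Measurable f},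
        MeasurableSpace.comap (fun ν : Measure E => ∫⁻ x, f.1 x ∂ν) inferInstance := by
  refine le_antisymm ?_ (iSup_le fun f => ?_)
  · refine iSup₂_le fun s hs => ?_
    refine le_trans (le_of_eq ?_) (le_iSup _ ⟨s.indicator 1, measurable_one.indicator hs⟩)
    have : (fun ν : Measure E => ∫⁻ x, s.indicator 1 x ∂ν) = fun ν => ν s := by
      ext ν; exact lintegral_indicator_one hs
    rw [this]
    rfl
  · exact measurable_iff_comap_le.1 (Measure.measurable_lintegral f.2)

/-- A finite measure on the space of measures is determined by its Laplace functional. -/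
theorem measure_measure_ext {E : Type*} [MeasurableSpace E] {P Q : Measure (Measure E)}
    [IsFiniteMeasure P] [IsFiniteMeasure Q]
    (h : ∀ f : E → ℝ≥0∞, Measurable f →
      ∫⁻ ν, lap (∫⁻ x, f x ∂ν) ∂P = ∫⁻ ν, lap (∫⁻ x, f x ∂ν) ∂Q) : P = Q :=
  measure_ext_of_lintegral_lap
    (fun (f : {f : E → ℝ≥0∞ // Measurable f}) (ν : Measure E) => ∫⁻ x, f.1 x ∂ν)
    ⟨⟨0, measurable_zero⟩, fun ν => by simp⟩
    (fun f g => ⟨⟨f.1 + g.1, f.2.add g.2⟩, fun ν => by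
      simp only [Pi.add_apply]; exact lintegral_add_left f.2 _⟩)
    measurableSpace_measure_eq_iSup_lintegral (fun f => h f.1 f.2)

/-- A finite measure on finite families of measures is determined by its Laplace functional. -/
theorem measure_pi_measure_ext {ι E : Type*} [Fintype ι] [MeasurableSpace E]
    {P Q : Measure (ι → Measure E)} [IsFiniteMeasure P] [IsFiniteMeasure Q]
    (h : ∀ f : ι → E → ℝ≥0∞, (∀ i, Measurable (f i)) →
      ∫⁻ ν, lap (∑ i, ∫⁻ x, f i x ∂(ν i)) ∂P = ∫⁻ ν, lap (∑ i, ∫⁻ x, f i x ∂(ν i)) ∂Q) : P = Q := by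
  classical
  refine measure_ext_of_lintegral_lap
    (fun (f : {f : ι → E → ℝ≥0∞ // ∀ i, Measurable (f i)}) (ν : ι → Measure E) =>
      ∑ i, ∫⁻ x, f.1 i x ∂(ν i))
    ⟨⟨0, fun i => measurable_zero⟩, fun ν => by simp⟩
    (fun f g => ⟨⟨f.1 + g.1, fun i => (f.2 i).add (g.2 i)⟩, fun ν => ?_⟩) ?_ (fun f => h f.1 f.2)
  · rw [← Finset.sum_add_distrib]
    refine Finset.sum_congr rfl fun i _ => ?_
    simp only [Pi.add_apply]; exact lintegral_add_left (f.2 i) _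
  · refine le_antisymm (iSup_le fun i => ?_) (iSup_le fun f => ?_)
    · beta_reduce
      rw [measurableSpace_measure_eq_iSup_lintegral, MeasurableSpace.comap_iSup]
      refine iSup_le fun f => ?_
      rw [MeasurableSpace.comap_comp]
      -- The family with a single nonzero member isolates the integral against the `i`-th component.
      refine le_trans (le_of_eq ?_) (le_iSup _ ⟨Pi.single i f.1, fun j => ?_⟩)
      · congr 1
        ext ν
        simp only [Function.comp]
        rw [Finset.sum_eq_single i]
        · simp
        · intro j _ hj; simp [hj]
        · simp
      · by_cases hj : j = i
        · subst hj; simpa using f.2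
        · simp only [Pi.single_eq_of_ne hj]; exact measurable_zero
    · refine measurable_iff_comap_le.1 (Finset.measurable_sum _ fun i _ => ?_)
      exact (Measure.measurable_lintegral (f.2 i)).comp (measurable_pi_apply i)

end

end MmWave


namespace MmWave

noncomputable section

open Filter Topology

variable {Ω E : Type*} [MeasurableSpace Ω] [MeasurableSpace E]
  {X : Ω → Measure E} {L : Measure E} {μ : Measure Ω}

/-! ## Independence of the restrictions to disjoint sets -/

lemma measurable_measure_restrict {S : Set E} (hS : MeasurableSet S) :
    Measurable fun ν : Measure E => ν.restrict S := by
  refine Measure.measurable_of_measurable_coe _ fun s hs => ?_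
  simp_rw [Measure.restrict_apply hs]
  exact Measure.measurable_coe (hs.inter hS)

/-- Joint law and product law have the same Laplace functional, since `1 - exp (-·)` is additive
over functions with disjoint supports. This upgrades independence of counts to independence of whole
configurations. -/
theorem IsPPP.iIndepFun_restrict [IsProbabilityMeasure μ] [SigmaFinite L] (h : IsPPP X L μ)
    {ι : Type*} [Fintype ι] (S : ι → Set E) (hS : ∀ i, MeasurableSet (S i))
    (hd : Pairwise fun i j => Disjoint (S i) (S j)) :
    iIndepFun (fun i ω => (X ω).restrict (S i)) μ := by
  have hm : ∀ i, Measurable fun ω => (X ω).restrict (S i) := fun i =>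
    (measurable_measure_restrict (hS i)).comp h.measurable
  rw [iIndepFun_iff_map_fun_eq_pi_map fun i => (hm i).aemeasurable]
  have : ∀ i, IsProbabilityMeasure (μ.map fun ω => (X ω).restrict (S i)) := fun i =>
    Measure.isProbabilityMeasure_map (hm i).aemeasurable
  have : IsProbabilityMeasure (μ.map fun ω i => (X ω).restrict (S i)) :=
    Measure.isProbabilityMeasure_map (measurable_pi_lambda _ hm).aemeasurable
  refine measure_pi_measure_ext fun f hf => ?_
  have hfi : ∀ i, Measurable ((S i).indicator (f i)) := fun i => (hf i).indicator (hS i)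
  have hl : Measurable fun ν : ι → Measure E => lap (∑ i, ∫⁻ x, f i x ∂(ν i)) :=
    measurable_lap.comp (Finset.measurable_sum _ fun i _ =>
      (Measure.measurable_lintegral (hf i)).comp (measurable_pi_apply i))
  have hl1 : ∀ i, Measurable fun ν : Measure E => lap (∫⁻ x, f i x ∂ν) := fun i =>
    measurable_lap.comp (Measure.measurable_lintegral (hf i))
  rw [lintegral_map hl (measurable_pi_lambda _ hm)]
  simp_rw [lap_sum]
  have hind : iIndepFun (fun i (ν : ι → Measure E) => lap (∫⁻ x, f i x ∂(ν i)))
      (Measure.pi fun i => μ.map fun ω => (X ω).restrict (S i)) :=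
    iIndepFun_pi (X := fun i (ν : Measure E) => lap (∫⁻ x, f i x ∂ν)) fun i => (hl1 i).aemeasurable
  rw [lintegral_prod_eq_prod_lintegral_of_indepFun _ _ hind
    fun i => (hl1 i).comp (measurable_pi_apply i)]
  have hmarg : ∀ i, ∫⁻ ν, lap (∫⁻ x, f i x ∂(ν i))
      ∂(Measure.pi fun i => μ.map fun ω => (X ω).restrict (S i)) =
      lap (∫⁻ x, (1 - lap ((S i).indicator (f i) x)) ∂L) := by
    intro i
    rw [(measurePreserving_eval (fun i => μ.map fun ω => (X ω).restrict (S i)) i).lintegral_comp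
      (hl1 i), lintegral_map (hl1 i) (hm i), ← h.lintegral_lap_lintegral (hfi i)]
    simp_rw [lintegral_indicator (hS i)]
  simp_rw [hmarg]
  have hli : ∀ i ∈ Finset.univ, Measurable fun x => 1 - lap ((S i).indicator (f i) x) :=
    fun i _ => (measurable_lap.comp (hfi i)).const_sub 1
  rw [← lap_sum, ← lintegral_finsetSum _ hli]
  -- At each point at most one indicator is nonzero.
  have hsum : ∀ x, ∑ i, (1 - lap ((S i).indicator (f i) x)) =
      1 - lap (∑ i, (S i).indicator (f i) x) := by
    intro x
    by_cases hx : ∃ i, x ∈ S i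
    · obtain ⟨i, hi⟩ := hx
      have hj : ∀ j, j ≠ i → x ∉ S j := fun j hj h' => Set.disjoint_left.1 (hd hj) h' hi
      rw [Finset.sum_eq_single i (fun j _ h' => by simp [hj j h']) (by simp),
        Finset.sum_eq_single i (fun j _ h' => by simp [hj j h']) (by simp)]
    · push Not at hx
      simp [hx]
  simp_rw [hsum]
  rw [← h.lintegral_lap_lintegral (Finset.measurable_sum _ fun i _ => hfi i)]
  refine lintegral_congr fun ω => ?_
  rw [← lap_sum, lintegral_finsetSum _ fun i _ => hfi i]
  simp_rw [lintegral_indicator (hS _)]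

/-! ## Restricting attention to locally finite measures -/

/-- A countable measurable partition of the space into sets of finite measure. -/
def finPart (L : Measure E) [SigmaFinite L] (n : ℕ) : Set E := disjointed (spanningSets L) n

lemma measurableSet_finPart (L : Measure E) [SigmaFinite L] (n : ℕ) :
    MeasurableSet (finPart L n) := MeasurableSet.disjointed (measurableSet_spanningSets L) n

lemma measure_finPart_ne_top (L : Measure E) [SigmaFinite L] (n : ℕ) : L (finPart L n) ≠ ∞ :=
  measure_ne_top_of_subset (disjointed_subset _ n) (measure_spanningSets_lt_top L n).ne

lemma iUnion_finPart (L : Measure E) [SigmaFinite L] : ⋃ n, finPart L n = univ := by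
  unfold finPart
  rw [iUnion_disjointed, iUnion_spanningSets]

lemma pairwise_disjoint_finPart (L : Measure E) [SigmaFinite L] :
    Pairwise (Function.onFun Disjoint (finPart L)) := disjoint_disjointed _

open Classical in
/-- The part in one set of the partition of a measure whose mass there has a given integer part. -/
def tamePiece (L : Measure E) [SigmaFinite L] (i : ℕ × ℕ) : Kernel (Measure E) E where
  toFun ν := if ν (finPart L i.1) ≠ ∞ ∧ ⌊(ν (finPart L i.1)).toReal⌋₊ = i.2 then
    ν.restrict (finPart L i.1) else 0
  measurable' := by
    have hm : Measurable fun ν : Measure E => ν (finPart L i.1) :=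
      Measure.measurable_coe (measurableSet_finPart L i.1)
    refine Measurable.ite ?_ (measurable_measure_restrict (measurableSet_finPart L i.1))
      measurable_const
    refine MeasurableSet.inter (hm (measurableSet_singleton _).compl) ?_
    exact (Nat.measurable_floor.comp hm.ennreal_toReal) (measurableSet_singleton i.2)

lemma tamePiece_apply (L : Measure E) [SigmaFinite L] (i : ℕ × ℕ) (ν : Measure E) :
    tamePiece L i ν = if ν (finPart L i.1) ≠ ∞ ∧ ⌊(ν (finPart L i.1)).toReal⌋₊ = i.2 then
      ν.restrict (finPart L i.1) else 0 := by
  classical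
  simp only [tamePiece, Kernel.coe_mk]

/-- A mass with integer part `i.2` is below `i.2 + 1`, uniformly in the measure; this is why the
pieces are indexed by integer parts. -/
instance (L : Measure E) [SigmaFinite L] (i : ℕ × ℕ) : IsFiniteKernel (tamePiece L i) := by
  refine ⟨⟨(i.2 : ℝ≥0∞) + 1, by simp, fun ν => ?_⟩⟩
  rw [tamePiece_apply]
  split_ifs with h
  · rw [Measure.restrict_apply_univ, ← ENNReal.ofReal_toReal h.1, ← h.2]
    refine (ENNReal.ofReal_le_ofReal (Nat.lt_floor_add_one _).le).trans (le_of_eq ?_)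
    rw [ENNReal.ofReal_add (by positivity) zero_le_one, ENNReal.ofReal_natCast, ENNReal.ofReal_one]
  · simp

/-- An s-finite kernel that maps every measure with finite mass on the sets `finPart L n` to itself. -/
def tame (L : Measure E) [SigmaFinite L] : Kernel (Measure E) E := Kernel.sum (tamePiece L)

instance (L : Measure E) [SigmaFinite L] : IsSFiniteKernel (tame L) := by
  unfold tame; infer_instance

/-- On each partition set exactly one piece is active, the one indexed by the integer part of the
mass, and it restricts `ν` to that set. -/
lemma tame_eq_self (L : Measure E) [SigmaFinite L] {ν : Measure E}
    (hν : ∀ n, ν (finPart L n) ≠ ∞) : tame L ν = ν := by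
  ext s hs
  rw [tame, Kernel.sum_apply' _ _ hs, ENNReal.tsum_prod (f := fun n m => tamePiece L (n, m) ν s)]
  have : ∀ n, ∑' m, tamePiece L (n, m) ν s = ν (s ∩ finPart L n) := by
    intro n
    rw [tsum_eq_single ⌊(ν (finPart L n)).toReal⌋₊]
    · rw [tamePiece_apply, if_pos ⟨hν n, rfl⟩, Measure.restrict_apply hs]
    · intro m hm
      rw [tamePiece_apply, if_neg fun h' => hm h'.2.symm]; simp
  simp_rw [this]
  rw [← measure_iUnion (fun i j hij => (pairwise_disjoint_finPart L hij).mono inter_subset_right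
    inter_subset_right) fun n => hs.inter (measurableSet_finPart L n), ← inter_iUnion,
    iUnion_finPart, inter_univ]

lemma IsPPP.ae_finPart [IsProbabilityMeasure μ] [SigmaFinite L] (h : IsPPP X L μ) :
    ∀ᵐ ω ∂μ, ∀ n, X ω (finPart L n) ≠ ∞ := by
  rw [ae_all_iff]
  intro n
  filter_upwards [h.ae_exists_nat (measurableSet_finPart L n) (measure_finPart_ne_top L n)]
    with ω ⟨k, hk⟩
  simp [hk]

lemma IsPPP.ae_tame [IsProbabilityMeasure μ] [SigmaFinite L] (h : IsPPP X L μ) :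
    ∀ᵐ ω ∂μ, tame L (X ω) = X ω := by
  filter_upwards [h.ae_finPart] with ω hω using tame_eq_self L hω

/-- The exceptional set does not depend on the added point: adding one point preserves finiteness on
each partition set. -/
lemma IsPPP.ae_tame_add_dirac [IsProbabilityMeasure μ] [SigmaFinite L] (h : IsPPP X L μ) :
    ∀ᵐ ω ∂μ, ∀ x, tame L (X ω + Measure.dirac x) = X ω + Measure.dirac x := by
  filter_upwards [h.ae_finPart] with ω hω x
  refine tame_eq_self L fun n => ?_
  rw [Measure.add_apply]
  exact ENNReal.add_ne_top.2 ⟨hω n, (measure_lt_top _ _).ne⟩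

/-! ## The Mecke formula -/

/-- The derivative is taken along `2⁻¹ ^ n` because dyadic difference quotients of `1 - exp (-t x)`
are monotone in `n`. -/
lemma tendsto_two_pow_mul {φ : ℝ → ℝ} {d : ℝ} (h : HasDerivAt φ d 0) (h0 : φ 0 = 0) :
    Tendsto (fun n : ℕ => (2 : ℝ) ^ n * φ ((2⁻¹ : ℝ) ^ n)) atTop (𝓝 d) := by
  have h1 := h.tendsto_slope_zero
  have h2 : Tendsto (fun n : ℕ => (2⁻¹ : ℝ) ^ n) atTop (𝓝[≠] 0) :=
    tendsto_nhdsWithin_iff.2 ⟨tendsto_pow_atTop_nhds_zero_of_lt_one (by norm_num) (by norm_num),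
      Eventually.of_forall fun n => by simp⟩
  refine (h1.comp h2).congr fun n => ?_
  simp [h0]

lemma one_sub_lap_ofReal {x : ℝ} (hx : 0 ≤ x) :
    1 - lap (ENNReal.ofReal x) = ENNReal.ofReal (1 - Real.exp (-x)) := by
  rw [lap_ofReal hx, ← ENNReal.ofReal_one, ← ENNReal.ofReal_sub _ (Real.exp_pos _).le]

/-- Halving the step amounts to `1 - v ^ 2 ≤ 2 * (1 - v)` with `v = exp (-u)`, that is, `(1 - v) ^ 2
≥ 0`. -/
lemma monotone_two_pow_mul_one_sub_lap (x : ℝ≥0∞) :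
    Monotone fun n : ℕ => (2 : ℝ≥0∞) ^ n * (1 - lap (ENNReal.ofReal ((2⁻¹ : ℝ) ^ n) * x)) := by
  refine monotone_nat_of_le_succ fun n => ?_
  set u := ENNReal.ofReal ((2⁻¹ : ℝ) ^ (n + 1)) * x with hu
  have h2 : ENNReal.ofReal ((2⁻¹ : ℝ) ^ n) * x = u + u := by
    rw [hu, ← add_mul, ← ENNReal.ofReal_add (by positivity) (by positivity)]
    congr 2; rw [pow_succ]; ring
  rw [h2, lap_add, pow_succ, mul_assoc]
  refine mul_le_mul_right ?_ _
  have h3 : lap u = ENNReal.ofReal (expNeg u) := rfl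
  have h4 := expNeg_nonneg u
  rw [h3, ← ENNReal.ofReal_mul h4, ← ENNReal.ofReal_one, ← ENNReal.ofReal_sub _ (by positivity),
    ← ENNReal.ofReal_sub _ h4, show (2 : ℝ≥0∞) = ENNReal.ofReal 2 by simp,
    ← ENNReal.ofReal_mul (by norm_num)]
  refine ENNReal.ofReal_le_ofReal ?_
  nlinarith [sq_nonneg (1 - expNeg u)]

lemma tendsto_two_pow_mul_one_sub_lap {x : ℝ≥0∞} (hx : x ≠ ∞) :
    Tendsto (fun n : ℕ => (2 : ℝ≥0∞) ^ n * (1 - lap (ENNReal.ofReal ((2⁻¹ : ℝ) ^ n) * x))) atTop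
      (𝓝 x) := by
  have hd : HasDerivAt (fun t : ℝ => 1 - Real.exp (-(t * x.toReal))) x.toReal 0 := by
    have h1 : HasDerivAt (fun t : ℝ => -(t * x.toReal)) (-(1 * x.toReal)) 0 :=
      ((hasDerivAt_id 0).mul_const _).neg
    simpa using h1.exp.const_sub 1
  have h := (ENNReal.continuous_ofReal.tendsto _).comp (tendsto_two_pow_mul hd (by simp))
  rw [ENNReal.ofReal_toReal hx] at h
  refine h.congr fun n => ?_
  have hp : (0 : ℝ) ≤ (2⁻¹ : ℝ) ^ n * x.toReal := by positivity
  simp only [Function.comp]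
  conv_rhs => rw [← ENNReal.ofReal_toReal hx]
  rw [← ENNReal.ofReal_mul (by positivity), one_sub_lap_ofReal hp, ENNReal.ofReal_mul (by positivity),
    ENNReal.ofReal_pow (by norm_num)]
  simp

/-- The derivative at `c = 0` of the Laplace functional at `f + c 1_B`, up to sign: on the random
side it brings down the factor `X ω B`, on the explicit side the integral of `exp (-f)` over `B`. -/
theorem IsPPP.lintegral_apply_mul_lap [IsProbabilityMeasure μ] [SigmaFinite L] (h : IsPPP X L μ)
    {f : E → ℝ≥0∞} (hf : Measurable f) {B : Set E} (hB : MeasurableSet B) (hL : L B ≠ ∞) :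
    ∫⁻ ω, X ω B * lap (∫⁻ x, f x ∂(X ω)) ∂μ =
      (∫⁻ x in B, lap (f x) ∂L) * lap (∫⁻ x, (1 - lap (f x)) ∂L) := by
  set a := ∫⁻ x in B, lap (f x) ∂L with ha
  set l := lap (∫⁻ x, (1 - lap (f x)) ∂L) with hl
  have hlapf : Measurable fun x => lap (f x) := measurable_lap.comp hf
  have hXf : Measurable fun ω => lap (∫⁻ x, f x ∂(X ω)) :=
    measurable_lap.comp (h.measurable_lintegral hf)
  have hXB := h.measurable_apply hB
  have hatop : a ≠ ∞ := by
    refine ne_top_of_le_ne_top hL ?_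
    calc a ≤ ∫⁻ x in B, 1 ∂L := lintegral_mono fun x => lap_le_one _
      _ = L B := by simp
  -- The increment of the functional is exact for every `c`, since on `B` one has `1 - exp (-f - c)
  -- = (1 - exp (-f)) + (1 - exp (-c)) * exp (-f)`.
  have hone : ∀ c : ℝ≥0∞, ∫⁻ ω, lap (∫⁻ x, f x ∂(X ω)) * (1 - lap (c * X ω B)) ∂μ =
      l * (1 - lap ((1 - lap c) * a)) := by
    intro c
    have hfc : Measurable fun x => f x + B.indicator (fun _ => c) x :=
      hf.add (measurable_const.indicator hB)
    have h1 : ∫⁻ ω, lap (∫⁻ x, f x ∂(X ω)) * lap (c * X ω B) ∂μ = l * lap ((1 - lap c) * a) := by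
      have e1 : ∀ ω, lap (∫⁻ x, f x ∂(X ω)) * lap (c * X ω B) =
          lap (∫⁻ x, (f x + B.indicator (fun _ => c) x) ∂(X ω)) := by
        intro ω
        rw [lintegral_add_left hf, lap_add, lintegral_indicator_const hB]
      simp_rw [e1]
      rw [h.lintegral_lap_lintegral hfc, hl, ← lap_add, ha, ← lintegral_const_mul _ hlapf,
        ← lintegral_indicator hB, ← lintegral_add_left (hlapf.const_sub 1)]
      congr 1
      refine lintegral_congr fun x => ?_
      rw [lap_add]
      by_cases hx : x ∈ B
      · simp only [hx, indicator_of_mem]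
        have h3 : ∀ b, lap b = ENNReal.ofReal (expNeg b) := fun _ => rfl
        have hf0 := expNeg_nonneg (f x)
        have hf1 := expNeg_le_one (f x)
        have hc0 := expNeg_nonneg c
        have hc1 := expNeg_le_one c
        rw [h3, h3, ← ENNReal.ofReal_mul hf0, ← ENNReal.ofReal_one, ← ENNReal.ofReal_sub _ (by positivity),
          ← ENNReal.ofReal_sub _ hf0, ← ENNReal.ofReal_sub _ hc0,
          ← ENNReal.ofReal_mul (by linarith),
          ← ENNReal.ofReal_add (by linarith) (mul_nonneg (by linarith) hf0)]
        congr 1; ring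
      · simp [hx]
    have h2 : ∀ ω, lap (∫⁻ x, f x ∂(X ω)) * (1 - lap (c * X ω B)) =
        lap (∫⁻ x, f x ∂(X ω)) - lap (∫⁻ x, f x ∂(X ω)) * lap (c * X ω B) := fun ω => by
      rw [ENNReal.mul_sub fun _ _ => lap_ne_top _, mul_one]
    have hmul : Measurable fun ω => lap (∫⁻ x, f x ∂(X ω)) * lap (c * X ω B) :=
      hXf.mul (measurable_lap.comp (hXB.const_mul c))
    simp_rw [h2]
    rw [lintegral_sub hmul
      (by rw [h1]; exact ENNReal.mul_ne_top (lap_ne_top _) (lap_ne_top _))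
      (Eventually.of_forall fun ω => mul_le_of_le_one_right' (lap_le_one _)), h1,
      h.lintegral_lap_lintegral hf, ENNReal.mul_sub fun _ _ => lap_ne_top _, mul_one]
  -- Monotone convergence passes the limit inside; the pointwise limit needs `X ω B` finite, which
  -- holds almost surely.
  have hlim1 : Tendsto (fun n : ℕ => ∫⁻ ω, (2 : ℝ≥0∞) ^ n *
      (lap (∫⁻ x, f x ∂(X ω)) * (1 - lap (ENNReal.ofReal ((2⁻¹ : ℝ) ^ n) * X ω B))) ∂μ) atTop
      (𝓝 (∫⁻ ω, X ω B * lap (∫⁻ x, f x ∂(X ω)) ∂μ)) := by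
    refine lintegral_tendsto_of_tendsto_of_monotone (fun n => ?_) ?_ ?_
    · exact ((hXf.mul ((measurable_lap.comp (hXB.const_mul _)).const_sub 1)).const_mul _).aemeasurable
    · refine Eventually.of_forall fun ω m n hmn => ?_
      have := monotone_two_pow_mul_one_sub_lap (X ω B) hmn
      simp only at this ⊢
      rw [mul_left_comm, mul_left_comm (2 ^ n)]
      exact mul_le_mul_right this _
    · filter_upwards [h.ae_exists_nat hB hL] with ω ⟨k, hk⟩
      have hfin : X ω B ≠ ∞ := by simp [hk]
      have := ENNReal.Tendsto.mul_const (b := lap (∫⁻ x, f x ∂(X ω)))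
        (tendsto_two_pow_mul_one_sub_lap hfin) (Or.inr (lap_ne_top _))
      refine this.congr fun n => ?_
      ring
  have hlim2 : Tendsto (fun n : ℕ => (2 : ℝ≥0∞) ^ n *
      (l * (1 - lap ((1 - lap (ENNReal.ofReal ((2⁻¹ : ℝ) ^ n))) * a)))) atTop (𝓝 (a * l)) := by
    have hd : HasDerivAt (fun t : ℝ => 1 - Real.exp (-((1 - Real.exp (-t)) * a.toReal))) a.toReal 0 := by
      have h1 : HasDerivAt (fun t : ℝ => 1 - Real.exp (-t)) 1 0 := by
        simpa using ((hasDerivAt_id (0 : ℝ)).neg.exp).const_sub 1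
      simpa using ((h1.mul_const a.toReal).neg.exp).const_sub 1
    have h1 := (ENNReal.continuous_ofReal.tendsto _).comp (tendsto_two_pow_mul hd (by simp))
    rw [ENNReal.ofReal_toReal hatop] at h1
    refine (ENNReal.Tendsto.mul_const (b := l) h1 (Or.inr (lap_ne_top _))).congr fun n => ?_
    have hp : (0 : ℝ) ≤ (2⁻¹ : ℝ) ^ n := by positivity
    have hp1 : (0 : ℝ) ≤ 1 - Real.exp (-(2⁻¹ : ℝ) ^ n) := by
      simp
    simp only [Function.comp]
    conv_rhs => rw [← ENNReal.ofReal_toReal hatop]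
    rw [one_sub_lap_ofReal hp, ← ENNReal.ofReal_mul hp1, one_sub_lap_ofReal
      (mul_nonneg hp1 ENNReal.toReal_nonneg), ENNReal.ofReal_mul (by positivity),
      ENNReal.ofReal_pow (by norm_num)]
    simp only [ENNReal.ofReal_ofNat]
    ring
  refine tendsto_nhds_unique hlim1 (hlim2.congr fun n => ?_)
  have hmul : Measurable fun ω => lap (∫⁻ x, f x ∂(X ω)) *
      (1 - lap (ENNReal.ofReal ((2⁻¹ : ℝ) ^ n) * X ω B)) :=
    hXf.mul ((measurable_lap.comp (hXB.const_mul _)).const_sub 1)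
  rw [lintegral_const_mul _ hmul, hone]

end

end MmWave


/-! ### The Mecke formula for functions of a point and the configuration -/

namespace MmWave

noncomputable section

open Filter Topology

variable {Ω E : Type*} [MeasurableSpace Ω] [MeasurableSpace E]
  {X : Ω → Measure E} {L : Measure E} {μ : Measure Ω}

lemma measurable_measure_add_dirac :
    Measurable fun p : E × Measure E => p.2 + Measure.dirac p.1 := by
  refine Measure.measurable_of_measurable_coe _ fun s hs => ?_
  simp only [Measure.add_apply]
  exact ((Measure.measurable_coe hs).comp measurable_snd).add
    ((Measure.measurable_coe hs).comp (Measure.measurable_dirac.comp measurable_fst))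

lemma IsPPP.measurable_add_dirac (h : IsPPP X L μ) :
    Measurable fun p : E × Ω => X p.2 + Measure.dirac p.1 :=
  measurable_measure_add_dirac.comp (measurable_fst.prodMk (h.measurable.comp measurable_snd))

lemma IsPPP.lintegral_apply [IsProbabilityMeasure μ] [SigmaFinite L] (h : IsPPP X L μ)
    {B : Set E} (hB : MeasurableSet B) (hL : L B ≠ ∞) : ∫⁻ ω, X ω B ∂μ = L B := by
  have := h.lintegral_apply_mul_lap measurable_zero hB hL
  simpa using this

lemma IsPPP.lintegral_apply_mul_indicator [IsProbabilityMeasure μ] [SigmaFinite L] (h : IsPPP X L μ)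
    {B : Set E} (hB : MeasurableSet B) (hL : L B ≠ ∞) {C : Set (Measure E)} (hC : MeasurableSet C) :
    ∫⁻ ω, X ω B * C.indicator 1 (X ω) ∂μ =
      ∫⁻ x in B, μ {ω | X ω + Measure.dirac x ∈ C} ∂L := by
  have hXB := h.measurable_apply hB
  have hX := h.measurable
  have hadd := h.measurable_add_dirac
  have : IsFiniteMeasure (L.restrict B) := ⟨by simpa using hL.lt_top⟩
  have : IsFiniteMeasure (μ.withDensity fun ω => X ω B) :=
    isFiniteMeasure_withDensity (by rw [h.lintegral_apply hB hL]; exact hL)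
  -- Both sides are finite laws on configurations: that of `X` biased by the number of points in
  -- `B`, and that of `X` with a point of `B` added. The differentiated Laplace functional shows
  -- that their Laplace functionals agree.
  have key : (μ.withDensity fun ω => X ω B).map X =
      ((L.restrict B).prod μ).map fun p => X p.2 + Measure.dirac p.1 := by
    refine measure_measure_ext fun f hf => ?_
    have hl : Measurable fun ν : Measure E => lap (∫⁻ x, f x ∂ν) :=
      measurable_lap.comp (Measure.measurable_lintegral hf)
    have hlX : Measurable fun ω => lap (∫⁻ x, f x ∂(X ω)) := hl.comp hX
    have hladd : Measurable fun p : E × Ω => lap (∫⁻ x, f x ∂(X p.2 + Measure.dirac p.1)) :=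
      hl.comp hadd
    rw [lintegral_map hl hX, lintegral_map hl hadd,
      lintegral_withDensity_eq_lintegral_mul _ hXB hlX, lintegral_prod _ hladd.aemeasurable]
    refine (h.lintegral_apply_mul_lap hf hB hL).trans ?_
    have : ∀ x, ∫⁻ ω, lap (∫⁻ y, f y ∂(X ω + Measure.dirac x)) ∂μ =
        lap (f x) * lap (∫⁻ x, (1 - lap (f x)) ∂L) := by
      intro x
      rw [← h.lintegral_lap_lintegral hf, ← lintegral_const_mul _ hlX]
      refine lintegral_congr fun ω => ?_
      rw [lintegral_add_measure, lintegral_dirac' _ hf, lap_add, mul_comm]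
    simp_rw [this]
    have hlf : Measurable fun x => lap (f x) := measurable_lap.comp hf
    rw [lintegral_mul_const _ hlf]
  have h1 := congrArg (fun m => m C) key
  rw [Measure.map_apply hX hC, Measure.map_apply hadd hC, withDensity_apply _ (hX hC),
    Measure.prod_apply (hadd hC), ← lintegral_indicator (hX hC)] at h1
  refine Eq.trans ?_ (h1.trans rfl)
  refine lintegral_congr fun ω => ?_
  by_cases hω : X ω ∈ C
  · rw [indicator_of_mem hω, indicator_of_mem (show ω ∈ X ⁻¹' C from hω)]; simp
  · rw [indicator_of_notMem hω, indicator_of_notMem (show ω ∉ X ⁻¹' C from hω)]; simp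

/-- The Mecke formula. -/
theorem IsPPP.lintegral_lintegral [IsProbabilityMeasure μ] [SigmaFinite L] (h : IsPPP X L μ)
    {F : E × Measure E → ℝ≥0∞} (hF : Measurable F) :
    ∫⁻ ω, ∫⁻ x, F (x, X ω) ∂(X ω) ∂μ = ∫⁻ x, ∫⁻ ω, F (x, X ω + Measure.dirac x) ∂μ ∂L := by
  have hX := h.measurable
  have hadd := h.measurable_add_dirac
  let κ : Kernel Ω E := (tame L).comap X hX
  have hκ : ∀ᵐ ω ∂μ, κ ω = X ω := by
    filter_upwards [h.ae_tame] with ω hω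
    rw [Kernel.comap_apply, hω]
  have hswap : Measurable fun p : Ω × E => (p.2, X p.1) :=
    measurable_snd.prodMk (hX.comp measurable_fst)
  have hpair : Measurable fun p : E × Ω => (p.1, X p.2 + Measure.dirac p.1) :=
    measurable_fst.prodMk hadd
  -- The Mecke formula as an equality of measures on pairs of a point and a configuration. The slabs
  -- over `finPart L n` have finite mass, so on each of them it suffices to compare rectangles.
  have key : (μ ⊗ₘ κ).map (fun p => (p.2, X p.1)) =
      (L.prod μ).map fun p => (p.1, X p.2 + Measure.dirac p.1) := by
    have hU : ⋃ n, finPart L n ×ˢ (univ : Set (Measure E)) = univ := by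
      rw [← iUnion_prod_const, iUnion_finPart, univ_prod_univ]
    rw [← Measure.restrict_univ (μ := Measure.map _ (μ ⊗ₘ κ)),
      ← Measure.restrict_univ (μ := Measure.map _ (L.prod μ)), ← hU, Measure.restrict_iUnion_congr]
    intro n
    have hrect : ∀ {s : Set E} {t : Set (Measure E)}, MeasurableSet s → MeasurableSet t →
        ((μ ⊗ₘ κ).map (fun p => (p.2, X p.1))).restrict (finPart L n ×ˢ univ) (s ×ˢ t) =
        ((L.prod μ).map fun p => (p.1, X p.2 + Measure.dirac p.1)).restrict
          (finPart L n ×ˢ univ) (s ×ˢ t) := by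
      intro s t hs ht
      have hB : MeasurableSet (s ∩ finPart L n) := hs.inter (measurableSet_finPart L n)
      have hL : L (s ∩ finPart L n) ≠ ∞ :=
        measure_ne_top_of_subset inter_subset_right (measure_finPart_ne_top L n)
      rw [Measure.restrict_apply (hs.prod ht), Measure.restrict_apply (hs.prod ht), prod_inter_prod,
        inter_univ, Measure.map_apply hswap (hB.prod ht), Measure.map_apply hpair (hB.prod ht),
        Measure.compProd_apply (hswap (hB.prod ht)), Measure.prod_apply (hpair (hB.prod ht))]
      have h1 := h.lintegral_apply_mul_indicator hB hL ht
      refine Eq.trans ?_ (h1.trans ?_)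
      · refine lintegral_congr_ae ?_
        filter_upwards [hκ] with ω hω
        rw [hω]
        by_cases hωt : X ω ∈ t
        · rw [indicator_of_mem hωt, Pi.one_apply, mul_one]
          congr 1
          ext x
          simp [hωt]
        · rw [indicator_of_notMem hωt, mul_zero]
          refine (congrArg (X ω) ?_).trans measure_empty
          ext x
          simp [hωt]
      · rw [← lintegral_indicator hB]
        refine lintegral_congr fun x => ?_
        by_cases hx : x ∈ s ∩ finPart L n
        · rw [indicator_of_mem hx]
          congr 1
          ext ω
          simp only [mem_preimage, mem_prod, hx, true_and]
          rfl
        · rw [indicator_of_notMem hx]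
          refine ((congrArg μ ?_).trans measure_empty).symm
          ext ω
          simp only [mem_preimage, mem_prod, hx, false_and, mem_empty_iff_false]
    have hfin : IsFiniteMeasure (((L.prod μ).map fun p => (p.1, X p.2 + Measure.dirac p.1)).restrict
        (finPart L n ×ˢ univ)) := by
      refine ⟨?_⟩
      rw [Measure.restrict_apply_univ, Measure.map_apply hpair
        ((measurableSet_finPart L n).prod .univ)]
      have : (fun p : E × Ω => (p.1, X p.2 + Measure.dirac p.1)) ⁻¹' (finPart L n ×ˢ univ) =
          finPart L n ×ˢ univ := by
        ext p; simp
      rw [this, Measure.prod_prod, measure_univ, mul_one]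
      exact (measure_finPart_ne_top L n).lt_top
    exact (Measure.ext_prod fun hs ht => (hrect hs ht).symm).symm
  have h1 := congrArg (fun m => ∫⁻ p, F p ∂m) key
  have hF1 : Measurable fun p : Ω × E => F (p.2, X p.1) := hF.comp hswap
  have hF2 : Measurable fun p : E × Ω => F (p.1, X p.2 + Measure.dirac p.1) := hF.comp hpair
  rw [lintegral_map hF hswap, lintegral_map hF hpair,
    Measure.lintegral_compProd hF1, lintegral_prod _ hF2.aemeasurable] at h1
  refine Eq.trans (lintegral_congr_ae ?_) h1
  filter_upwards [hκ] with ω hω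
  rw [hω]

end

end MmWave


namespace MmWave

noncomputable section

open Filter Topology

/-! ## Sectors -/

/-- The angle of a complex number in `[0, 2π)`. -/
def angle (x : ℂ) : ℝ := if 0 ≤ x.arg then x.arg else x.arg + 2 * π

lemma measurable_angle : Measurable angle :=
  Measurable.ite (measurableSet_le measurable_const Complex.measurable_arg) Complex.measurable_arg
    (Complex.measurable_arg.add_const _)

lemma angle_mem (x : ℂ) : angle x ∈ Ico 0 (2 * π) := by
  have h1 := Complex.arg_le_pi x
  have h2 := Complex.neg_pi_lt_arg x
  have := Real.pi_pos
  unfold angle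
  split_ifs with h
  · exact ⟨h, by linarith⟩
  · push Not at h
    exact ⟨by linarith, by linarith⟩

lemma norm_mul_exp_angle (x : ℂ) : (‖x‖ : ℂ) * Complex.exp ((angle x : ℂ) * Complex.I) = x := by
  unfold angle
  split_ifs
  · exact Complex.norm_mul_exp_arg_mul_I x
  · push_cast
    rw [add_mul, Complex.exp_periodic]
    exact Complex.norm_mul_exp_arg_mul_I x

lemma angle_eq {r θ : ℝ} (hr : 0 < r) (hθ : θ ∈ Ico 0 (2 * π)) :
    angle ((r : ℂ) * Complex.exp ((θ : ℂ) * Complex.I)) = θ := by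
  have hpi := Real.pi_pos
  unfold angle
  rcases le_or_gt θ π with h | h
  · have : Complex.arg ((r : ℂ) * Complex.exp ((θ : ℂ) * Complex.I)) = θ := by
      rw [Complex.exp_mul_I]
      exact Complex.arg_mul_cos_add_sin_mul_I hr ⟨by linarith [hθ.1], h⟩
    rw [this, if_pos hθ.1]
  · have : Complex.arg ((r : ℂ) * Complex.exp ((θ : ℂ) * Complex.I)) = θ - 2 * π := by
      have h2 : Complex.exp ((θ : ℂ) * Complex.I) = Complex.exp (((θ - 2 * π : ℝ) : ℂ) * Complex.I) := by
        push_cast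
        rw [sub_mul]
        exact (Complex.exp_periodic.sub_eq _).symm
      rw [h2, Complex.exp_mul_I]
      exact Complex.arg_mul_cos_add_sin_mul_I hr ⟨by linarith, by linarith [hθ.2]⟩
    rw [this, if_neg (by linarith [hθ.2])]
    ring

/-- The `j`-th of `K` equal sectors with apex `0`. -/
def eqSector (K : ℕ) (j : Fin K) : Set ℂ :=
  sector 0 (2 * π * (j : ℝ) / K) (2 * π * ((j : ℝ) + 1) / K)

lemma mem_eqSector {K : ℕ} {j : Fin K} {x : ℂ} :
    x ∈ eqSector K j ↔ x ≠ 0 ∧ angle x ∈ Ico (2 * π * (j : ℝ) / K) (2 * π * ((j : ℝ) + 1) / K) := by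
  have hpi := Real.pi_pos
  have hK : (0 : ℝ) < K := by exact_mod_cast j.pos
  constructor
  · rintro ⟨r, hr, θ, hθ, rfl⟩
    have hθ' : θ ∈ Ico 0 (2 * π) := by
      refine ⟨le_trans (by positivity) hθ.1, lt_of_lt_of_le hθ.2 ?_⟩
      rw [div_le_iff₀ hK]
      have : (j : ℝ) + 1 ≤ K := by exact_mod_cast j.2
      gcongr
    rw [zero_add]
    refine ⟨mul_ne_zero (by exact_mod_cast hr.ne') (Complex.exp_ne_zero _), ?_⟩
    rwa [angle_eq hr hθ']
  · rintro ⟨h0, h⟩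
    exact ⟨‖x‖, norm_pos_iff.2 h0, angle x, h, by rw [zero_add, norm_mul_exp_angle]⟩

lemma measurableSet_eqSector {K : ℕ} (j : Fin K) : MeasurableSet (eqSector K j) := by
  have : eqSector K j = {x | x ≠ 0} ∩
      angle ⁻¹' Ico (2 * π * (j : ℝ) / K) (2 * π * ((j : ℝ) + 1) / K) := by
    ext x; exact mem_eqSector
  rw [this]
  exact (measurableSet_singleton _).compl.inter (measurable_angle measurableSet_Ico)

lemma zero_notMem_eqSector {K : ℕ} (j : Fin K) : (0 : ℂ) ∉ eqSector K j :=
  fun h => (mem_eqSector.1 h).1 rfl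

lemma pairwise_disjoint_eqSector (K : ℕ) :
    Pairwise fun i j : Fin K => Disjoint (eqSector K i) (eqSector K j) := by
  have key : ∀ i j : Fin K, i < j → Disjoint (eqSector K i) (eqSector K j) := by
    intro i j hij
    refine Set.disjoint_left.2 fun x hi hj => ?_
    have h1 := (mem_eqSector.1 hi).2.2
    have h2 := (mem_eqSector.1 hj).2.1
    have h3 : (i : ℝ) + 1 ≤ j := by exact_mod_cast hij
    have : 2 * π * ((i : ℝ) + 1) / K ≤ 2 * π * (j : ℝ) / K := by
      have := Real.pi_pos
      gcongr
    linarith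
  intro i j hij
  rcases lt_or_gt_of_ne hij with h | h
  · exact key i j h
  · exact (key j i h).symm

lemma iUnion_eqSector {K : ℕ} (hK : 0 < K) : ⋃ j, eqSector K j = {0}ᶜ := by
  ext x
  simp only [mem_iUnion, mem_compl_iff, mem_singleton_iff]
  constructor
  · rintro ⟨j, hj⟩
    exact (mem_eqSector.1 hj).1
  · intro hx
    have hpi := Real.pi_pos
    have hK' : (0 : ℝ) < K := by exact_mod_cast hK
    obtain ⟨h0, h1⟩ := angle_mem x
    -- The index of the sector is the integer part of the angle measured in units of `2π / K`.
    have hlt : ⌊K * angle x / (2 * π)⌋₊ < K := by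
      rw [Nat.floor_lt (by positivity), div_lt_iff₀ (by positivity)]
      gcongr
    refine ⟨⟨_, hlt⟩, mem_eqSector.2 ⟨hx, ?_, ?_⟩⟩
    · have := Nat.floor_le (show 0 ≤ K * angle x / (2 * π) by positivity)
      rw [le_div_iff₀ (by positivity)] at this
      rw [div_le_iff₀ hK']
      simp only
      linarith
    · have := Nat.lt_floor_add_one (K * angle x / (2 * π))
      rw [div_lt_iff₀ (by positivity)] at this
      rw [lt_div_iff₀ hK']
      simp only
      linarith

/-- The rotation by `2π (j - i) / K` preserves area and norm and carries one sector to the other. -/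
lemma lintegral_eqSector_eq {K : ℕ} (i j : Fin K) (ψ : ℝ → ℝ≥0∞) :
    ∫⁻ x in eqSector K i, ψ ‖x‖ = ∫⁻ x in eqSector K j, ψ ‖x‖ := by
  have key : ∀ i j : Fin K, ∀ x ∈ eqSector K i,
      rotation (Circle.exp (2 * π * ((j : ℝ) - i) / K)) x ∈ eqSector K j := by
    rintro i j x ⟨r, hr, θ, hθ, rfl⟩
    have hK : (0 : ℝ) < K := by exact_mod_cast i.pos
    refine ⟨r, hr, θ + 2 * π * ((j : ℝ) - i) / K, ⟨?_, ?_⟩, ?_⟩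
    · have h1 := hθ.1
      have : 2 * π * (j : ℝ) / K = 2 * π * (i : ℝ) / K + 2 * π * ((j : ℝ) - i) / K := by ring
      linarith
    · have h1 := hθ.2
      have : 2 * π * ((j : ℝ) + 1) / K = 2 * π * ((i : ℝ) + 1) / K + 2 * π * ((j : ℝ) - i) / K := by
        ring
      linarith
    · rw [rotation_apply, Circle.coe_exp, zero_add, zero_add, mul_left_comm, ← Complex.exp_add]
      push_cast
      congr 2; ring
  have hmp := (rotation (Circle.exp (2 * π * ((j : ℝ) - i) / K))).measurePreserving
  have hpre : rotation (Circle.exp (2 * π * ((j : ℝ) - i) / K)) ⁻¹' eqSector K j = eqSector K i := by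
    ext x
    refine ⟨fun h => ?_, fun h => key i j x h⟩
    have := key j i _ h
    rw [show ∀ a b : Circle, rotation a (rotation b x) = rotation (a * b) x from fun a b => by
        simp, ← Circle.exp_add] at this
    have h0 : 2 * π * ((i : ℝ) - j) / K + 2 * π * ((j : ℝ) - i) / K = 0 := by ring
    rw [h0, Circle.exp_zero, map_one] at this
    exact this
  rw [← hmp.setLIntegral_comp_preimage_emb
    (rotation (Circle.exp (2 * π * ((j : ℝ) - i) / K))).toHomeomorph.measurableEmbedding
    (fun x => ψ ‖x‖) (eqSector K j), hpre]
  simp only [LinearIsometryEquiv.norm_map]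

lemma lintegral_norm_complex (ψ : ℝ → ℝ≥0∞) (hψ : Measurable ψ) :
    ∫⁻ x : ℂ, ψ ‖x‖ = ENNReal.ofReal (2 * π) * ∫⁻ r in Ioi (0 : ℝ), ENNReal.ofReal r * ψ r := by
  rw [← Complex.lintegral_comp_polarCoord_symm, polarCoord_target,
    Measure.volume_eq_prod, setLIntegral_prod]
  · have : ∀ r ∈ Ioi (0 : ℝ), ∫⁻ θ in Ioo (-π) π,
        ENNReal.ofReal (r, θ).1 • ψ ‖Complex.polarCoord.symm (r, θ)‖ =
        ENNReal.ofReal (2 * π) * (ENNReal.ofReal r * ψ r) := by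
      intro r hr
      have h1 : ∀ θ : ℝ, ‖Complex.polarCoord.symm (r, θ)‖ = r := fun θ => by
        rw [Complex.norm_polarCoord_symm]; exact abs_of_pos hr
      simp_rw [h1, smul_eq_mul]
      rw [setLIntegral_const, Real.volume_Ioo, mul_comm]
      congr 2; ring
    rw [setLIntegral_congr_fun measurableSet_Ioi this]
    exact lintegral_const_mul _ (ENNReal.measurable_ofReal.mul hψ)
  · refine Measurable.aemeasurable ?_
    simp only [Complex.norm_polarCoord_symm, smul_eq_mul]
    exact (ENNReal.measurable_ofReal.comp measurable_fst).mul
      (hψ.comp (measurable_fst.abs))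

/-- The `K` sectors have equal integrals and cover the plane up to the origin, so each has a
fraction `1 / K` of the polar integral. -/
theorem lintegral_eqSector {K : ℕ} (j : Fin K) {ψ : ℝ → ℝ≥0∞} (hψ : Measurable ψ) :
    ∫⁻ x in eqSector K j, ψ ‖x‖ =
      ENNReal.ofReal (2 * π / K) * ∫⁻ r in Ioi (0 : ℝ), ENNReal.ofReal r * ψ r := by
  have hK : (0 : ℝ) < K := by exact_mod_cast j.pos
  have hsum : ∑ i : Fin K, ∫⁻ x in eqSector K i, ψ ‖x‖ = ∫⁻ x : ℂ, ψ ‖x‖ := by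
    have h0 : (({0}ᶜ : Set ℂ) : Set ℂ) =ᵐ[volume] (univ : Set ℂ) := by
      rw [ae_eq_univ, compl_compl]; simp
    rw [← setLIntegral_univ (fun x : ℂ => ψ ‖x‖), ← setLIntegral_congr h0, ← iUnion_eqSector j.pos,
      lintegral_iUnion measurableSet_eqSector (pairwise_disjoint_eqSector K), tsum_fintype]
  rw [Finset.sum_congr rfl fun i _ => lintegral_eqSector_eq i j ψ, Finset.sum_const,
    Finset.card_univ, Fintype.card_fin, nsmul_eq_mul, lintegral_norm_complex ψ hψ] at hsum
  have hKn : (K : ℝ≥0∞) ≠ 0 := by exact_mod_cast j.pos.ne'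
  rw [ENNReal.ofReal_div_of_pos hK, ENNReal.ofReal_natCast, ENNReal.div_eq_inv_mul, mul_assoc, ← hsum,
    ← mul_assoc, ENNReal.inv_mul_cancel hKn (ENNReal.natCast_ne_top K), one_mul]

end

end MmWave


namespace MmWave

noncomputable section

open Filter Topology

namespace Params

variable {p : Params}

/-! ## Integrals of functions of the path loss -/

lemma Valid.one_sub_h_nonneg (hp : p.Valid) (r : ℝ) : 0 ≤ 1 - p.h r := sub_nonneg.2 (hp.h_le_one r)

lemma measurable_lossL : Measurable p.lossL := by unfold lossL; fun_prop

lemma measurable_lossN : Measurable p.lossN := by unfold lossN; fun_prop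

lemma measurable_loss : Measurable p.loss := by
  unfold loss
  refine Measurable.ite (measurable_snd (measurableSet_singleton true)) ?_ ?_
  · exact measurable_lossL.comp measurable_fst.norm
  · exact measurable_lossN.comp measurable_fst.norm

lemma Valid.loss_pos (hp : p.Valid) {y : ℂ × Bool} (hy : y.1 ≠ 0) : 0 < p.loss y := by
  have := norm_pos_iff.2 hy
  have := hp.β_pos
  unfold loss lossL lossN
  split_ifs <;> positivity

lemma Valid.sigmaFinite_linkIntensity (hp : p.Valid) (lam : ℝ) : SigmaFinite (p.linkIntensity lam) := by
  have := hp.h_meas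
  have h1 : SigmaFinite (volume.withDensity fun x : ℂ => ENNReal.ofReal (lam * p.h ‖x‖)) :=
    SigmaFinite.withDensity_ofReal _
  have h2 : SigmaFinite (volume.withDensity fun x : ℂ => ENNReal.ofReal (lam * (1 - p.h ‖x‖))) :=
    SigmaFinite.withDensity_ofReal _
  unfold linkIntensity
  infer_instance

lemma Valid.lintegral_linkIntensity (hp : p.Valid) (lam : ℝ) {f : ℂ × Bool → ℝ≥0∞}
    (hf : Measurable f) :
    ∫⁻ y, f y ∂(p.linkIntensity lam) = (∫⁻ x : ℂ, ENNReal.ofReal (lam * p.h ‖x‖) * f (x, true)) +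
      ∫⁻ x : ℂ, ENNReal.ofReal (lam * (1 - p.h ‖x‖)) * f (x, false) := by
  have := hp.h_meas
  have h1 : Measurable fun x : ℂ => ENNReal.ofReal (lam * p.h ‖x‖) := by fun_prop
  have h2 : Measurable fun x : ℂ => ENNReal.ofReal (lam * (1 - p.h ‖x‖)) := by fun_prop
  rw [linkIntensity, lintegral_add_measure, lintegral_prod _ hf.aemeasurable,
    lintegral_prod _ hf.aemeasurable]
  simp_rw [lintegral_dirac]
  rw [lintegral_withDensity_eq_lintegral_mul _ h1 (by fun_prop),
    lintegral_withDensity_eq_lintegral_mul _ h2 (by fun_prop)]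
  rfl

/-- The integral of a function of the path loss against the radial intensity of links. -/
def radial (p : Params) (φ : ℝ → ℝ≥0∞) : ℝ≥0∞ :=
  (∫⁻ r in Ioi (0 : ℝ), ENNReal.ofReal (p.h r * r) * φ (p.lossL r)) +
    ∫⁻ r in Ioi (0 : ℝ), ENNReal.ofReal ((1 - p.h r) * r) * φ (p.lossN r)

/-- `A` is a measurable set on which radial functions have a fraction `c` of their total integral. -/
def IsRadialPart (A : Set ℂ) (c : ℝ) : Prop :=
  MeasurableSet A ∧ ∀ ψ : ℝ → ℝ≥0∞, Measurable ψ →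
    ∫⁻ x in A, ψ ‖x‖ = ENNReal.ofReal (2 * π * c) * ∫⁻ r in Ioi (0 : ℝ), ENNReal.ofReal r * ψ r

lemma isRadialPart_eqSector {K : ℕ} (j : Fin K) : IsRadialPart (eqSector K j) (1 / K) :=
  ⟨measurableSet_eqSector j, fun ψ hψ => by rw [lintegral_eqSector j hψ, mul_one_div]⟩

/-- Path loss depends on position only through the norm, so the region enters only through its
fraction `c`. -/
lemma Valid.lintegral_loss_eq_radial (hp : p.Valid) {lam : ℝ} (hlam : 0 ≤ lam) {A : Set ℂ} {c : ℝ}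
    (hA : IsRadialPart A c) {φ : ℝ → ℝ≥0∞} (hφ : Measurable φ) :
    ∫⁻ y in {y : ℂ × Bool | y.1 ∈ A}, φ (p.loss y) ∂(p.linkIntensity lam) =
      ENNReal.ofReal (2 * π * (lam * c)) * p.radial φ := by
  have hpi := Real.pi_pos
  have hh := hp.h_meas
  have hL := p.measurable_lossL
  have hN := p.measurable_lossN
  have hS : MeasurableSet {y : ℂ × Bool | y.1 ∈ A} :=
    measurable_fst hA.1
  have hφl : Measurable fun y => φ (p.loss y) := hφ.comp measurable_loss
  rw [← lintegral_indicator hS, hp.lintegral_linkIntensity lam (hφl.indicator hS)]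
  have e1 : ∀ (b : Bool) (a : ℂ → ℝ≥0∞), ∫⁻ x : ℂ, a x *
      {y : ℂ × Bool | y.1 ∈ A}.indicator (fun y => φ (p.loss y)) (x, b) =
      ∫⁻ x in A, a x * φ (p.loss (x, b)) := by
    intro b a
    rw [← lintegral_indicator hA.1]
    refine lintegral_congr fun x => ?_
    by_cases hx : x ∈ A
    · rw [indicator_of_mem hx, indicator_of_mem (show (x, b) ∈ {y : ℂ × Bool | y.1 ∈ A} from hx)]
    · rw [indicator_of_notMem hx,
        indicator_of_notMem (show (x, b) ∉ {y : ℂ × Bool | y.1 ∈ A} from hx), mul_zero]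
  rw [e1, e1]
  have h1 : Measurable fun r : ℝ => ENNReal.ofReal (lam * p.h r) * φ (p.lossL r) := by fun_prop
  have h2 : Measurable fun r : ℝ => ENNReal.ofReal (lam * (1 - p.h r)) * φ (p.lossN r) := by fun_prop
  simp only [loss, if_true, Bool.false_eq_true, if_false]
  rw [hA.2 _ h1, hA.2 _ h2, ← mul_add]
  have h3 : Measurable fun r : ℝ => ENNReal.ofReal (p.h r * r) * φ (p.lossL r) := by fun_prop
  have h4 : Measurable fun r : ℝ => ENNReal.ofReal ((1 - p.h r) * r) * φ (p.lossN r) := by fun_prop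
  have e2 : ∀ (a : ℝ → ℝ) (φ' : ℝ → ℝ≥0∞), (∀ r, 0 ≤ a r) →
      Measurable (fun r : ℝ => ENNReal.ofReal (a r * r) * φ' r) →
      ∫⁻ r in Ioi (0 : ℝ), ENNReal.ofReal r * (ENNReal.ofReal (lam * a r) * φ' r) =
      ENNReal.ofReal lam * ∫⁻ r in Ioi (0 : ℝ), ENNReal.ofReal (a r * r) * φ' r := by
    intro a φ' ha hm
    rw [← lintegral_const_mul _ hm]
    refine setLIntegral_congr_fun measurableSet_Ioi fun r hr => ?_
    have hr' : (0 : ℝ) < r := hr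
    rw [ENNReal.ofReal_mul hlam, ENNReal.ofReal_mul (ha r)]
    ring
  rw [e2 p.h _ hp.h_nonneg h3, e2 (fun r => 1 - p.h r) _ hp.one_sub_h_nonneg h4, ← mul_add,
    ← mul_assoc, ← ENNReal.ofReal_mul' hlam]
  congr 2
  ring

/-- The density of the path losses with respect to the radial intensity of links. -/
def lossDensity (p : Params) (z : ℝ) : ℝ :=
  (1 / p.αL) * (1 / p.β) ^ (2 / p.αL) * z ^ (2 / p.αL - 1) * p.h (p.invL z)
    + (1 / p.αN) * (1 / p.β) ^ (2 / p.αN) * z ^ (2 / p.αN - 1) * (1 - p.h (p.invN z))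

lemma Valid.lossDensity_nonneg (hp : p.Valid) {z : ℝ} (hz : 0 < z) : 0 ≤ p.lossDensity z := by
  have h1 := hp.αL_pos
  have h2 := hp.αN_pos
  have h3 := hp.β_pos
  have h4 := hp.h_nonneg (p.invL z)
  have h5 := hp.one_sub_h_nonneg (p.invN z)
  unfold lossDensity
  positivity

lemma Valid.measurable_lossDensity (hp : p.Valid) : Measurable p.lossDensity := by
  have := hp.h_meas
  unfold lossDensity invL invN
  fun_prop

lemma inv_power_loss {β α z : ℝ} (hβ : 0 < β) (hα : 0 < α) (hz : 0 < z) :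
    β * ((z / β) ^ (1 / α)) ^ α = z := by
  rw [← Real.rpow_mul (by positivity), one_div_mul_cancel hα.ne', Real.rpow_one]
  field_simp

lemma power_loss_inv {β α r : ℝ} (hβ : 0 < β) (hα : 0 < α) (hr : 0 ≤ r) :
    (β * r ^ α / β) ^ (1 / α) = r := by
  rw [mul_div_cancel_left₀ _ hβ.ne', ← Real.rpow_mul hr, mul_one_div_cancel hα.ne', Real.rpow_one]

/-- Change of variables from link length to path loss. -/
lemma lintegral_power_loss {β α : ℝ} (hβ : 0 < β) (hα : 0 < α) (a : ℝ → ℝ) (φ : ℝ → ℝ≥0∞) :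
    ∫⁻ r in Ioi (0 : ℝ), ENNReal.ofReal (a r * r) * φ (β * r ^ α) =
      ∫⁻ z in Ioi (0 : ℝ), ENNReal.ofReal ((1 / α) * (1 / β) ^ (2 / α) * z ^ (2 / α - 1) *
        a ((z / β) ^ (1 / α))) * φ z := by
  have himg : (fun z : ℝ => (z / β) ^ (1 / α)) '' Ioi 0 = Ioi 0 := by
    ext r
    constructor
    · rintro ⟨z, hz, rfl⟩
      have hz' : (0 : ℝ) < z := hz
      exact (show (0 : ℝ) < (z / β) ^ (1 / α) by positivity)
    · intro hr
      have hr' : (0 : ℝ) < r := hr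
      exact ⟨β * r ^ α, (show (0 : ℝ) < β * r ^ α by positivity), power_loss_inv hβ hα hr'.le⟩
  have hderiv : ∀ z ∈ Ioi (0 : ℝ), HasDerivWithinAt (fun z : ℝ => (z / β) ^ (1 / α))
      (1 / β * (1 / α) * (z / β) ^ (1 / α - 1)) (Ioi 0) z := by
    intro z hz
    have hz' : (0 : ℝ) < z := hz
    have h1 : HasDerivAt (fun z : ℝ => z / β) (1 / β) z := (hasDerivAt_id z).div_const β
    exact (h1.rpow_const (Or.inl (by positivity))).hasDerivWithinAt
  have hmono : MonotoneOn (fun z : ℝ => (z / β) ^ (1 / α)) (Ioi 0) := by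
    intro x hx y hy hxy
    have hx' : (0 : ℝ) < x := hx
    exact Real.rpow_le_rpow (by positivity) (by gcongr) (by positivity)
  have key := lintegral_image_eq_lintegral_deriv_mul_of_monotoneOn measurableSet_Ioi hderiv hmono
    (fun r => ENNReal.ofReal (a r * r) * φ (β * r ^ α))
  rw [himg] at key
  rw [key]
  refine setLIntegral_congr_fun measurableSet_Ioi fun z hz => ?_
  have hz' : (0 : ℝ) < z := hz
  rw [inv_power_loss hβ hα hz', ← mul_assoc, ← ENNReal.ofReal_mul (by positivity)]
  congr 2
  -- The first power comes from the Jacobian, the second from the polar weight `r`; together they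
  -- give the power in `lossDensity`.
  have e1 : (z / β) ^ (1 / α - 1) * (z / β) ^ (1 / α) = (1 / β) ^ (2 / α) * z ^ (2 / α - 1) * β := by
    rw [← Real.rpow_add (by positivity), show 1 / α - 1 + 1 / α = 2 / α - 1 by ring,
      Real.rpow_sub (by positivity), Real.rpow_sub hz', Real.rpow_one, Real.rpow_one,
      div_eq_mul_one_div z β, Real.mul_rpow hz'.le (by positivity)]
    field_simp
  calc 1 / β * (1 / α) * (z / β) ^ (1 / α - 1) * (a ((z / β) ^ (1 / α)) * (z / β) ^ (1 / α))
      = 1 / β * (1 / α) * a ((z / β) ^ (1 / α)) *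
        ((z / β) ^ (1 / α - 1) * (z / β) ^ (1 / α)) := by ring
    _ = _ := by rw [e1]; field_simp

lemma Valid.radial_eq (hp : p.Valid) {φ : ℝ → ℝ≥0∞} (hφ : Measurable φ) :
    p.radial φ = ∫⁻ z in Ioi (0 : ℝ), ENNReal.ofReal (p.lossDensity z) * φ z := by
  have hh := hp.h_meas
  have h1 := lintegral_power_loss hp.β_pos hp.αL_pos p.h φ
  have h2 := lintegral_power_loss hp.β_pos hp.αN_pos (fun r => 1 - p.h r) φ
  unfold radial lossL lossN
  rw [h1, h2, ← lintegral_add_left (by fun_prop)]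
  refine setLIntegral_congr_fun measurableSet_Ioi fun z hz => ?_
  have hz' : (0 : ℝ) < z := hz
  have hL := hp.αL_pos
  have hN := hp.αN_pos
  have hβ := hp.β_pos
  have h4 := hp.h_nonneg ((z / p.β) ^ (1 / p.αL))
  have h5 := hp.one_sub_h_nonneg ((z / p.β) ^ (1 / p.αN))
  simp only [lossDensity, invL, invN]
  rw [ENNReal.ofReal_add (by positivity) (by positivity), add_mul]

/-- Links of positive length have positive path loss, so nonpositive arguments, where division or
`ENNReal.ofReal` takes default values, never matter. -/
lemma Valid.radial_congr (hp : p.Valid) {φ ψ : ℝ → ℝ≥0∞} (h : ∀ l, 0 < l → φ l = ψ l) :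
    p.radial φ = p.radial ψ := by
  have hβ := hp.β_pos
  unfold radial lossL lossN
  congr 1 <;>
  · refine setLIntegral_congr_fun measurableSet_Ioi fun r hr => ?_
    have hr' : (0 : ℝ) < r := hr
    rw [h _ (by positivity)]

/-! ## The special functions -/

lemma Valid.U_eq (hp : p.Valid) (z T lam : ℝ) :
    p.U z T lam = expNeg (ENNReal.ofReal (2 * π * lam) *
      p.radial fun l => ENNReal.ofReal (T * z / (T * z + l))) := by
  unfold U radial
  congr 3 <;>
  · refine setLIntegral_congr_fun measurableSet_Ioi fun r hr => ?_
    have hr' : (0 : ℝ) < r := hr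
    have h4 := hp.h_nonneg r
    have h5 := hp.one_sub_h_nonneg r
    simp only
    rw [← ENNReal.ofReal_mul (by positivity)]
    congr 1; ring

lemma lt_loss_iff {β α z r : ℝ} (hβ : 0 < β) (hα : 0 < α) (hz : 0 < z) (hr : 0 < r) :
    z < β * r ^ α ↔ (z / β) ^ (1 / α) < r := by
  conv_rhs => rw [← power_loss_inv hβ hα hr.le]
  rw [Real.rpow_lt_rpow_iff (by positivity) (by positivity) (by positivity),
    div_lt_div_iff_of_pos_right hβ]

lemma setLIntegral_Ioi_eq {c : ℝ} (hc : 0 < c) (f : ℝ → ℝ≥0∞) :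
    ∫⁻ r in Ioi c, f r = ∫⁻ r in Ioi (0 : ℝ), (Ioi c).indicator f r := by
  rw [setLIntegral_indicator measurableSet_Ioi, inter_eq_left.2 (Ioi_subset_Ioi hc.le)]

/-- The two tiers have different cutoffs in distance, `invL z` and `invN z`, but both correspond to
the single cutoff `z` in path loss. -/
lemma Valid.V_eq (hp : p.Valid) {z : ℝ} (hz : 0 < z) (T lam : ℝ) :
    p.V z T lam = expNeg (ENNReal.ofReal (2 * π * lam) *
      p.radial ((Ioi z).indicator fun l => ENNReal.ofReal (T * z / (T * z + l)))) := by
  have hβ := hp.β_pos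
  have hL := hp.αL_pos
  have hN := hp.αN_pos
  unfold V radial
  rw [setLIntegral_Ioi_eq (c := p.invL z) (by unfold invL; positivity),
    setLIntegral_Ioi_eq (c := p.invN z) (by unfold invN; positivity)]
  congr 3
  · refine setLIntegral_congr_fun measurableSet_Ioi fun r hr => ?_
    have hr' : (0 : ℝ) < r := hr
    have h4 := hp.h_nonneg r
    have hiff : p.lossL r ∈ Ioi z ↔ r ∈ Ioi (p.invL z) := lt_loss_iff hβ hL hz hr'
    by_cases h : r ∈ Ioi (p.invL z)
    · rw [indicator_of_mem h, indicator_of_mem (hiff.2 h), ← ENNReal.ofReal_mul (by positivity)]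
      congr 1; ring
    · rw [indicator_of_notMem h, indicator_of_notMem (mt hiff.1 h), mul_zero]
  · refine setLIntegral_congr_fun measurableSet_Ioi fun r hr => ?_
    have hr' : (0 : ℝ) < r := hr
    have h4 := hp.one_sub_h_nonneg r
    have hiff : p.lossN r ∈ Ioi z ↔ r ∈ Ioi (p.invN z) := lt_loss_iff hβ hN hz hr'
    by_cases h : r ∈ Ioi (p.invN z)
    · rw [indicator_of_mem h, indicator_of_mem (hiff.2 h), ← ENNReal.ofReal_mul (by positivity)]
      congr 1; ring
    · rw [indicator_of_notMem h, indicator_of_notMem (mt hiff.1 h), mul_zero]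

/-- The probability that no link of path loss at most `z` starts in a given sector. -/
def voidProb (p : Params) (z : ℝ) : ℝ≥0∞ :=
  lap (ENNReal.ofReal (2 * π * (p.lam / p.Kcs)) * p.radial ((Iic z).indicator 1))

lemma lintegral_Ioc_eq {a : ℝ → ℝ} (ha : Measurable a) (h0 : ∀ r, 0 ≤ a r) (h1 : ∀ r, a r ≤ 1)
    {c : ℝ} (hc : 0 ≤ c) :
    ∫⁻ r in Ioc 0 c, ENNReal.ofReal (a r * r) = ENNReal.ofReal (∫ r in (0 : ℝ)..c, a r * r) := by
  have hi : IntegrableOn (fun r => a r * r) (Ioc 0 c) := by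
    have h2 : IntegrableOn (fun r : ℝ => r) (Ioc 0 c) :=
      (continuous_id.integrableOn_Icc).mono_set Ioc_subset_Icc_self
    refine h2.mono' (by fun_prop) ?_
    filter_upwards [ae_restrict_mem measurableSet_Ioc] with r hr
    have := hr.1
    rw [Real.norm_of_nonneg (mul_nonneg (h0 r) this.le)]
    exact mul_le_of_le_one_left this.le (h1 r)
  rw [intervalIntegral.integral_of_le hc, ofReal_integral_eq_lintegral_ofReal hi]
  filter_upwards [ae_restrict_mem measurableSet_Ioc] with r hr
  exact mul_nonneg (h0 r) hr.1.le

lemma Valid.Mcs_pos (hp : p.Valid) : 0 < p.Mcs := by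
  have h1 := hp.fastCS_range
  unfold Mcs
  cases h : p.protocol with
  | fastCS m => exact lt_of_lt_of_le hp.N_pos (h1 m h).1
  | _ => exact hp.M_pos

lemma Valid.Kcs_pos (hp : p.Valid) : 0 < p.Kcs := lt_of_lt_of_le hp.Mcs_pos (le_max_left _ _)

lemma Valid.radial_Iic (hp : p.Valid) {z : ℝ} (hz : 0 < z) :
    p.radial ((Iic z).indicator 1) =
      ENNReal.ofReal (∫ r in (0 : ℝ)..p.invL z, p.h r * r) +
        ENNReal.ofReal (∫ r in (0 : ℝ)..p.invN z, (1 - p.h r) * r) := by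
  have hβ := hp.β_pos
  have hL := hp.αL_pos
  have hN := hp.αN_pos
  have hh := hp.h_meas
  have hiL : 0 ≤ p.invL z := by unfold invL; positivity
  have hiN : 0 ≤ p.invN z := by unfold invN; positivity
  rw [← lintegral_Ioc_eq hh hp.h_nonneg hp.h_le_one hiL,
    ← lintegral_Ioc_eq (a := fun r => 1 - p.h r) (by fun_prop) hp.one_sub_h_nonneg
      (fun r => by linarith [hp.h_nonneg r]) hiN]
  unfold radial
  rw [← Ioi_inter_Iic, ← Ioi_inter_Iic, inter_comm, inter_comm (Ioi 0),
    ← setLIntegral_indicator measurableSet_Iic, ← setLIntegral_indicator measurableSet_Iic]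
  congr 1
  · refine setLIntegral_congr_fun measurableSet_Ioi fun r hr => ?_
    have hr' : (0 : ℝ) < r := hr
    have hiff : p.lossL r ∈ Iic z ↔ r ∈ Iic (p.invL z) := by
      have := not_congr (lt_loss_iff hβ hL hz hr')
      rw [not_lt, not_lt] at this
      exact this
    by_cases h : r ∈ Iic (p.invL z)
    · rw [indicator_of_mem h, indicator_of_mem (hiff.2 h), Pi.one_apply, mul_one]
    · rw [indicator_of_notMem h, indicator_of_notMem (mt hiff.1 h), mul_zero]
  · refine setLIntegral_congr_fun measurableSet_Ioi fun r hr => ?_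
    have hr' : (0 : ℝ) < r := hr
    have hiff : p.lossN r ∈ Iic z ↔ r ∈ Iic (p.invN z) := by
      have := not_congr (lt_loss_iff hβ hN hz hr')
      rw [not_lt, not_lt] at this
      exact this
    by_cases h : r ∈ Iic (p.invN z)
    · rw [indicator_of_mem h, indicator_of_mem (hiff.2 h), Pi.one_apply, mul_one]
    · rw [indicator_of_notMem h, indicator_of_notMem (mt hiff.1 h), mul_zero]

/-- The density of a minimum is the intensity of points at level `z` times the probability of no
point up to level `z`. This is the form in which the Mecke formula produces it. -/
lemma Valid.fZ₁_eq (hp : p.Valid) {z : ℝ} (hz : 0 < z) :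
    ENNReal.ofReal (p.fZ₁ z) = ENNReal.ofReal (2 * π * (p.lam / p.Kcs)) *
      (ENNReal.ofReal (p.lossDensity z) * p.voidProb z) := by
  have hβ := hp.β_pos
  have hL := hp.αL_pos
  have hN := hp.αN_pos
  have hpi := Real.pi_pos
  have hlam := hp.lam_pos
  have hK : (0 : ℝ) < p.Kcs := by exact_mod_cast hp.Kcs_pos
  have hiL : 0 ≤ p.invL z := by unfold invL; positivity
  have hiN : 0 ≤ p.invN z := by unfold invN; positivity
  have hrad := hp.radial_Iic hz
  have hIL : 0 ≤ ∫ r in (0 : ℝ)..p.invL z, p.h r * r :=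
    intervalIntegral.integral_nonneg hiL fun r hr => mul_nonneg (hp.h_nonneg r) hr.1
  have hIN : 0 ≤ ∫ r in (0 : ℝ)..p.invN z, (1 - p.h r) * r :=
    intervalIntegral.integral_nonneg hiN fun r hr => mul_nonneg (hp.one_sub_h_nonneg r) hr.1
  have hd := hp.lossDensity_nonneg hz
  rw [voidProb, hrad, ← ENNReal.ofReal_add hIL hIN, ← ENNReal.ofReal_mul (by positivity),
    lap_ofReal (by positivity), ← ENNReal.ofReal_mul hd, ← ENNReal.ofReal_mul (by positivity)]
  congr 1
  rw [fZ₁, lossDensity, mul_assoc _ (Real.exp _), ← Real.exp_add]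
  ring_nf

end Params

end

end MmWave


namespace MmWave

noncomputable section

open Filter Topology

namespace Params

variable {p : Params}

/-! ## Detection in a sector as a functional of the marked process -/

/-- Points of a sector whose path loss satisfies a condition. -/
def sectorSet {α : Type*} (p : Params) (j : Fin p.Kcs) (A : Set ℝ≥0∞) : Set ((ℂ × Bool) × α) :=
  {y | y.1.1 ∈ p.bsSector j ∧ ENNReal.ofReal (p.loss y.1) ∈ A}

lemma sectorSet_mono {α : Type*} (j : Fin p.Kcs) {A B : Set ℝ≥0∞} (h : A ⊆ B) :
    (p.sectorSet j A : Set ((ℂ × Bool) × α)) ⊆ p.sectorSet j B := fun _ hy => ⟨hy.1, h hy.2⟩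

lemma measurableSet_bsSector (j : Fin p.Kcs) : MeasurableSet (p.bsSector j) :=
  measurableSet_eqSector j

lemma measurable_ofReal_loss : Measurable fun y : ℂ × Bool => ENNReal.ofReal (p.loss y) :=
  p.measurable_loss.ennreal_ofReal

lemma measurableSet_sectorSet {α : Type*} [MeasurableSpace α] (j : Fin p.Kcs) {A : Set ℝ≥0∞}
    (hA : MeasurableSet A) : MeasurableSet (p.sectorSet j A : Set ((ℂ × Bool) × α)) :=
  ((measurableSet_bsSector j).preimage (measurable_fst.comp measurable_fst)).inter
    ((measurable_ofReal_loss.comp measurable_fst) hA)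

/-- Minimum path loss of the points of a measure in a sector. -/
def minLossOf (p : Params) (j : Fin p.Kcs) (ν : Measure ((ℂ × Bool) × ℝ)) : ℝ≥0∞ :=
  sInf {z | ν (p.sectorSet j (Iic z)) ≠ 0}

/-- Power received from the points of given path loss in a sector. -/
def signalOf (p : Params) (j : Fin p.Kcs) (z : ℝ≥0∞) (ν : Measure ((ℂ × Bool) × ℝ)) : ℝ≥0∞ :=
  ∫⁻ y in p.sectorSet j {z}, ENNReal.ofReal y.2 ∂ν

/-- Interference from the points of larger path loss in a sector. -/
def interfOf (p : Params) (j : Fin p.Kcs) (z : ℝ≥0∞) (ν : Measure ((ℂ × Bool) × ℝ)) : ℝ≥0∞ :=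
  ∫⁻ y in p.sectorSet j (Ioi z), ENNReal.ofReal (y.2 / p.loss y.1) ∂ν

/-- Normalised noise power in cell search. -/
def noiseCS (p : Params) : ℝ≥0∞ := ENNReal.ofReal (p.noise / (p.Pb * p.Mcs * p.Gcs))

/-- SINR in a sector for a given path loss of the serving point. -/
def sinrOf (p : Params) (j : Fin p.Kcs) (z : ℝ≥0∞) (ν : Measure ((ℂ × Bool) × ℝ)) : ℝ≥0∞ :=
  p.signalOf j z ν / z / (p.interfOf j z ν + p.noiseCS)

open Classical in
/-- The minimum path loss in a sector if the sector is detected, and `∞` otherwise. -/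
def detLoss (p : Params) (j : Fin p.Kcs) (ν : Measure ((ℂ × Bool) × ℝ)) : ℝ≥0∞ :=
  if ENNReal.ofReal p.Γcs ≤ p.sinrOf j (p.minLossOf j ν) ν then p.minLossOf j ν else ∞

/-- Expresses the infimum through the mass of one measurable set, for an arbitrary measure;
measurability of the minimum follows with no exceptional configurations. -/
lemma minLossOf_lt_iff (j : Fin p.Kcs) (ν : Measure ((ℂ × Bool) × ℝ)) (c : ℝ≥0∞) :
    p.minLossOf j ν < c ↔ ν (p.sectorSet j (Iio c)) ≠ 0 := by
  unfold minLossOf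
  rw [sInf_lt_iff]
  constructor
  · rintro ⟨z, hz, hzc⟩ h0
    exact hz (measure_mono_null (sectorSet_mono j fun _ hy => lt_of_le_of_lt hy hzc) h0)
  · intro h
    by_contra! hcon
    refine h ?_
    obtain ⟨u, -, huc, hu⟩ : ∃ u : ℕ → ℝ≥0∞, Monotone u ∧ (∀ n, c ≠ 0 → u n < c) ∧
        (∀ y < c, ∃ n, y ≤ u n) := by
      by_cases hc : c = 0
      · exact ⟨fun _ => 0, monotone_const, fun n h => absurd hc h, fun y hy => by simp [hc] at hy⟩
      · obtain ⟨u, hu1, hu2, hu3⟩ := exists_seq_strictMono_tendsto' (pos_iff_ne_zero.2 hc)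
        refine ⟨u, hu1.monotone, fun n _ => (hu2 n).2, fun y hy => ?_⟩
        obtain ⟨n, hn⟩ := (hu3.eventually (lt_mem_nhds hy)).exists
        exact ⟨n, hn.le⟩
    have hsub : (p.sectorSet j (Iio c) : Set ((ℂ × Bool) × ℝ)) ⊆ ⋃ n, p.sectorSet j (Iic (u n) ∩ Iio c) := by
      rintro y ⟨hy1, hy2⟩
      obtain ⟨n, hn⟩ := hu _ hy2
      exact mem_iUnion.2 ⟨n, hy1, hn, hy2⟩
    refine measure_mono_null hsub (measure_iUnion_null fun n => ?_)
    by_cases hc : c = 0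
    · refine measure_mono_null (t := ∅) ?_ measure_empty
      rintro y ⟨-, -, hy⟩
      simp [hc] at hy
    · by_contra hne
      have hne' : ν (p.sectorSet j (Iic (u n))) ≠ 0 := fun h0 =>
        hne (measure_mono_null (sectorSet_mono j inter_subset_left) h0)
      exact absurd (huc n hc) (not_lt.2 (hcon _ hne'))

lemma measurable_minLossOf (j : Fin p.Kcs) : Measurable (p.minLossOf j) := by
  refine measurable_of_Iio fun c => ?_
  have : p.minLossOf j ⁻¹' Iio c = {ν | ν (p.sectorSet j (Iio c)) ≠ 0} := by
    ext ν; exact minLossOf_lt_iff j ν c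
  rw [this]
  exact (Measure.measurable_coe (measurableSet_sectorSet j measurableSet_Iio))
    (measurableSet_singleton 0).compl

/-- Integrals over parametrised sets of the points of a sector are measurable. -/
lemma measurable_lintegral_sectorSet {α : Type*} [MeasurableSpace α] (j : Fin p.Kcs)
    (κ : Kernel (Measure ((ℂ × Bool) × α)) ((ℂ × Bool) × α)) [IsSFiniteKernel κ]
    {A : ℝ≥0∞ → Set ℝ≥0∞} (hA : MeasurableSet {q : ℝ≥0∞ × ℝ≥0∞ | q.2 ∈ A q.1})
    {f : (ℂ × Bool) × α → ℝ≥0∞} (hf : Measurable f) :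
    Measurable fun q : ℝ≥0∞ × Measure ((ℂ × Bool) × α) => ∫⁻ y in p.sectorSet j (A q.1), f y ∂(κ q.2) := by
  have hA1 : ∀ z, MeasurableSet (A z) := fun z => measurable_prodMk_left hA
  have h1 : ∀ q : ℝ≥0∞ × Measure ((ℂ × Bool) × α), ∫⁻ y in p.sectorSet j (A q.1), f y ∂(κ q.2) =
      ∫⁻ y, {r : ℝ≥0∞ × ((ℂ × Bool) × α) | r.2 ∈ p.sectorSet j (A r.1)}.indicator (fun r => f r.2)
        (q.1, y) ∂(Kernel.prodMkLeft ℝ≥0∞ κ q) := by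
    intro q
    rw [← lintegral_indicator (measurableSet_sectorSet j (hA1 q.1)), Kernel.prodMkLeft_apply]
    rfl
  simp_rw [h1]
  have hm : MeasurableSet {r : ℝ≥0∞ × ((ℂ × Bool) × α) | r.2 ∈ p.sectorSet j (A r.1)} := by
    have h2 : Measurable fun r : ℝ≥0∞ × ((ℂ × Bool) × α) => (r.1, ENNReal.ofReal (p.loss r.2.1)) :=
      measurable_fst.prodMk (measurable_ofReal_loss.comp (measurable_fst.comp measurable_snd))
    exact ((measurableSet_bsSector j).preimage
      (measurable_fst.comp (measurable_fst.comp measurable_snd))).inter (h2 hA)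
  have hg : Measurable ({r : ℝ≥0∞ × ((ℂ × Bool) × α) | r.2 ∈ p.sectorSet j (A r.1)}.indicator
      (fun r => f r.2)) := (hf.comp measurable_snd).indicator hm
  exact Measurable.lintegral_kernel_prod_right' (κ := Kernel.prodMkLeft ℝ≥0∞ κ)
    (f := fun r : (ℝ≥0∞ × Measure ((ℂ × Bool) × α)) × ((ℂ × Bool) × α) =>
      {r : ℝ≥0∞ × ((ℂ × Bool) × α) | r.2 ∈ p.sectorSet j (A r.1)}.indicator (fun r => f r.2)
        (r.1.1, r.2))
    (hg.comp ((measurable_fst.comp measurable_fst).prodMk measurable_snd))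

lemma measurable_interfOf (j : Fin p.Kcs)
    (κ : Kernel (Measure ((ℂ × Bool) × ℝ)) ((ℂ × Bool) × ℝ)) [IsSFiniteKernel κ] :
    Measurable fun q : ℝ≥0∞ × Measure ((ℂ × Bool) × ℝ) => p.interfOf j q.1 (κ q.2) :=
  measurable_lintegral_sectorSet j κ (A := fun z => Ioi z)
    (measurableSet_lt measurable_fst measurable_snd)
    (measurable_snd.div (p.measurable_loss.comp measurable_fst)).ennreal_ofReal

lemma measurable_sinrOf (j : Fin p.Kcs)
    (κ : Kernel (Measure ((ℂ × Bool) × ℝ)) ((ℂ × Bool) × ℝ)) [IsSFiniteKernel κ] :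
    Measurable fun q : ℝ≥0∞ × Measure ((ℂ × Bool) × ℝ) => p.sinrOf j q.1 (κ q.2) := by
  have h1 : Measurable fun q : ℝ≥0∞ × Measure ((ℂ × Bool) × ℝ) => p.signalOf j q.1 (κ q.2) :=
    measurable_lintegral_sectorSet j κ (A := fun z => {z})
      (measurableSet_eq_fun measurable_snd measurable_fst) measurable_snd.ennreal_ofReal
  exact (h1.div measurable_fst).div ((measurable_interfOf j κ).add_const _)

/-- The functional `detLoss` agrees with a measurable functional on the fixed points of an s-finite
kernel. -/
lemma exists_measurable_detLoss (j : Fin p.Kcs)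
    (κ : Kernel (Measure ((ℂ × Bool) × ℝ)) ((ℂ × Bool) × ℝ)) [IsSFiniteKernel κ] :
    ∃ D : Measure ((ℂ × Bool) × ℝ) → ℝ≥0∞, Measurable D ∧ ∀ ν, κ ν = ν → D ν = p.detLoss j ν := by
  classical
  have h1 : Measurable fun ν => (p.minLossOf j ν, ν) :=
    (measurable_minLossOf j).prodMk measurable_id
  have h2 : Measurable fun ν => p.sinrOf j (p.minLossOf j ν) (κ ν) := by
    have := (measurable_sinrOf j κ).comp h1
    simp only [Function.comp_def] at this
    exact this
  have h3 : MeasurableSet {ν | ENNReal.ofReal p.Γcs ≤ p.sinrOf j (p.minLossOf j ν) (κ ν)} :=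
    measurableSet_le measurable_const h2
  have h4 : Measurable fun _ : Measure ((ℂ × Bool) × ℝ) => (∞ : ℝ≥0∞) := measurable_const
  refine ⟨piecewise {ν | ENNReal.ofReal p.Γcs ≤ p.sinrOf j (p.minLossOf j ν) (κ ν)} (p.minLossOf j)
    fun _ => ∞, (measurable_minLossOf j).piecewise h3 h4, fun ν hν => ?_⟩
  unfold detLoss
  by_cases h : ENNReal.ofReal p.Γcs ≤ p.sinrOf j (p.minLossOf j ν) ν
  · rw [if_pos h]
    exact piecewise_eq_of_mem _ _ _ (show ENNReal.ofReal p.Γcs ≤ p.sinrOf j (p.minLossOf j ν) (κ ν) by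
      rwa [hν])
  · rw [if_neg h]
    exact piecewise_eq_of_notMem _ _ _
      (show ¬ ENNReal.ofReal p.Γcs ≤ p.sinrOf j (p.minLossOf j ν) (κ ν) by rwa [hν])

/-- Detection in a sector depends only on the points of that sector; independence between sectors
rests on this. -/
lemma detLoss_restrict (j : Fin p.Kcs) (ν : Measure ((ℂ × Bool) × ℝ)) :
    p.detLoss j (ν.restrict (p.sectorSet j univ)) = p.detLoss j ν := by
  have hm : ∀ {A : Set ℝ≥0∞}, MeasurableSet A →
      (ν.restrict (p.sectorSet j univ)).restrict (p.sectorSet j A) = ν.restrict (p.sectorSet j A) := by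
    intro A hA
    rw [Measure.restrict_restrict (measurableSet_sectorSet j hA),
      inter_eq_left.2 (show p.sectorSet j A ⊆ p.sectorSet j univ from fun y hy => ⟨hy.1, trivial⟩)]
  have h1 : p.minLossOf j (ν.restrict (p.sectorSet j univ)) = p.minLossOf j ν := by
    unfold minLossOf
    congr 1
    ext z
    have h2 : MeasurableSet (p.sectorSet j (Iic z) : Set ((ℂ × Bool) × ℝ)) :=
      measurableSet_sectorSet j measurableSet_Iic
    change _ ≠ 0 ↔ _ ≠ 0
    rw [← Measure.restrict_apply_self, hm measurableSet_Iic, Measure.restrict_apply_self]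
  have h3 : ∀ z, p.sinrOf j z (ν.restrict (p.sectorSet j univ)) = p.sinrOf j z ν := by
    intro z
    unfold sinrOf signalOf interfOf
    rw [hm (measurableSet_singleton z), hm measurableSet_Ioi]
  unfold detLoss
  rw [h1, h3]

/-! ## The point of minimum path loss -/

/-- The event that a point of a measure has the minimum path loss in its sector and is detected. -/
def peakSet (p : Params) (j : Fin p.Kcs) (ν : Measure ((ℂ × Bool) × ℝ)) : Set ((ℂ × Bool) × ℝ) :=
  {x | x.1.1 ∈ p.bsSector j ∧ ν (p.sectorSet j (Iic (ENNReal.ofReal (p.loss x.1)))) ≤ 1 ∧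
    ENNReal.ofReal p.Γcs ≤ ENNReal.ofReal x.2 / ENNReal.ofReal (p.loss x.1) /
      (p.interfOf j (ENNReal.ofReal (p.loss x.1)) ν + p.noiseCS)}

lemma lintegral_sum_dirac {E : Type*} [MeasurableSpace E] [MeasurableSingletonClass E] {I : Set ℕ}
    (x : I → E) (f : E → ℝ≥0∞) :
    ∫⁻ y, f y ∂(Measure.sum fun i => Measure.dirac (x i)) = ∑' i, f (x i) := by
  rw [lintegral_sum_measure]
  simp_rw [lintegral_dirac]

lemma setLIntegral_sum_dirac {E : Type*} [MeasurableSpace E] [MeasurableSingletonClass E] {I : Set ℕ}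
    (x : I → E) (f : E → ℝ≥0∞) {A : Set E} (hA : MeasurableSet A) :
    ∫⁻ y in A, f y ∂(Measure.sum fun i => Measure.dirac (x i)) = ∑' i, A.indicator f (x i) := by
  rw [← lintegral_indicator hA, lintegral_sum_dirac]

lemma sum_dirac_apply {E : Type*} [MeasurableSpace E] {I : Set ℕ}
    (x : I → E) {A : Set E} (hA : MeasurableSet A) :
    (Measure.sum fun i => Measure.dirac (x i)) A = ∑' i, A.indicator 1 (x i) := by
  rw [Measure.sum_apply _ hA]
  simp_rw [Measure.dirac_apply' _ hA]

lemma sum_dirac_ne_zero_iff {E : Type*} [MeasurableSpace E] {I : Set ℕ}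
    (x : I → E) {A : Set E} (hA : MeasurableSet A) :
    (Measure.sum fun i => Measure.dirac (x i)) A ≠ 0 ↔ ∃ i, x i ∈ A := by
  rw [sum_dirac_apply x hA, ne_eq, ENNReal.tsum_eq_zero, not_forall]
  simp

lemma two_le_sum_dirac {E : Type*} [MeasurableSpace E] {I : Set ℕ}
    (x : I → E) {A : Set E} (hA : MeasurableSet A) {i j : I} (hij : i ≠ j) (hi : x i ∈ A)
    (hj : x j ∈ A) : 2 ≤ (Measure.sum fun i => Measure.dirac (x i)) A := by
  classical
  rw [sum_dirac_apply x hA]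
  refine le_trans (le_of_eq ?_) (ENNReal.sum_le_tsum {i, j})
  rw [Finset.sum_pair hij, indicator_of_mem hi, indicator_of_mem hj]
  simp only [Pi.one_apply]
  norm_num

lemma finite_of_sum_dirac_ne_top {E : Type*} [MeasurableSpace E] {I : Set ℕ}
    (x : I → E) {A : Set E} (hA : MeasurableSet A)
    (h : (Measure.sum fun i => Measure.dirac (x i)) A ≠ ∞) : {i | x i ∈ A}.Finite := by
  rw [sum_dirac_apply x hA] at h
  have := ENNReal.finite_const_le_of_tsum_ne_top h one_ne_zero
  refine this.subset fun i hi => ?_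
  have hi' : x i ∈ A := hi
  simp [hi']

/-- For a counting measure without ties, the integral over the detected point of minimum path loss is
evaluation at `detLoss`. -/
lemma Valid.lintegral_peakSet (hp : p.Valid) (j : Fin p.Kcs) {I : Set ℕ} (x : I → (ℂ × Bool) × ℝ)
    {ν : Measure ((ℂ × Bool) × ℝ)} (hν : ν = Measure.sum fun i => Measure.dirac (x i))
    (hfin : ∀ n : ℕ, ν (p.sectorSet j (Iic (n : ℝ≥0∞))) ≠ ∞)
    (htie : ∀ i, (x i).1.1 ∈ p.bsSector j →
      ν (p.sectorSet j {ENNReal.ofReal (p.loss (x i).1)}) ≤ 1)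
    {φ : ℝ≥0∞ → ℝ≥0∞} (hφ : φ ∞ = 0) :
    ∫⁻ y, (p.peakSet j ν).indicator (fun y => φ (ENNReal.ofReal (p.loss y.1))) y ∂ν =
      φ (p.detLoss j ν) := by
  classical
  have hsec : ∀ {A : Set ℝ≥0∞}, MeasurableSet A →
      MeasurableSet (p.sectorSet j A : Set ((ℂ × Bool) × ℝ)) := fun hA => measurableSet_sectorSet j hA
  conv_lhs => rw [hν, lintegral_sum_dirac, ← hν]
  have hΓ : 0 < ENNReal.ofReal p.Γcs := ENNReal.ofReal_pos.2 hp.Γcs_pos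
  -- An empty sector has no signal, so its SINR `0` misses the positive threshold, and both sides
  -- vanish because `φ ∞ = 0`.
  by_cases hne : ∃ i, (x i).1.1 ∈ p.bsSector j
  swap
  · push Not at hne
    have h0 : ∀ A : Set ℝ≥0∞, MeasurableSet A → ν (p.sectorSet j A) = 0 := by
      intro A hA
      by_contra h
      rw [hν, ← ne_eq, sum_dirac_ne_zero_iff x (hsec hA)] at h
      obtain ⟨i, hi⟩ := h
      exact hne i hi.1
    have hs : p.signalOf j (p.minLossOf j ν) ν = 0 :=
      setLIntegral_measure_zero _ _ (h0 _ (measurableSet_singleton _))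
    have hd : p.detLoss j ν = ∞ := by
      rw [detLoss, if_neg]
      rw [sinrOf, hs, ENNReal.zero_div, ENNReal.zero_div]
      exact not_le.2 hΓ
    rw [hd, hφ, ENNReal.tsum_eq_zero]
    intro i
    exact indicator_of_notMem (fun h => hne i h.1) _
  obtain ⟨k, hk⟩ := hne
  -- Below the level `n` there are finitely many points and at least one, so the infimum of the path
  -- losses is attained.
  obtain ⟨n, hn⟩ : ∃ n : ℕ, ENNReal.ofReal (p.loss (x k).1) ≤ n :=
    ENNReal.exists_nat_gt ENNReal.ofReal_ne_top |>.imp fun n h => h.le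
  have hfinite : {i | x i ∈ (p.sectorSet j (Iic (n : ℝ≥0∞)) : Set ((ℂ × Bool) × ℝ))}.Finite :=
    finite_of_sum_dirac_ne_top x (hsec measurableSet_Iic) (by rw [← hν]; exact hfin n)
  obtain ⟨m, hm, hmin⟩ := hfinite.exists_minimalFor (fun i => ENNReal.ofReal (p.loss (x i).1)) _ ⟨k, hk, hn⟩
  have hmin' : ∀ i, (x i).1.1 ∈ p.bsSector j →
      ENNReal.ofReal (p.loss (x m).1) ≤ ENNReal.ofReal (p.loss (x i).1) := by
    intro i hi
    by_cases hin : ENNReal.ofReal (p.loss (x i).1) ≤ n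
    · rcases le_total (ENNReal.ofReal (p.loss (x m).1)) (ENNReal.ofReal (p.loss (x i).1)) with h | h
      · exact h
      · exact hmin ⟨hi, hin⟩ h
    · exact le_trans hm.2 (not_le.1 hin).le
  set l := ENNReal.ofReal (p.loss (x m).1) with hl
  have hstrict : ∀ i, i ≠ m → (x i).1.1 ∈ p.bsSector j → l < ENNReal.ofReal (p.loss (x i).1) := by
    intro i him hi
    refine lt_of_le_of_ne (hmin' i hi) fun heq => ?_
    have h2 := two_le_sum_dirac x (hsec (measurableSet_singleton l)) him ⟨hi, heq.symm⟩ ⟨hm.1, rfl⟩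
    rw [← hν] at h2
    exact absurd (h2.trans (htie m hm.1)) (by norm_num)
  have hminLoss : p.minLossOf j ν = l := by
    have : {z | ν (p.sectorSet j (Iic z)) ≠ 0} = Ici l := by
      ext z
      change ν (p.sectorSet j (Iic z)) ≠ 0 ↔ l ≤ z
      rw [hν, sum_dirac_ne_zero_iff x (hsec measurableSet_Iic)]
      constructor
      · rintro ⟨i, hi1, hi2⟩
        exact (hmin' i hi1).trans hi2
      · intro hz
        exact ⟨m, hm.1, hz⟩
    rw [minLossOf, this]
    exact csInf_Ici
  have hsignal : p.signalOf j l ν = ENNReal.ofReal (x m).2 := by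
    rw [signalOf, hν, setLIntegral_sum_dirac x _ (hsec (measurableSet_singleton l)),
      tsum_eq_single m]
    · rw [indicator_of_mem]
      exact ⟨hm.1, rfl⟩
    · intro i him
      refine indicator_of_notMem (fun h => ?_) _
      exact (hstrict i him h.1).ne' h.2
  rw [tsum_eq_single m]
  · have hone : ν (p.sectorSet j (Iic l)) ≤ 1 := by
      rw [hν, sum_dirac_apply x (hsec measurableSet_Iic), tsum_eq_single m]
      · exact indicator_le_self' (fun _ _ => zero_le) _
      · intro i him
        refine indicator_of_notMem (fun h => ?_) _
        exact absurd h.2 (not_le.2 (hstrict i him h.1))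
    rw [detLoss, hminLoss, sinrOf, hsignal]
    by_cases hdet : ENNReal.ofReal p.Γcs ≤ ENNReal.ofReal (x m).2 / l / (p.interfOf j l ν + p.noiseCS)
    · rw [if_pos hdet, indicator_of_mem]
      exact ⟨hm.1, hone, hdet⟩
    · rw [if_neg hdet, hφ, indicator_of_notMem]
      exact fun h => hdet h.2.2
  -- A point other than the minimum sees at least two points up to its own level, itself and the
  -- minimum, which contradicts the bound `1` in `peakSet`.
  · intro i him
    refine indicator_of_notMem (fun h => ?_) _
    have h2 := two_le_sum_dirac x (hsec (measurableSet_Iic (a := ENNReal.ofReal (p.loss (x i).1)))) him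
      ⟨h.1, self_mem_Iic⟩ ⟨hm.1, (hstrict i him h.1).le⟩
    rw [← hν] at h2
    exact absurd (h2.trans h.2.1) (by norm_num)

end Params

end

end MmWave


namespace MmWave

noncomputable section

open Filter Topology

namespace Params

variable {p : Params}

/-! ## Integrals of functions of path loss and mark -/

lemma measurable_lossTier {f : ℝ → ℝ≥0∞} (hf : Measurable f) (hp : p.Valid) :
    Measurable (fun r => ENNReal.ofReal (p.h r * r) * f (p.lossL r)) ∧
      Measurable (fun r => ENNReal.ofReal ((1 - p.h r) * r) * f (p.lossN r)) := by
  have hh := hp.h_meas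
  have hL := p.measurable_lossL
  have hN := p.measurable_lossN
  constructor <;> fun_prop

lemma Valid.radial_add (hp : p.Valid) {φ ψ : ℝ → ℝ≥0∞} (hφ : Measurable φ) :
    p.radial (fun l => φ l + ψ l) = p.radial φ + p.radial ψ := by
  have h1 := measurable_lossTier hφ hp
  unfold radial
  simp_rw [mul_add]
  rw [lintegral_add_left h1.1, lintegral_add_left h1.2]
  ring

lemma Valid.radial_const_mul (hp : p.Valid) (c : ℝ≥0∞) {φ : ℝ → ℝ≥0∞} (hφ : Measurable φ) :
    p.radial (fun l => c * φ l) = c * p.radial φ := by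
  have h1 := measurable_lossTier hφ hp
  unfold radial
  simp_rw [mul_left_comm _ c]
  rw [lintegral_const_mul _ h1.1, lintegral_const_mul _ h1.2]
  ring

lemma Valid.lintegral_loss_mark (hp : p.Valid) {lam : ℝ} (hlam : 0 ≤ lam) {A : Set ℂ} {c : ℝ}
    (hA : IsRadialPart A c) {α : Type*} [MeasurableSpace α] (M : Measure α) [SFinite M]
    {f : ℝ × α → ℝ≥0∞} (hf : Measurable f) :
    ∫⁻ y in {y : (ℂ × Bool) × α | y.1.1 ∈ A}, f (p.loss y.1, y.2) ∂((p.linkIntensity lam).prod M) =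
      ENNReal.ofReal (2 * π * (lam * c)) * p.radial fun l => ∫⁻ m, f (l, m) ∂M := by
  have := hp.sigmaFinite_linkIntensity lam
  have hs : {y : (ℂ × Bool) × α | y.1.1 ∈ A} = {y : ℂ × Bool | y.1 ∈ A} ×ˢ (univ : Set α) := by
    ext y; simp
  have hf' : Measurable fun y : (ℂ × Bool) × α => f (p.loss y.1, y.2) :=
    hf.comp ((p.measurable_loss.comp measurable_fst).prodMk measurable_snd)
  rw [hs, setLIntegral_prod _ hf'.aemeasurable, Measure.restrict_univ]
  exact hp.lintegral_loss_eq_radial hlam hA (φ := fun l => ∫⁻ m, f (l, m) ∂M) hf.lintegral_prod_right'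

/-- Intensity of the marked process of base stations. -/
def csIntensity (p : Params) : Measure ((ℂ × Bool) × ℝ) := (p.linkIntensity p.lam).prod (expMeasure 1)

lemma Valid.sigmaFinite_csIntensity (hp : p.Valid) : SigmaFinite p.csIntensity := by
  have := hp.sigmaFinite_linkIntensity p.lam
  unfold csIntensity
  infer_instance

lemma Valid.lintegral_csIntensity (hp : p.Valid) (j : Fin p.Kcs) {f : ℝ × ℝ → ℝ≥0∞}
    (hf : Measurable f) :
    ∫⁻ y in {y : (ℂ × Bool) × ℝ | y.1.1 ∈ p.bsSector j}, f (p.loss y.1, y.2) ∂p.csIntensity =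
      ENNReal.ofReal (2 * π * (p.lam / p.Kcs)) * p.radial fun l => ∫⁻ m, f (l, m) ∂(expMeasure 1) := by
  rw [← mul_one_div p.lam]
  exact hp.lintegral_loss_mark hp.lam_pos.le (isRadialPart_eqSector j) _ hf

lemma Valid.csIntensity_sectorSet (hp : p.Valid) (j : Fin p.Kcs) {A : Set ℝ≥0∞}
    (hA : MeasurableSet A) :
    p.csIntensity (p.sectorSet j A) = ENNReal.ofReal (2 * π * (p.lam / p.Kcs)) *
      p.radial ((ENNReal.ofReal ⁻¹' A).indicator 1) := by
  have hm : Measurable fun q : ℝ × ℝ => (ENNReal.ofReal ⁻¹' A).indicator (1 : ℝ → ℝ≥0∞) q.1 :=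
    (measurable_one.indicator (ENNReal.measurable_ofReal hA)).comp measurable_fst
  have h1 := hp.lintegral_csIntensity j hm
  simp only [lintegral_const, measure_univ, mul_one] at h1
  refine Eq.trans ?_ h1
  have hSj : MeasurableSet {y : (ℂ × Bool) × ℝ | y.1.1 ∈ p.bsSector j} :=
    (measurableSet_bsSector j).preimage (measurable_fst.comp measurable_fst)
  rw [← lintegral_indicator_one (measurableSet_sectorSet j hA), ← lintegral_indicator hSj]
  refine lintegral_congr fun y => ?_
  by_cases hy : y.1.1 ∈ p.bsSector j
  · rw [indicator_of_mem (show y ∈ {y : (ℂ × Bool) × ℝ | y.1.1 ∈ p.bsSector j} from hy)]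
    by_cases hy2 : ENNReal.ofReal (p.loss y.1) ∈ A
    · rw [indicator_of_mem (show y ∈ p.sectorSet j A from ⟨hy, hy2⟩), indicator_of_mem (by exact hy2)]
      rfl
    · rw [indicator_of_notMem (fun h : y ∈ p.sectorSet j A => hy2 h.2),
        indicator_of_notMem (by exact hy2)]
  · rw [indicator_of_notMem (fun h : y ∈ p.sectorSet j A => hy h.1),
      indicator_of_notMem (show y ∉ {y : (ℂ × Bool) × ℝ | y.1.1 ∈ p.bsSector j} from hy)]

/-- Bounded path loss means bounded distance in each tier. The level is raised to `n + 1` so that it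
is positive also for `n = 0`. -/
lemma Valid.csIntensity_sectorSet_Iic_ne_top (hp : p.Valid) (j : Fin p.Kcs) (n : ℕ) :
    p.csIntensity (p.sectorSet j (Iic (n : ℝ≥0∞))) ≠ ∞ := by
  have hz : (0 : ℝ) < n + 1 := by positivity
  refine measure_ne_top_of_subset (sectorSet_mono j (B := Iic (ENNReal.ofReal (n + 1))) ?_) ?_
  · refine Iic_subset_Iic.2 ?_
    rw [← ENNReal.ofReal_natCast n]
    exact ENNReal.ofReal_le_ofReal (by linarith)
  · rw [hp.csIntensity_sectorSet j measurableSet_Iic]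
    refine ENNReal.mul_ne_top ENNReal.ofReal_ne_top ?_
    rw [hp.radial_congr (ψ := (Iic ((n : ℝ) + 1)).indicator 1), hp.radial_Iic hz]
    · simp
    · intro l hl
      have : l ∈ ENNReal.ofReal ⁻¹' Iic (ENNReal.ofReal (n + 1)) ↔ l ∈ Iic ((n : ℝ) + 1) := by
        simp only [mem_preimage, mem_Iic]
        exact ENNReal.ofReal_le_ofReal_iff hz.le
      by_cases h : l ∈ Iic ((n : ℝ) + 1)
      · rw [indicator_of_mem h, indicator_of_mem (this.2 h)]
      · rw [indicator_of_notMem h, indicator_of_notMem (mt this.1 h)]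

lemma Valid.csIntensity_sectorSet_singleton (hp : p.Valid) (j : Fin p.Kcs) (c : ℝ≥0∞) :
    p.csIntensity (p.sectorSet j {c}) = 0 := by
  rw [hp.csIntensity_sectorSet j (measurableSet_singleton c), hp.radial_eq
    (measurable_one.indicator (ENNReal.measurable_ofReal (measurableSet_singleton c)))]
  refine mul_eq_zero_of_right _ ?_
  rw [← nonpos_iff_eq_zero]
  calc ∫⁻ z in Ioi (0 : ℝ), ENNReal.ofReal (p.lossDensity z) *
        (ENNReal.ofReal ⁻¹' {c}).indicator 1 z
      = ∫⁻ z in Ioi (0 : ℝ), 0 := by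
        refine setLIntegral_congr_fun_ae measurableSet_Ioi ?_
        filter_upwards [Measure.ae_ne volume c.toReal] with z hz hz0
        rw [indicator_of_notMem, mul_zero]
        intro h
        have h' : ENNReal.ofReal z = c := h
        exact hz (by rw [← h', ENNReal.toReal_ofReal (le_of_lt hz0)])
    _ ≤ 0 := by simp

/-! ## Absence of ties -/

variable {Ω : Type*} [MeasurableSpace Ω] {μ : Measure Ω} {X : Ω → Measure ((ℂ × Bool) × ℝ)}

/-- By the Mecke formula the expected number of points that share their level with another is an
integral over an added point, and an independent level set through that point is almost surely empty
since path losses have a density. The statement covers every enumeration of the points, so no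
measurable choice of one is needed. -/
lemma Valid.ae_no_tie [IsProbabilityMeasure μ] (hp : p.Valid) (h : IsPPP X p.csIntensity μ)
    (j : Fin p.Kcs) : ∀ᵐ ω ∂μ, ∀ (I : Set ℕ) (x : I → (ℂ × Bool) × ℝ),
      X ω = Measure.sum (fun i => Measure.dirac (x i)) → ∀ i, (x i).1.1 ∈ p.bsSector j →
        X ω (p.sectorSet j {ENNReal.ofReal (p.loss (x i).1)}) ≤ 1 := by
  have := hp.sigmaFinite_csIntensity
  let κ := tame p.csIntensity
  let S : Set (((ℂ × Bool) × ℝ) × Measure ((ℂ × Bool) × ℝ)) :=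
    {q | q.1.1.1 ∈ p.bsSector j ∧ 1 < ∫⁻ _ in p.sectorSet j {ENNReal.ofReal (p.loss q.1.1)}, 1 ∂(κ q.2)}
  have hS : MeasurableSet S := by
    have h1 := measurable_lintegral_sectorSet j κ (A := fun z => {z}) (f := fun _ => 1)
      (measurableSet_eq_fun measurable_snd measurable_fst) measurable_const
    have h2 : Measurable fun q : ((ℂ × Bool) × ℝ) × Measure ((ℂ × Bool) × ℝ) =>
        (ENNReal.ofReal (p.loss q.1.1), q.2) :=
      (measurable_ofReal_loss.comp (measurable_fst.comp measurable_fst)).prodMk measurable_snd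
    have h3 := h1.comp h2
    simp only [Function.comp_def] at h3
    have h4 := measurableSet_lt (measurable_const (a := (1 : ℝ≥0∞))) h3
    have h5 : MeasurableSet {q : ((ℂ × Bool) × ℝ) × Measure ((ℂ × Bool) × ℝ) |
        q.1.1.1 ∈ p.bsSector j} :=
      (measurableSet_bsSector j).preimage (measurable_fst.comp (measurable_fst.comp measurable_fst))
    exact h5.inter h4
  have hF : Measurable (S.indicator (fun _ => (1 : ℝ≥0∞))) := measurable_const.indicator hS
  have h0 : ∫⁻ ω, ∫⁻ x, S.indicator (fun _ => (1 : ℝ≥0∞)) (x, X ω) ∂(X ω) ∂μ = 0 := by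
    rw [h.lintegral_lintegral hF]
    refine (lintegral_congr fun x => ?_).trans lintegral_zero
    set B : Set ((ℂ × Bool) × ℝ) := p.sectorSet j {ENNReal.ofReal (p.loss x.1)} with hB
    have hBm : MeasurableSet B := measurableSet_sectorSet j (measurableSet_singleton _)
    have hLB : p.csIntensity B = 0 := hp.csIntensity_sectorSet_singleton j _
    have h1 := h.lintegral_apply hBm (by rw [hLB]; exact ENNReal.zero_ne_top)
    rw [hLB, lintegral_eq_zero_iff (h.measurable_apply hBm)] at h1
    rw [← lintegral_zero (μ := μ)]
    refine lintegral_congr_ae ?_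
    filter_upwards [h1, h.ae_tame_add_dirac] with ω hω hκ
    refine indicator_of_notMem (fun hmem => ?_) _
    have h2 := hmem.2
    simp only [κ] at h2
    rw [hκ x, setLIntegral_one, Measure.add_apply] at h2
    have h3 : X ω B = 0 := hω
    rw [← hB, h3, zero_add] at h2
    exact absurd h2 (not_lt.2 prob_le_one)
  have hm : Measurable fun ω => ∫⁻ x, S.indicator (fun _ => (1 : ℝ≥0∞)) (x, X ω) ∂(κ (X ω)) := by
    have h1 : Measurable fun q : Ω × ((ℂ × Bool) × ℝ) => S.indicator (fun _ => (1 : ℝ≥0∞)) (q.2, X q.1) :=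
      hF.comp (measurable_snd.prodMk (h.measurable.comp measurable_fst))
    have := Measurable.lintegral_kernel_prod_right' (κ := κ.comap X h.measurable) h1
    simpa only [Kernel.comap_apply] using this
  have h0' : ∫⁻ ω, ∫⁻ x, S.indicator (fun _ => (1 : ℝ≥0∞)) (x, X ω) ∂(κ (X ω)) ∂μ = 0 := by
    rw [← h0]
    refine lintegral_congr_ae ?_
    filter_upwards [h.ae_tame] with ω hω
    simp only [κ, hω]
  rw [lintegral_eq_zero_iff hm] at h0'
  filter_upwards [h0', h.ae_tame] with ω hω hκ I x hx i hi
  have hω' : ∫⁻ x, S.indicator (fun _ => (1 : ℝ≥0∞)) (x, X ω) ∂(κ (X ω)) = 0 := hω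
  simp only [κ, hκ] at hω'
  conv at hω' => lhs; rw [hx, lintegral_sum_dirac, ← hx]
  rw [ENNReal.tsum_eq_zero] at hω'
  by_contra hcon
  have hmem : (x i, X ω) ∈ S := by
    refine ⟨hi, ?_⟩
    simp only [κ, hκ, setLIntegral_one]
    exact not_le.1 hcon
  have := hω' i
  rw [indicator_of_mem hmem] at this
  exact one_ne_zero this

end Params

end

end MmWave


namespace MmWave

noncomputable section

open Filter Topology

namespace Params

variable {p : Params}

/-! ## Antenna gains -/

lemma mainGain_pos {C₀ : ℝ} (hC : 0 < C₀) {n : ℕ} (hn : 0 < n) : 0 < mainGain C₀ (2 * π / n) := by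
  have hpi := Real.pi_pos
  have hn' : (1 : ℝ) ≤ n := by exact_mod_cast hn
  have hle : 2 * π / n ≤ 2 * π := div_le_self (by positivity) hn'
  unfold mainGain
  split_ifs with h
  · exact one_pos
  · have : 0 < 2 * π - 2 * π / n := sub_pos.2 (lt_of_le_of_ne hle h)
    positivity

lemma sideGain_nonneg {C₀ : ℝ} (hC : 0 < C₀) {n : ℕ} (hn : 0 < n) : 0 ≤ sideGain C₀ (2 * π / n) := by
  have hpi := Real.pi_pos
  have hn' : (1 : ℝ) ≤ n := by exact_mod_cast hn
  have hle : 2 * π / n ≤ 2 * π := div_le_self (by positivity) hn'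
  unfold sideGain
  split_ifs with h
  · exact le_rfl
  · have : 0 < 2 * π - 2 * π / n := sub_pos.2 (lt_of_le_of_ne hle h)
    positivity

lemma Valid.Ncs_pos (hp : p.Valid) : 0 < p.Ncs := by
  unfold Ncs
  cases p.protocol <;> simp [hp.N_pos]

lemma Valid.G_pos (hp : p.Valid) : 0 < p.G := mainGain_pos hp.C₀_pos hp.N_pos

lemma Valid.g_nonneg (hp : p.Valid) : 0 ≤ p.g := sideGain_nonneg hp.C₀_pos hp.N_pos

lemma Valid.Gcs_pos (hp : p.Valid) : 0 < p.Gcs := mainGain_pos hp.C₀_pos hp.Ncs_pos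

/-- Positive noise keeps the denominator from vanishing and a finite signal avoids `∞ / ∞`, so
infinite interference is covered without a separate case. -/
lemma le_sinr_iff {a s l i n : ℝ≥0∞} (hs : s ≠ ∞) (hl0 : l ≠ 0) (hn0 : n ≠ 0) :
    a ≤ s / l / (i + n) ↔ a * (i + n) * l ≤ s := by
  have h1 : s / l ≠ ∞ := ENNReal.div_ne_top hs hl0
  rw [ENNReal.le_div_iff_mul_le (Or.inl (by simp [hn0])) (Or.inr h1),
    ENNReal.le_div_iff_mul_le (Or.inl hl0) (Or.inr hs)]

/-! ## Law of the path loss of a detected sector -/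

variable {Ω : Type*} [MeasurableSpace Ω] {μ : Measure Ω} {X : Ω → Measure ((ℂ × Bool) × ℝ)}

lemma Valid.ofReal_Ptilde (hp : p.Valid) {z : ℝ} (hz : 0 < z) :
    ENNReal.ofReal (p.Ptilde z) = lap (ENNReal.ofReal p.Γcs * p.noiseCS * ENNReal.ofReal z) *
      lap (ENNReal.ofReal (2 * π * (p.lam / p.Kcs)) *
        p.radial ((Ioi z).indicator fun l => ENNReal.ofReal (p.Γcs * z / (p.Γcs * z + l)))) := by
  have h1 := hp.Γcs_pos
  have h2 := hp.noise_pos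
  have h3 := hp.Pb_pos
  have h4 := hp.Gcs_pos
  have h5 : (0 : ℝ) < p.Mcs := by exact_mod_cast hp.Mcs_pos
  rw [Ptilde, hp.V_eq hz, ENNReal.ofReal_mul (Real.exp_pos _).le, noiseCS,
    ← ENNReal.ofReal_mul h1.le, ← ENNReal.ofReal_mul
      (show 0 ≤ p.Γcs * (p.noise / (p.Pb * p.Mcs * p.Gcs)) by positivity), lap_ofReal (by positivity),
    lap]
  congr 4
  ring

/-- Joint Laplace transform of the absence of points with smaller path loss and the interference. -/
lemma Valid.lintegral_void_lap_interf [IsProbabilityMeasure μ] (hp : p.Valid)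
    (h : IsPPP X p.csIntensity μ) (j : Fin p.Kcs) {l : ℝ} (hl : 0 < l) :
    ∫⁻ ω, lap (∞ * X ω (p.sectorSet j (Iic (ENNReal.ofReal l)))) *
      lap (ENNReal.ofReal p.Γcs * (p.interfOf j (ENNReal.ofReal l) (X ω) + p.noiseCS) *
        ENNReal.ofReal l) ∂μ = p.voidProb l * ENNReal.ofReal (p.Ptilde l) := by
  have := hp.sigmaFinite_csIntensity
  have hΓ := hp.Γcs_pos
  -- Weight `∞` on points of path loss at most `l` turns `exp (-f)` into the indicator that there
  -- are none; farther points carry their scaled interference. One Laplace functional then treats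
  -- both.
  let f : ℝ × ℝ → ℝ≥0∞ := fun q =>
    (Iic l).indicator (fun _ => ∞) q.1 + (Ioi l).indicator (fun l' => ENNReal.ofReal (p.Γcs * l / l' * q.2)) q.1
  have hf : Measurable f := by
    refine Measurable.add ((measurable_const.indicator measurableSet_Iic).comp measurable_fst) ?_
    have h1 : Measurable fun q : ℝ × ℝ => ENNReal.ofReal (p.Γcs * l / q.1 * q.2) := by fun_prop
    exact h1.indicator (measurable_fst measurableSet_Ioi)
  have hS : MeasurableSet {y : (ℂ × Bool) × ℝ | y.1.1 ∈ p.bsSector j} :=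
    (measurableSet_bsSector j).preimage (measurable_fst.comp measurable_fst)
  have hfl : Measurable fun y : (ℂ × Bool) × ℝ => f (p.loss y.1, y.2) :=
    hf.comp ((p.measurable_loss.comp measurable_fst).prodMk measurable_snd)
  have hmI : MeasurableSet (p.sectorSet j (Ioi (ENNReal.ofReal l)) : Set ((ℂ × Bool) × ℝ)) :=
    measurableSet_sectorSet j measurableSet_Ioi
  have hmB : MeasurableSet (p.sectorSet j (Iic (ENNReal.ofReal l)) : Set ((ℂ × Bool) × ℝ)) :=
    measurableSet_sectorSet j measurableSet_Iic
  have hmi : Measurable fun y : (ℂ × Bool) × ℝ => ENNReal.ofReal (y.2 / p.loss y.1) :=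
    (measurable_snd.div (p.measurable_loss.comp measurable_fst)).ennreal_ofReal
  have key : ∀ ν : Measure ((ℂ × Bool) × ℝ),
      ∫⁻ y, {y : (ℂ × Bool) × ℝ | y.1.1 ∈ p.bsSector j}.indicator (fun y => f (p.loss y.1, y.2)) y ∂ν =
      ∞ * ν (p.sectorSet j (Iic (ENNReal.ofReal l))) +
        ENNReal.ofReal p.Γcs * p.interfOf j (ENNReal.ofReal l) ν * ENNReal.ofReal l := by
    intro ν
    rw [interfOf, mul_right_comm, ← ENNReal.ofReal_mul hΓ.le, ← lintegral_const_mul _ hmi,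
      ← lintegral_indicator_const hmB, ← lintegral_indicator hmI,
      ← lintegral_add_left (measurable_const.indicator hmB)]
    refine lintegral_congr fun y => ?_
    by_cases hy : y.1.1 ∈ p.bsSector j
    · rw [indicator_of_mem (show y ∈ {y : (ℂ × Bool) × ℝ | y.1.1 ∈ p.bsSector j} from hy)]
      have hpos : 0 < p.loss y.1 :=
        hp.loss_pos fun h0 => zero_notMem_eqSector j (by rw [← h0]; exact hy)
      by_cases hle : p.loss y.1 ≤ l
      · have h1 : y ∈ p.sectorSet j (Iic (ENNReal.ofReal l)) := ⟨hy, ENNReal.ofReal_le_ofReal hle⟩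
        have h2 : y ∉ p.sectorSet j (Ioi (ENNReal.ofReal l)) := fun h' =>
          absurd (ENNReal.ofReal_le_ofReal hle) (not_le.2 h'.2)
        rw [indicator_of_mem h1, indicator_of_notMem h2]
        simp only [f]
        rw [indicator_of_mem (mem_Iic.2 hle), indicator_of_notMem (by simpa using hle)]
      · have hlt := not_le.1 hle
        have hlt' : ENNReal.ofReal l < ENNReal.ofReal (p.loss y.1) :=
          (ENNReal.ofReal_lt_ofReal_iff hpos).2 hlt
        have h1 : y ∉ p.sectorSet j (Iic (ENNReal.ofReal l)) := fun h' =>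
          absurd hlt' (not_lt.2 h'.2)
        have h2 : y ∈ p.sectorSet j (Ioi (ENNReal.ofReal l)) := ⟨hy, hlt'⟩
        rw [indicator_of_notMem h1, indicator_of_mem h2]
        simp only [f]
        rw [indicator_of_notMem (by simpa using hlt), indicator_of_mem (mem_Ioi.2 hlt),
          ← ENNReal.ofReal_mul (by positivity)]
        congr 2
        ring
    · rw [indicator_of_notMem (show y ∉ {y : (ℂ × Bool) × ℝ | y.1.1 ∈ p.bsSector j} from hy),
        indicator_of_notMem (fun h' : y ∈ p.sectorSet j (Iic _) => hy h'.1),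
        indicator_of_notMem (fun h' : y ∈ p.sectorSet j (Ioi _) => hy h'.1), add_zero]
  have h1 : ∀ ω, lap (∞ * X ω (p.sectorSet j (Iic (ENNReal.ofReal l)))) *
      lap (ENNReal.ofReal p.Γcs * (p.interfOf j (ENNReal.ofReal l) (X ω) + p.noiseCS) *
        ENNReal.ofReal l) = lap (ENNReal.ofReal p.Γcs * p.noiseCS * ENNReal.ofReal l) *
      lap (∫⁻ y, {y : (ℂ × Bool) × ℝ | y.1.1 ∈ p.bsSector j}.indicator
        (fun y => f (p.loss y.1, y.2)) y ∂(X ω)) := by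
    intro ω
    rw [key, ← lap_add, ← lap_add]
    congr 1
    ring
  have hlm : Measurable fun ω => lap (∫⁻ y, {y : (ℂ × Bool) × ℝ | y.1.1 ∈ p.bsSector j}.indicator
      (fun y => f (p.loss y.1, y.2)) y ∂(X ω)) :=
    measurable_lap.comp (h.measurable_lintegral (hfl.indicator hS))
  simp_rw [h1]
  rw [lintegral_const_mul _ hlm,
    h.lintegral_lap_lintegral (hfl.indicator hS)]
  have h2 : ∫⁻ y, (1 - lap ({y : (ℂ × Bool) × ℝ | y.1.1 ∈ p.bsSector j}.indicator
      (fun y => f (p.loss y.1, y.2)) y)) ∂p.csIntensity =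
      ∫⁻ y in {y : (ℂ × Bool) × ℝ | y.1.1 ∈ p.bsSector j}, (1 - lap (f (p.loss y.1, y.2))) ∂p.csIntensity := by
    rw [← lintegral_indicator hS]
    refine lintegral_congr fun y => ?_
    by_cases hy : y ∈ {y : (ℂ × Bool) × ℝ | y.1.1 ∈ p.bsSector j}
    · rw [indicator_of_mem hy, indicator_of_mem hy]
    · rw [indicator_of_notMem hy, indicator_of_notMem hy, lap_zero, tsub_self]
  have hg : Measurable fun q : ℝ × ℝ => 1 - lap (f q) := (measurable_lap.comp hf).const_sub 1
  rw [h2, hp.lintegral_csIntensity j hg]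
  -- The near part contributes `1`, which gives the void probability; the far part contributes the
  -- kernel of `V` with `T = Γcs`.
  have h3 : ∀ l', 0 < l' → ∫⁻ m, (1 - lap (f (l', m))) ∂(expMeasure 1) =
      (Iic l).indicator 1 l' +
        (Ioi l).indicator (fun l' => ENNReal.ofReal (p.Γcs * l / (p.Γcs * l + l'))) l' := by
    intro l' hl'
    by_cases hle : l' ≤ l
    · have hI : l' ∈ Iic l := hle
      have hO : l' ∉ Ioi l := not_lt.2 hle
      simp only [f, indicator_of_mem hI, indicator_of_notMem hO]
      simp
    · have hI : l' ∉ Iic l := hle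
      have hO : l' ∈ Ioi l := not_le.1 hle
      simp only [f, indicator_of_notMem hI, indicator_of_mem hO, zero_add]
      rw [lintegral_one_sub_lap_expMeasure (by positivity)]
      congr 1
      field_simp
      ring
  rw [hp.radial_congr h3, hp.radial_add (measurable_one.indicator measurableSet_Iic), mul_add, lap_add,
    hp.ofReal_Ptilde hl, voidProb]
  ring

end Params

end

end MmWave


namespace MmWave

noncomputable section

open Filter Topology

namespace Params

variable {p : Params}

/-! ## Measurability of the special functions -/

lemma Valid.measurable_U (hp : p.Valid) (T lam : ℝ) : Measurable fun z => p.U z T lam := by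
  have hh := hp.h_meas
  have hL := p.measurable_lossL
  have hN := p.measurable_lossN
  have h1 : Measurable fun q : ℝ × ℝ =>
      ENNReal.ofReal (T * q.1 * p.h q.2 * q.2 / (T * q.1 + p.lossL q.2)) := by fun_prop
  have h2 : Measurable fun q : ℝ × ℝ =>
      ENNReal.ofReal (T * q.1 * (1 - p.h q.2) * q.2 / (T * q.1 + p.lossN q.2)) := by fun_prop
  unfold U
  exact measurable_expNeg.comp
    ((h1.lintegral_prod_right'.add h2.lintegral_prod_right').const_mul _)

lemma Valid.measurable_V (hp : p.Valid) (T lam : ℝ) : Measurable fun z => p.V z T lam := by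
  have hh := hp.h_meas
  have hL := p.measurable_lossL
  have hN := p.measurable_lossN
  have hiL : Measurable p.invL := by unfold invL; fun_prop
  have hiN : Measurable p.invN := by unfold invN; fun_prop
  have h1 : Measurable fun q : ℝ × ℝ =>
      ENNReal.ofReal (T * q.1 * p.h q.2 * q.2 / (T * q.1 + p.lossL q.2)) := by fun_prop
  have h2 : Measurable fun q : ℝ × ℝ =>
      ENNReal.ofReal (T * q.1 * (1 - p.h q.2) * q.2 / (T * q.1 + p.lossN q.2)) := by fun_prop
  have h3 := (h1.indicator (measurableSet_lt (hiL.comp measurable_fst) measurable_snd)).lintegral_prod_right'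
    (ν := volume)
  have h4 := (h2.indicator (measurableSet_lt (hiN.comp measurable_fst) measurable_snd)).lintegral_prod_right'
    (ν := volume)
  unfold V
  refine measurable_expNeg.comp (Measurable.const_mul (Measurable.add ?_ ?_) _)
  · have e : (fun z => ∫⁻ r in Ioi (p.invL z), ENNReal.ofReal (T * z * p.h r * r / (T * z + p.lossL r))) =
        fun z => ∫⁻ r, (Ioi (p.invL z)).indicator (fun r =>
          ENNReal.ofReal (T * z * p.h r * r / (T * z + p.lossL r))) r := by
      ext z; rw [← lintegral_indicator measurableSet_Ioi]
    rw [e]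
    exact h3
  · have e : (fun z => ∫⁻ r in Ioi (p.invN z), ENNReal.ofReal (T * z * (1 - p.h r) * r / (T * z + p.lossN r))) =
        fun z => ∫⁻ r, (Ioi (p.invN z)).indicator (fun r =>
          ENNReal.ofReal (T * z * (1 - p.h r) * r / (T * z + p.lossN r))) r := by
      ext z; rw [← lintegral_indicator measurableSet_Ioi]
    rw [e]
    exact h4

lemma Valid.measurable_Ptilde (hp : p.Valid) : Measurable p.Ptilde := by
  have := hp.measurable_V p.Γcs (p.lam / p.Kcs)
  unfold Ptilde
  fun_prop

lemma Valid.measurable_voidProb (hp : p.Valid) : Measurable p.voidProb := by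
  have hh := hp.h_meas
  have hL := p.measurable_lossL
  have hN := p.measurable_lossN
  have hi : ∀ f : ℝ → ℝ, Measurable f →
      Measurable fun q : ℝ × ℝ => (Iic q.1).indicator (1 : ℝ → ℝ≥0∞) (f q.2) := by
    intro f hf
    have hm : MeasurableSet {q : ℝ × ℝ | f q.2 ≤ q.1} :=
      measurableSet_le (hf.comp measurable_snd) measurable_fst
    exact (measurable_const (a := (1 : ℝ≥0∞))).indicator hm
  have h1 := hi _ hL
  have h2 := hi _ hN
  have h3 : Measurable fun q : ℝ × ℝ => ENNReal.ofReal (p.h q.2 * q.2) *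
    (Iic q.1).indicator (1 : ℝ → ℝ≥0∞) (p.lossL q.2) := by fun_prop
  have h4 : Measurable fun q : ℝ × ℝ => ENNReal.ofReal ((1 - p.h q.2) * q.2) *
    (Iic q.1).indicator (1 : ℝ → ℝ≥0∞) (p.lossN q.2) := by fun_prop
  unfold voidProb radial
  exact measurable_lap.comp ((h3.lintegral_prod_right'.add h4.lintegral_prod_right').const_mul _)

lemma Valid.Ptilde_nonneg (_hp : p.Valid) (z : ℝ) : 0 ≤ p.Ptilde z :=
  mul_nonneg (Real.exp_pos _).le (expNeg_nonneg _)

/-! ## Law of the path loss of a detected sector -/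

variable {Ω : Type*} [MeasurableSpace Ω] {μ : Measure Ω} {X : Ω → Measure ((ℂ × Bool) × ℝ)}

lemma measurableSet_peakSet (j : Fin p.Kcs)
    (κ : Kernel (Measure ((ℂ × Bool) × ℝ)) ((ℂ × Bool) × ℝ)) [IsSFiniteKernel κ] :
    MeasurableSet {q : ((ℂ × Bool) × ℝ) × Measure ((ℂ × Bool) × ℝ) | q.1 ∈ p.peakSet j (κ q.2)} := by
  have h2 : Measurable fun q : ((ℂ × Bool) × ℝ) × Measure ((ℂ × Bool) × ℝ) =>
      (ENNReal.ofReal (p.loss q.1.1), q.2) :=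
    (measurable_ofReal_loss.comp (measurable_fst.comp measurable_fst)).prodMk measurable_snd
  have h1 := (measurable_lintegral_sectorSet j κ (A := fun z => Iic z) (f := fun _ => 1)
    (measurableSet_le measurable_snd measurable_fst) measurable_const).comp h2
  have h3 := (measurable_interfOf j κ).comp h2
  simp only [Function.comp_def, setLIntegral_one] at h1 h3
  have h5 : MeasurableSet {q : ((ℂ × Bool) × ℝ) × Measure ((ℂ × Bool) × ℝ) |
      q.1.1.1 ∈ p.bsSector j} :=
    (measurableSet_bsSector j).preimage (measurable_fst.comp (measurable_fst.comp measurable_fst))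
  have h6 := measurableSet_le h1 (measurable_const (a := (1 : ℝ≥0∞)))
  have h7 : Measurable fun q : ((ℂ × Bool) × ℝ) × Measure ((ℂ × Bool) × ℝ) =>
      ENNReal.ofReal q.1.2 / ENNReal.ofReal (p.loss q.1.1) /
        (p.interfOf j (ENNReal.ofReal (p.loss q.1.1)) (κ q.2) + p.noiseCS) :=
    ((measurable_snd.comp measurable_fst).ennreal_ofReal.div
      (measurable_ofReal_loss.comp (measurable_fst.comp measurable_fst))).div (h3.add_const _)
  have h8 := measurableSet_le (measurable_const (a := ENNReal.ofReal p.Γcs)) h7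
  exact h5.inter (h6.inter h8)

/-- Integrals over the detected point of minimum path loss when a point is added. -/
lemma Valid.lintegral_peakSet_add_dirac [IsProbabilityMeasure μ] (hp : p.Valid)
    (h : IsPPP X p.csIntensity μ) (j : Fin p.Kcs) (y : ℂ × Bool) (hy : y.1 ∈ p.bsSector j) :
    ∫⁻ m, ∫⁻ ω, (p.peakSet j (X ω + Measure.dirac (y, m))).indicator (1 : ((ℂ × Bool) × ℝ) → ℝ≥0∞) (y, m) ∂μ ∂(expMeasure 1) =
      p.voidProb (p.loss y) * ENNReal.ofReal (p.Ptilde (p.loss y)) := by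
  have hl : 0 < p.loss y :=
    hp.loss_pos fun h0 => zero_notMem_eqSector j (by rw [← h0]; exact hy)
  set l := p.loss y with hldef
  set B : Set ((ℂ × Bool) × ℝ) := p.sectorSet j (Iic (ENNReal.ofReal l)) with hB
  have hmB : MeasurableSet B := measurableSet_sectorSet j measurableSet_Iic
  have hmI : MeasurableSet (p.sectorSet j (Ioi (ENNReal.ofReal l)) : Set ((ℂ × Bool) × ℝ)) :=
    measurableSet_sectorSet j measurableSet_Ioi
  have hmi : Measurable fun y : (ℂ × Bool) × ℝ => ENNReal.ofReal (y.2 / p.loss y.1) :=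
    (measurable_snd.div (p.measurable_loss.comp measurable_fst)).ennreal_ofReal
  let a : Ω → ℝ≥0∞ := fun ω =>
    ENNReal.ofReal p.Γcs * (p.interfOf j (ENNReal.ofReal l) (X ω) + p.noiseCS) * ENNReal.ofReal l
  have hia : Measurable fun ω => p.interfOf j (ENNReal.ofReal l) (X ω) := by
    have := h.measurable_lintegral (hmi.indicator hmI)
    simp_rw [lintegral_indicator hmI] at this
    exact this
  have ha : Measurable a := ((hia.add_const _).const_mul _).mul_const _
  have hn0 : p.noiseCS ≠ 0 := by
    have h2 := hp.noise_pos
    have h3 := hp.Pb_pos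
    have h4 := hp.Gcs_pos
    have h5 : (0 : ℝ) < p.Mcs := by exact_mod_cast hp.Mcs_pos
    exact (ENNReal.ofReal_pos.2 (by positivity)).ne'
  -- The added point already accounts for the allowed mass `1`, so the configuration itself must be
  -- empty up to its level. It does not interfere with itself because interference counts strictly
  -- larger path losses.
  have hpt : ∀ m ω, (p.peakSet j (X ω + Measure.dirac (y, m))).indicator (1 : ((ℂ × Bool) × ℝ) → ℝ≥0∞) (y, m) =
      lap (∞ * X ω B) * {m : ℝ | a ω ≤ ENNReal.ofReal m}.indicator (1 : ℝ → ℝ≥0∞) m := by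
    intro m ω
    have hint : p.interfOf j (ENNReal.ofReal l) (X ω + Measure.dirac (y, m)) =
        p.interfOf j (ENNReal.ofReal l) (X ω) := by
      have h0 : (y, m) ∉ (p.sectorSet j (Ioi (ENNReal.ofReal l)) : Set ((ℂ × Bool) × ℝ)) :=
        fun h' => lt_irrefl (ENNReal.ofReal l) h'.2
      classical
      rw [interfOf, Measure.restrict_add, lintegral_add_measure, restrict_dirac' hmI, if_neg h0,
        lintegral_zero_measure, add_zero, interfOf]
    have hone : (X ω + Measure.dirac (y, m)) B = X ω B + 1 := by
      rw [Measure.add_apply, Measure.dirac_apply' _ hmB,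
        indicator_of_mem (show (y, m) ∈ B from ⟨hy, self_mem_Iic⟩)]
      rfl
    have hiff : (y, m) ∈ p.peakSet j (X ω + Measure.dirac (y, m)) ↔
        X ω B = 0 ∧ a ω ≤ ENNReal.ofReal m := by
      have h1 : (y, m) ∈ p.peakSet j (X ω + Measure.dirac (y, m)) ↔
          y.1 ∈ p.bsSector j ∧ (X ω + Measure.dirac (y, m)) B ≤ 1 ∧
          ENNReal.ofReal p.Γcs ≤ ENNReal.ofReal m / ENNReal.ofReal l /
            (p.interfOf j (ENNReal.ofReal l) (X ω + Measure.dirac (y, m)) + p.noiseCS) := Iff.rfl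
      rw [h1, hone, hint, le_sinr_iff ENNReal.ofReal_ne_top (ENNReal.ofReal_pos.2 hl).ne' hn0]
      refine ⟨fun h' => ⟨?_, h'.2.2⟩, fun h' => ⟨hy, by rw [h'.1, zero_add], h'.2⟩⟩
      by_contra hne
      exact absurd h'.2.1 (not_le.2 (by
        rw [add_comm]; exact ENNReal.lt_add_right ENNReal.one_ne_top hne))
    by_cases h0 : X ω B = 0
    · by_cases h1 : a ω ≤ ENNReal.ofReal m
      · rw [indicator_of_mem (hiff.2 ⟨h0, h1⟩), indicator_of_mem (by exact h1), h0]
        simp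
      · rw [indicator_of_notMem (fun h' => h1 (hiff.1 h').2), indicator_of_notMem (by exact h1), mul_zero]
    · rw [indicator_of_notMem (fun h' => h0 (hiff.1 h').1), ENNReal.top_mul h0, lap_top, zero_mul]
  simp_rw [hpt]
  have hXB := h.measurable_apply hmB
  have hmS : MeasurableSet {q : ℝ × Ω | a q.2 ≤ ENNReal.ofReal q.1} :=
    measurableSet_le (ha.comp measurable_snd) measurable_fst.ennreal_ofReal
  have hm1 : Measurable fun q : ℝ × Ω => lap (∞ * X q.2 B) *
      {m : ℝ | a q.2 ≤ ENNReal.ofReal m}.indicator (1 : ℝ → ℝ≥0∞) q.1 := by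
    refine (measurable_lap.comp ((hXB.comp measurable_snd).const_mul _)).mul ?_
    exact (measurable_const (a := (1 : ℝ≥0∞))).indicator hmS
  -- Integrating the point's own fading first turns the detection event into a Laplace factor.
  rw [lintegral_lintegral_swap hm1.aemeasurable, ← hp.lintegral_void_lap_interf h j hl]
  refine lintegral_congr fun ω => ?_
  have hms : MeasurableSet {m : ℝ | a ω ≤ ENNReal.ofReal m} :=
    measurableSet_le measurable_const ENNReal.measurable_ofReal
  rw [lintegral_const_mul _ (measurable_one.indicator hms), lintegral_indicator_one hms, expMeasure_ge]

/-- The Mecke formula applied to the detected minimum point. The condition `φ ∞ = 0` leaves out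
undetected sectors, so the density has total mass `P` and not `1`. -/
theorem Valid.lintegral_detLoss [IsProbabilityMeasure μ] (hp : p.Valid)
    (h : IsPPP X p.csIntensity μ) (j : Fin p.Kcs) {φ : ℝ≥0∞ → ℝ≥0∞} (hφm : Measurable φ)
    (hφ : φ ∞ = 0) :
    ∫⁻ ω, φ (p.detLoss j (X ω)) ∂μ =
      ∫⁻ z in Ioi (0 : ℝ), ENNReal.ofReal (p.Ptilde z * p.fZ₁ z) * φ (ENNReal.ofReal z) := by
  have := hp.sigmaFinite_csIntensity
  have := hp.sigmaFinite_linkIntensity p.lam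
  let κ := tame p.csIntensity
  let S : Set (((ℂ × Bool) × ℝ) × Measure ((ℂ × Bool) × ℝ)) := {q | q.1 ∈ p.peakSet j (κ q.2)}
  let F : ((ℂ × Bool) × ℝ) × Measure ((ℂ × Bool) × ℝ) → ℝ≥0∞ :=
    S.indicator fun q => φ (ENNReal.ofReal (p.loss q.1.1))
  have hφl : Measurable fun y : ℂ × Bool => φ (ENNReal.ofReal (p.loss y)) :=
    hφm.comp measurable_ofReal_loss
  have hF : Measurable F :=
    (hφl.comp (measurable_fst.comp measurable_fst)).indicator (measurableSet_peakSet j κ)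
  -- Almost surely the configuration is a counting measure, finite up to every level and free of
  -- ties, so `φ (detLoss)` is a sum over its points with at most one nonzero term.
  have h1 : ∫⁻ ω, φ (p.detLoss j (X ω)) ∂μ = ∫⁻ ω, ∫⁻ x, F (x, X ω) ∂(X ω) ∂μ := by
    have hfin : ∀ᵐ ω ∂μ, ∀ n : ℕ, X ω (p.sectorSet j (Iic (n : ℝ≥0∞))) ≠ ∞ := by
      rw [ae_all_iff]
      intro n
      filter_upwards [h.ae_exists_nat (measurableSet_sectorSet j measurableSet_Iic)
        (hp.csIntensity_sectorSet_Iic_ne_top j n)] with ω ⟨k, hk⟩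
      simp [hk]
    refine lintegral_congr_ae ?_
    filter_upwards [h.counting, hfin, hp.ae_no_tie h j, h.ae_tame] with ω ⟨I, x, hx⟩ h2 h3 hκ
    rw [← hp.lintegral_peakSet j x hx h2 (h3 I x hx) hφ]
    refine lintegral_congr fun y => ?_
    have hiff : (y, X ω) ∈ S ↔ y ∈ p.peakSet j (X ω) := by
      change y ∈ p.peakSet j (κ (X ω)) ↔ _
      simp only [κ, hκ]
    by_cases hy : y ∈ p.peakSet j (X ω)
    · rw [indicator_of_mem hy]
      exact (indicator_of_mem (f := fun q : ((ℂ × Bool) × ℝ) × Measure ((ℂ × Bool) × ℝ) =>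
        φ (ENNReal.ofReal (p.loss q.1.1))) (hiff.2 hy)).symm
    · rw [indicator_of_notMem hy]
      exact (indicator_of_notMem (f := fun q : ((ℂ × Bool) × ℝ) × Measure ((ℂ × Bool) × ℝ) =>
        φ (ENNReal.ofReal (p.loss q.1.1))) (mt hiff.1 hy)).symm
  rw [h1, h.lintegral_lintegral hF]
  have hG : Measurable fun x => ∫⁻ ω, F (x, X ω + Measure.dirac x) ∂μ := by
    have : Measurable fun q : ((ℂ × Bool) × ℝ) × Ω => F (q.1, X q.2 + Measure.dirac q.1) :=
      hF.comp (measurable_fst.prodMk h.measurable_add_dirac)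
    exact this.lintegral_prod_right'
  have h2 : ∫⁻ x, ∫⁻ ω, F (x, X ω + Measure.dirac x) ∂μ ∂p.csIntensity =
      ∫⁻ y, ∫⁻ m, ∫⁻ ω, F ((y, m), X ω + Measure.dirac (y, m)) ∂μ ∂(expMeasure 1)
        ∂(p.linkIntensity p.lam) := lintegral_prod _ hG.aemeasurable
  rw [h2]
  have hSj : MeasurableSet {y : ℂ × Bool | y.1 ∈ p.bsSector j} :=
    (measurableSet_bsSector j).preimage measurable_fst
  have h3 : ∀ y : ℂ × Bool, ∫⁻ m, ∫⁻ ω, F ((y, m), X ω + Measure.dirac (y, m)) ∂μ ∂(expMeasure 1) =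
      {y : ℂ × Bool | y.1 ∈ p.bsSector j}.indicator (fun y => φ (ENNReal.ofReal (p.loss y)) *
        (p.voidProb (p.loss y) * ENNReal.ofReal (p.Ptilde (p.loss y)))) y := by
    intro y
    have hFi : ∀ m, ∫⁻ ω, F ((y, m), X ω + Measure.dirac (y, m)) ∂μ =
        ∫⁻ ω, φ (ENNReal.ofReal (p.loss y)) *
          (p.peakSet j (X ω + Measure.dirac (y, m))).indicator (1 : ((ℂ × Bool) × ℝ) → ℝ≥0∞) (y, m) ∂μ := by
      intro m
      refine lintegral_congr_ae ?_
      filter_upwards [h.ae_tame_add_dirac] with ω hκ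
      have hiff : ((y, m), X ω + Measure.dirac (y, m)) ∈ S ↔
          (y, m) ∈ p.peakSet j (X ω + Measure.dirac (y, m)) := by
        change (y, m) ∈ p.peakSet j (κ (X ω + Measure.dirac (y, m))) ↔ _
        simp only [κ, hκ]
      by_cases hy : (y, m) ∈ p.peakSet j (X ω + Measure.dirac (y, m))
      · rw [indicator_of_mem hy, Pi.one_apply, mul_one]
        exact indicator_of_mem (hiff.2 hy) _
      · rw [indicator_of_notMem hy, mul_zero]
        exact indicator_of_notMem (mt hiff.1 hy) _
    by_cases hy : y.1 ∈ p.bsSector j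
    · rw [indicator_of_mem (show y ∈ {y : ℂ × Bool | y.1 ∈ p.bsSector j} from hy),
        ← hp.lintegral_peakSet_add_dirac h j y hy]
      simp_rw [hFi]
      have hm : Measurable fun q : ℝ × Ω =>
          S.indicator (fun _ => (1 : ℝ≥0∞)) ((y, q.1), X q.2 + Measure.dirac (y, q.1)) := by
        have hc : Measurable fun q : ℝ × Ω => ((y, q.1), X q.2 + Measure.dirac (y, q.1)) := by
          have h5 : Measurable fun q : ℝ × Ω => ((y, q.1), q.2) :=
            (measurable_const.prodMk measurable_fst).prodMk measurable_snd
          exact (measurable_const.prodMk measurable_fst).prodMk (h.measurable_add_dirac.comp h5)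
        exact (measurable_const.indicator (measurableSet_peakSet j κ)).comp hc
      have hFi2 : ∀ m, ∫⁻ ω, (p.peakSet j (X ω + Measure.dirac (y, m))).indicator (1 : ((ℂ × Bool) × ℝ) → ℝ≥0∞) (y, m) ∂μ =
          ∫⁻ ω, S.indicator (fun _ => (1 : ℝ≥0∞)) ((y, m), X ω + Measure.dirac (y, m)) ∂μ := by
        intro m
        refine lintegral_congr_ae ?_
        filter_upwards [h.ae_tame_add_dirac] with ω hκ
        have hiff : ((y, m), X ω + Measure.dirac (y, m)) ∈ S ↔
            (y, m) ∈ p.peakSet j (X ω + Measure.dirac (y, m)) := by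
          change (y, m) ∈ p.peakSet j (κ (X ω + Measure.dirac (y, m))) ↔ _
          simp only [κ, hκ]
        by_cases hy : (y, m) ∈ p.peakSet j (X ω + Measure.dirac (y, m))
        · rw [indicator_of_mem hy, indicator_of_mem (hiff.2 hy), Pi.one_apply]
        · rw [indicator_of_notMem hy, indicator_of_notMem (mt hiff.1 hy)]
      have hFi3 : ∀ m, ∫⁻ ω, φ (ENNReal.ofReal (p.loss y)) *
          (p.peakSet j (X ω + Measure.dirac (y, m))).indicator (1 : ((ℂ × Bool) × ℝ) → ℝ≥0∞) (y, m) ∂μ =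
          φ (ENNReal.ofReal (p.loss y)) *
            ∫⁻ ω, (p.peakSet j (X ω + Measure.dirac (y, m))).indicator (1 : ((ℂ × Bool) × ℝ) → ℝ≥0∞) (y, m) ∂μ := by
        intro m
        refine lintegral_const_mul'' _ ⟨_, hm.comp (measurable_const (a := m).prodMk measurable_id), ?_⟩
        filter_upwards [h.ae_tame_add_dirac] with ω hκ
        have hiff : ((y, m), X ω + Measure.dirac (y, m)) ∈ S ↔
            (y, m) ∈ p.peakSet j (X ω + Measure.dirac (y, m)) := by
          change (y, m) ∈ p.peakSet j (κ (X ω + Measure.dirac (y, m))) ↔ _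
          simp only [κ, hκ]
        by_cases hy : (y, m) ∈ p.peakSet j (X ω + Measure.dirac (y, m))
        · rw [indicator_of_mem hy]
          exact (indicator_of_mem (hiff.2 hy) fun _ => (1 : ℝ≥0∞)).symm
        · rw [indicator_of_notMem hy]
          exact (indicator_of_notMem (mt hiff.1 hy) fun _ => (1 : ℝ≥0∞)).symm
      simp_rw [hFi3, hFi2]
      exact lintegral_const_mul _ hm.lintegral_prod_right'
    · rw [indicator_of_notMem (show y ∉ {y : ℂ × Bool | y.1 ∈ p.bsSector j} from hy)]
      simp_rw [hFi]
      have h0 : ∀ m ω, (y, m) ∉ p.peakSet j (X ω + Measure.dirac (y, m)) := fun m ω h' => hy h'.1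
      simp [h0]
  simp_rw [h3]
  have hmeas : Measurable fun l => φ (ENNReal.ofReal l) *
      (p.voidProb l * ENNReal.ofReal (p.Ptilde l)) :=
    (hφm.comp ENNReal.measurable_ofReal).mul
      (hp.measurable_voidProb.mul hp.measurable_Ptilde.ennreal_ofReal)
  rw [lintegral_indicator hSj]
  refine (hp.lintegral_loss_eq_radial hp.lam_pos.le (isRadialPart_eqSector j) hmeas).trans ?_
  have hmeas2 : Measurable fun l => ENNReal.ofReal (p.lossDensity l) * (φ (ENNReal.ofReal l) *
      (p.voidProb l * ENNReal.ofReal (p.Ptilde l))) :=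
    hp.measurable_lossDensity.ennreal_ofReal.mul hmeas
  rw [hp.radial_eq hmeas, ← lintegral_const_mul _ hmeas2, mul_one_div]
  refine setLIntegral_congr_fun measurableSet_Ioi fun z hz => ?_
  rw [ENNReal.ofReal_mul (hp.Ptilde_nonneg z), hp.fZ₁_eq hz]
  ring

end Params

end

end MmWave


namespace MmWave

noncomputable section

open Filter Topology

/-! ### Integration over independent variables -/

section Independence

variable {Ω : Type*} [MeasurableSpace Ω] {μ : Measure Ω}

lemma lintegral_indepFun [IsFiniteMeasure μ] {α β : Type*} [MeasurableSpace α] [MeasurableSpace β]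
    {f : Ω → α} {g : Ω → β} (h : IndepFun f g μ) (hf : Measurable f) (hg : Measurable g)
    {F : α × β → ℝ≥0∞} (hF : Measurable F) :
    ∫⁻ ω, F (f ω, g ω) ∂μ = ∫⁻ ω, ∫⁻ ω', F (f ω, g ω') ∂μ ∂μ := by
  have h1 : ∫⁻ ω, F (f ω, g ω) ∂μ = ∫⁻ x, F x ∂(μ.map fun ω => (f ω, g ω)) :=
    (lintegral_map hF (hf.prodMk hg)).symm
  rw [h1, h.map_prod_eq_prod_map_map hf.aemeasurable hg.aemeasurable, lintegral_prod _ hF.aemeasurable]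
  rw [lintegral_map hF.lintegral_prod_right' hf]
  refine lintegral_congr fun ω => ?_
  exact lintegral_map (f := fun y => F (f ω, y)) (hF.comp measurable_prodMk_left) hg

/-- An exponential random variable exceeds an independent one with the Laplace transform of the
latter as probability. -/
lemma measure_le_exp [IsFiniteMeasure μ] {I : Ω → ℝ≥0∞} {F : Ω → ℝ} (h : IndepFun I F μ)
    (hI : Measurable I) (hF : Measurable F) (hlaw : μ.map F = expMeasure 1) :
    μ {ω | I ω ≤ ENNReal.ofReal (F ω)} = ∫⁻ ω, lap (I ω) ∂μ := by
  have hS : MeasurableSet {q : ℝ≥0∞ × ℝ | q.1 ≤ ENNReal.ofReal q.2} :=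
    measurableSet_le measurable_fst measurable_snd.ennreal_ofReal
  have h1 := lintegral_indepFun h hI hF (measurable_one.indicator hS)
  have h2 : ∫⁻ ω, {q : ℝ≥0∞ × ℝ | q.1 ≤ ENNReal.ofReal q.2}.indicator (1 : ℝ≥0∞ × ℝ → ℝ≥0∞) (I ω, F ω) ∂μ =
      μ {ω | I ω ≤ ENNReal.ofReal (F ω)} :=
    lintegral_indicator_one ((hI.prodMk hF) hS)
  rw [h2] at h1
  rw [h1]
  refine lintegral_congr fun ω => ?_
  rw [← expMeasure_ge, ← hlaw, Measure.map_apply hF (measurableSet_le measurable_const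
    ENNReal.measurable_ofReal)]
  exact lintegral_indicator_one (hF (measurableSet_le measurable_const ENNReal.measurable_ofReal))

end Independence

namespace Params

variable {p : Params}

lemma Valid.fZ₁_nonneg (hp : p.Valid) {z : ℝ} (hz : 0 ≤ z) : 0 ≤ p.fZ₁ z := by
  have h1 := hp.lam_pos
  have h2 := hp.αL_pos
  have h3 := hp.αN_pos
  have h4 := hp.β_pos
  have h5 := hp.h_nonneg (p.invL z)
  have h6 := hp.one_sub_h_nonneg (p.invN z)
  have hpi := Real.pi_pos
  unfold fZ₁
  positivity

/-- Measurability in the upper limits of the inner integrals is obtained from the expression through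
`voidProb`, valid on the positive half-line. -/
lemma Valid.aemeasurable_fZ₁ (hp : p.Valid) : AEMeasurable p.fZ₁ (volume.restrict (Ioi 0)) := by
  have hm : Measurable fun z => (ENNReal.ofReal (2 * π * (p.lam / p.Kcs)) *
      (ENNReal.ofReal (p.lossDensity z) * p.voidProb z)).toReal :=
    ((hp.measurable_lossDensity.ennreal_ofReal.mul hp.measurable_voidProb).const_mul _).ennreal_toReal
  refine ⟨_, hm, ?_⟩
  filter_upwards [ae_restrict_mem measurableSet_Ioi] with z hz
  rw [← hp.fZ₁_eq hz, ENNReal.toReal_ofReal (hp.fZ₁_nonneg (le_of_lt hz))]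

/-! ### Joint law of the path losses of the detected sectors -/

section DetectedLoss

variable {Ω : Type*} [MeasurableSpace Ω] {μ : Measure Ω} {X : Ω → Measure ((ℂ × Bool) × ℝ)}

lemma pairwise_disjoint_sectorSet {α : Type*} (A : Set ℝ≥0∞) :
    Pairwise fun i j => Disjoint (p.sectorSet i A : Set ((ℂ × Bool) × α)) (p.sectorSet j A) := by
  intro i j hij
  rw [Set.disjoint_left]
  intro y hi hj
  exact Set.disjoint_left.1 (pairwise_disjoint_eqSector p.Kcs hij) hi.1 hj.1

/-- The path losses of the detected sectors are independent, after a modification that makes them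
measurable functions of the process. -/
theorem Valid.exists_iIndepFun_detLoss [IsProbabilityMeasure μ] (hp : p.Valid)
    (h : IsPPP X p.csIntensity μ) :
    ∃ D : Fin p.Kcs → Measure ((ℂ × Bool) × ℝ) → ℝ≥0∞, (∀ i, Measurable (D i)) ∧
      (∀ i, ∀ᵐ ω ∂μ, D i (X ω) = p.detLoss i (X ω)) ∧ iIndepFun (fun i ω => D i (X ω)) μ := by
  have := hp.sigmaFinite_csIntensity
  choose D hD hDe using fun i => exists_measurable_detLoss i (tame p.csIntensity)
  have hS : ∀ i, MeasurableSet (p.sectorSet i univ : Set ((ℂ × Bool) × ℝ)) := fun i =>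
    measurableSet_sectorSet i MeasurableSet.univ
  refine ⟨fun i ν => D i (ν.restrict (p.sectorSet i univ)),
    fun i => (hD i).comp (measurable_measure_restrict (hS i)), fun i => ?_, ?_⟩
  · filter_upwards [h.ae_finPart] with ω hω
    rw [hDe i, detLoss_restrict]
    -- The measurable version is evaluated at the configuration restricted to its sector, which is
    -- still fixed by `tame`.
    exact tame_eq_self _ fun n => ((Measure.restrict_le_self _).trans_lt (hω n).lt_top).ne
  · exact (h.iIndepFun_restrict _ hS (pairwise_disjoint_sectorSet univ)).comp D hD

/-- A random variable with the law of the path loss of a detected sector. -/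
structure IsDetLoss (p : Params) (Y : Ω → ℝ≥0∞) (μ : Measure Ω) : Prop where
  measurable : Measurable Y
  lintegral_of_top : ∀ φ : ℝ≥0∞ → ℝ≥0∞, Measurable φ → φ ∞ = 0 → ∫⁻ ω, φ (Y ω) ∂μ =
    ∫⁻ z in Ioi (0 : ℝ), ENNReal.ofReal (p.Ptilde z * p.fZ₁ z) * φ (ENNReal.ofReal z)

variable {Y : Ω → ℝ≥0∞}

lemma IsDetLoss.measure_of_top (h : p.IsDetLoss Y μ) {A : Set ℝ≥0∞} (hA : MeasurableSet A) (hA0 : ∞ ∉ A) :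
    μ {ω | Y ω ∈ A} = ∫⁻ z in Ioi (0 : ℝ) ∩ ENNReal.ofReal ⁻¹' A, ENNReal.ofReal (p.Ptilde z * p.fZ₁ z) := by
  have h1 := h.lintegral_of_top (A.indicator 1) (measurable_one.indicator hA) (indicator_of_notMem hA0 _)
  have h2 : ∫⁻ ω, A.indicator (1 : ℝ≥0∞ → ℝ≥0∞) (Y ω) ∂μ = μ {ω | Y ω ∈ A} :=
    lintegral_indicator_one (h.measurable hA)
  rw [← h2, h1, inter_comm, ← Measure.restrict_restrict (ENNReal.measurable_ofReal hA),
    ← lintegral_indicator (ENNReal.measurable_ofReal hA)]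
  refine lintegral_congr fun z => ?_
  by_cases hz : ENNReal.ofReal z ∈ A
  · rw [indicator_of_mem hz, indicator_of_mem (show z ∈ ENNReal.ofReal ⁻¹' A from hz), Pi.one_apply, mul_one]
  · rw [indicator_of_notMem hz, indicator_of_notMem (show z ∉ ENNReal.ofReal ⁻¹' A from hz), mul_zero]

lemma IsDetLoss.measure_singleton (h : p.IsDetLoss Y μ) {c : ℝ≥0∞} (hc : c ≠ ∞) : μ {ω | Y ω = c} = 0 := by
  have h1 := h.measure_of_top (measurableSet_singleton c) hc.symm
  refine h1.trans (setLIntegral_measure_zero _ _ ?_)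
  refine measure_mono_null (t := {c.toReal}) ?_ (MeasureTheory.measure_singleton _)
  rintro z ⟨hz, hzc⟩
  have hzc' : ENNReal.ofReal z = c := hzc
  rw [mem_singleton_iff, ← hzc', ENNReal.toReal_ofReal (le_of_lt hz)]

variable [IsProbabilityMeasure μ]

lemma Valid.ae_detDensity_nonneg (hp : p.Valid) :
    0 ≤ᵐ[volume.restrict (Ioi (0 : ℝ))] fun z => p.Ptilde z * p.fZ₁ z := by
  filter_upwards [ae_restrict_mem measurableSet_Ioi] with z hz
  exact mul_nonneg (hp.Ptilde_nonneg z) (hp.fZ₁_nonneg (le_of_lt hz))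

lemma Valid.aemeasurable_detDensity (hp : p.Valid) :
    AEMeasurable (fun z => p.Ptilde z * p.fZ₁ z) (volume.restrict (Ioi 0)) :=
  hp.measurable_Ptilde.aemeasurable.mul hp.aemeasurable_fZ₁

/-- The integral of the density is the probability of a finite loss; no analytic estimate is needed.
-/
lemma IsDetLoss.integrableOn (hp : p.Valid) (h : p.IsDetLoss Y μ) :
    IntegrableOn (fun z => p.Ptilde z * p.fZ₁ z) (Ioi 0) := by
  refine ⟨hp.aemeasurable_detDensity.aestronglyMeasurable, ?_⟩
  rw [hasFiniteIntegral_iff_ofReal hp.ae_detDensity_nonneg]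
  have h1 := h.measure_of_top (A := {∞}ᶜ) (measurableSet_singleton _).compl (by simp)
  have h2 : Ioi (0 : ℝ) ∩ ENNReal.ofReal ⁻¹' {∞}ᶜ = Ioi 0 := by
    rw [inter_eq_left]
    exact fun z _ => ENNReal.ofReal_ne_top
  rw [h2] at h1
  rw [← h1]
  exact measure_lt_top _ _

lemma IsDetLoss.measure_Ioo_top (hp : p.Valid) (h : p.IsDetLoss Y μ) {z : ℝ} (hz : 0 ≤ z) :
    μ {ω | ENNReal.ofReal z < Y ω ∧ Y ω ≠ ∞} = ENNReal.ofReal (p.Ptail z) := by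
  have h1 := h.measure_of_top (A := Ioi (ENNReal.ofReal z) ∩ {∞}ᶜ)
    (measurableSet_Ioi.inter (measurableSet_singleton _).compl) (by simp)
  have h2 : Ioi (0 : ℝ) ∩ ENNReal.ofReal ⁻¹' (Ioi (ENNReal.ofReal z) ∩ {∞}ᶜ) = Ioi z := by
    ext t
    constructor
    · rintro ⟨ht, ht2, -⟩
      exact (ENNReal.ofReal_lt_ofReal_iff ht).1 ht2
    · intro ht
      have ht0 : 0 < t := lt_of_le_of_lt hz ht
      exact ⟨ht0, (ENNReal.ofReal_lt_ofReal_iff ht0).2 ht, ENNReal.ofReal_ne_top⟩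
  rw [h2] at h1
  refine h1.trans ?_
  rw [Ptail, ofReal_integral_eq_lintegral_ofReal ((h.integrableOn hp).mono_set (Ioi_subset_Ioi hz))]
  exact ae_mono (Measure.restrict_mono (Ioi_subset_Ioi hz) le_rfl) hp.ae_detDensity_nonneg

lemma IsDetLoss.measure_ne_top (hp : p.Valid) (h : p.IsDetLoss Y μ) :
    μ {ω | Y ω ≠ ∞} = ENNReal.ofReal p.Pdet := by
  have h1 := h.measure_Ioo_top hp le_rfl
  rw [ENNReal.ofReal_zero] at h1
  change _ = ENNReal.ofReal (p.Ptail 0)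
  rw [← h1]
  refine measure_congr ?_
  have h0 : ∀ᵐ ω ∂μ, Y ω ≠ 0 := by
    rw [ae_iff]
    simpa using h.measure_singleton ENNReal.zero_ne_top
  filter_upwards [h0] with ω hω
  exact propext ⟨fun h' => ⟨pos_iff_ne_zero.2 hω, h'⟩, fun h' => h'.2⟩

lemma Valid.Ptail_nonneg (hp : p.Valid) {z : ℝ} (hz : 0 ≤ z) : 0 ≤ p.Ptail z :=
  setIntegral_nonneg measurableSet_Ioi fun t ht =>
    mul_nonneg (hp.Ptilde_nonneg t) (hp.fZ₁_nonneg (hz.trans (le_of_lt ht)))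

lemma Valid.Pdet_nonneg (hp : p.Valid) : 0 ≤ p.Pdet := hp.Ptail_nonneg le_rfl

lemma IsDetLoss.Pdet_le_one (hp : p.Valid) (h : p.IsDetLoss Y μ) : p.Pdet ≤ 1 := by
  have h1 := h.measure_ne_top hp
  have h2 : ENNReal.ofReal p.Pdet ≤ 1 := by
    rw [← h1]
    exact prob_le_one
  rwa [ENNReal.ofReal_le_one] at h2

lemma IsDetLoss.measure_eq_top (hp : p.Valid) (h : p.IsDetLoss Y μ) :
    μ {ω | Y ω = ∞} = ENNReal.ofReal (1 - p.Pdet) := by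
  have h1 := prob_compl_eq_one_sub (μ := μ) (h.measurable (measurableSet_singleton ∞).compl)
  have h2 : (Y ⁻¹' {∞}ᶜ)ᶜ = {ω | Y ω = ∞} := by ext; simp
  have h3 : μ (Y ⁻¹' {∞}ᶜ) = ENNReal.ofReal p.Pdet := h.measure_ne_top hp
  rw [h2, h3] at h1
  rw [h1, ENNReal.ofReal_sub _ hp.Pdet_nonneg, ENNReal.ofReal_one]

/-- Integration against the law of a path loss in the interval above `z`, with separate values for
detected and undetected sectors. -/
lemma IsDetLoss.lintegral_of_lt (hp : p.Valid) (h : p.IsDetLoss Y μ) {z : ℝ} (hz : 0 ≤ z) (a b : ℝ≥0∞) :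
    ∫⁻ ω, (if ENNReal.ofReal z < Y ω then (if Y ω = ∞ then b else a) else 0) ∂μ =
      a * ENNReal.ofReal (p.Ptail z) + b * ENNReal.ofReal (1 - p.Pdet) := by
  have hm1 : MeasurableSet {ω | ENNReal.ofReal z < Y ω ∧ Y ω ≠ ∞} :=
    (measurableSet_lt measurable_const h.measurable).inter (h.measurable (measurableSet_singleton ∞).compl)
  have hm2 : MeasurableSet {ω | Y ω = ∞} := h.measurable (measurableSet_singleton ∞)
  have h1 : ∀ ω, (if ENNReal.ofReal z < Y ω then (if Y ω = ∞ then b else a) else 0) =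
      {ω | ENNReal.ofReal z < Y ω ∧ Y ω ≠ ∞}.indicator (fun _ => a) ω +
        {ω | Y ω = ∞}.indicator (fun _ => b) ω := by
    intro ω
    simp only [indicator]
    by_cases h2 : Y ω = ∞
    · simp [h2]
    · by_cases h3 : ENNReal.ofReal z < Y ω <;> simp [h2, h3]
  simp_rw [h1]
  rw [lintegral_add_left (measurable_const.indicator hm1), lintegral_indicator_const hm1,
    lintegral_indicator_const hm2, h.measure_Ioo_top hp hz, h.measure_eq_top hp]

/-- The law of a detected loss has no atom except at `∞`, so two independent ones coincide only
there; hence the serving sector is unique. -/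
lemma ae_ne_of_indepFun {Y' : Ω → ℝ≥0∞} (h : p.IsDetLoss Y μ) (h' : p.IsDetLoss Y' μ)
    (hi : IndepFun Y Y' μ) : ∀ᵐ ω ∂μ, Y ω ≠ ∞ → Y ω ≠ Y' ω := by
  have hS : MeasurableSet {q : ℝ≥0∞ × ℝ≥0∞ | q.1 ≠ ∞ ∧ q.1 = q.2} := by
    have h1 : MeasurableSet {q : ℝ≥0∞ × ℝ≥0∞ | q.1 ≠ ∞} :=
      measurable_fst (measurableSet_singleton ∞).compl
    exact h1.inter (measurableSet_eq_fun measurable_fst measurable_snd)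
  have h1 := lintegral_indepFun hi h.measurable h'.measurable (measurable_one.indicator hS)
  have h2 : ∫⁻ ω, {q : ℝ≥0∞ × ℝ≥0∞ | q.1 ≠ ∞ ∧ q.1 = q.2}.indicator (1 : ℝ≥0∞ × ℝ≥0∞ → ℝ≥0∞)
      (Y ω, Y' ω) ∂μ = μ {ω | Y ω ≠ ∞ ∧ Y ω = Y' ω} :=
    lintegral_indicator_one ((h.measurable.prodMk h'.measurable) hS)
  have h3 : ∀ ω, ∫⁻ ω', {q : ℝ≥0∞ × ℝ≥0∞ | q.1 ≠ ∞ ∧ q.1 = q.2}.indicator (1 : ℝ≥0∞ × ℝ≥0∞ → ℝ≥0∞)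
      (Y ω, Y' ω') ∂μ = 0 := by
    intro ω
    by_cases hc : Y ω = ∞
    · simp [indicator, hc]
    · refine (lintegral_indicator_one (s := {ω' | Y ω ≠ ∞ ∧ Y ω = Y' ω'})
        ((measurable_const.prodMk h'.measurable) hS)).trans ?_
      refine measure_mono_null ?_ (h'.measure_singleton hc)
      exact fun ω' hω' => hω'.2.symm
  rw [h2] at h1
  simp_rw [h3, lintegral_zero] at h1
  rw [ae_iff]
  refine measure_mono_null ?_ h1
  intro ω hω
  simpa using hω

lemma measure_exists_ne_top (hp : p.Valid) {Y : Fin p.Kcs → Ω → ℝ≥0∞} (h : ∀ i, p.IsDetLoss (Y i) μ)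
    (hi : iIndepFun Y μ) : μ.real {ω | ∃ i, Y i ω ≠ ∞} = p.Phat := by
  have hm : ∀ i, MeasurableSet {ω | Y i ω = ∞} := fun i => (h i).measurable (measurableSet_singleton ∞)
  have h1 : {ω | ∃ i, Y i ω ≠ ∞} = (⋂ i, {ω | Y i ω = ∞})ᶜ := by
    ext ω; simp
  have h2 : μ (⋂ i, {ω | Y i ω = ∞}) = ∏ i : Fin p.Kcs, μ {ω | Y i ω = ∞} := by
    have := hi.measure_inter_preimage_eq_mul Finset.univ (sets := fun _ => {∞})
      (fun _ _ => measurableSet_singleton ∞)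
    simp only [Finset.mem_univ, iInter_true] at this
    exact this
  have hle : 0 ≤ 1 - p.Pdet := by
    have := (h ⟨0, hp.Kcs_pos⟩).Pdet_le_one hp
    linarith
  rw [h1, probReal_compl_eq_one_sub (MeasurableSet.iInter hm), Measure.real, h2]
  simp_rw [(h _).measure_eq_top hp]
  rw [Finset.prod_const, ENNReal.toReal_pow, ENNReal.toReal_ofReal hle, Finset.card_univ, Fintype.card_fin,
    Phat]

end DetectedLoss

end Params

end

end MmWave


namespace MmWave

noncomputable section

open Filter Topology

/-! ### Laws of the discrete marks -/

lemma coin_true (n : ℕ) : coin n {true} = ENNReal.ofReal (1 / n) := by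
  simp [coin]

lemma coin_false (n : ℕ) : coin n {false} = ENNReal.ofReal (1 - 1 / n) := by
  simp [coin]

instance (n : ℕ) : IsFiniteMeasure (coin n) := by
  refine ⟨?_⟩
  rw [show (univ : Set Bool) = {true} ∪ {false} by ext b; cases b <;> simp]
  refine (measure_union_le _ _).trans_lt ?_
  rw [coin_true, coin_false]
  exact ENNReal.add_lt_top.2 ⟨ENNReal.ofReal_lt_top, ENNReal.ofReal_lt_top⟩

lemma coin_univ {n : ℕ} (hn : 0 < n) : coin n univ = 1 := by
  have hn' : (1 : ℝ) ≤ n := by exact_mod_cast hn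
  have h1 : 1 / (n : ℝ) ≤ 1 := by rw [div_le_one (by linarith)]; exact hn'
  rw [show (univ : Set Bool) = {true} ∪ {false} by ext b; cases b <;> simp,
    measure_union (by simp) (measurableSet_singleton _), coin_true, coin_false,
    ← ENNReal.ofReal_add (by positivity) (by linarith)]
  simp

lemma uniformOn_univ_singleton {n : ℕ} (k : Fin n) :
    uniformOn (univ : Set (Fin n)) {k} = ENNReal.ofReal (1 / n) := by
  have hn : (0 : ℝ) < n := by exact_mod_cast k.pos
  rw [uniformOn_univ, Measure.count_singleton, Fintype.card_fin, ENNReal.ofReal_div_of_pos hn,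
    ENNReal.ofReal_one, ENNReal.ofReal_natCast]

lemma isFiniteMeasure_uniformOn_univ {n : ℕ} : IsFiniteMeasure (uniformOn (univ : Set (Fin n))) := by
  unfold uniformOn
  infer_instance

namespace Params

variable {p : Params}

/-! ## Protocols -/

lemma Valid.N_dvd_Kcs (hp : p.Valid) : p.N ∣ p.Kcs := by
  have hle := Nat.le_of_dvd hp.M_pos hp.N_dvd_M
  have hN := hp.N_pos
  have hM := hp.M_pos
  have hr := hp.fastCS_range
  unfold Kcs Mcs Ncs
  cases h : p.protocol with
  | fastCS m => simpa [max_eq_left (hr m h).1] using (hr m h).2.2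
  | omniRX => simpa [max_eq_left (show 1 ≤ p.M from hM)] using hp.N_dvd_M
  | _ => simpa [max_eq_left hle] using hp.N_dvd_M

lemma Valid.q_mul_N (hp : p.Valid) : p.q * p.N = p.Kcs := Nat.div_mul_cancel hp.N_dvd_Kcs

lemma Valid.q_pos (hp : p.Valid) : 0 < p.q :=
  Nat.div_pos (Nat.le_of_dvd hp.Kcs_pos hp.N_dvd_Kcs) hp.N_pos

lemma Valid.q_le_Kcs (_hp : p.Valid) : p.q ≤ p.Kcs := Nat.div_le_self _ _

lemma Valid.Mra_pos (hp : p.Valid) : 0 < p.Mra := by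
  unfold Mra
  cases p.protocol <;> simp [hp.M_pos]

/-- The sectors in the same user beam as the `j`-th one. -/
def lobe (p : Params) (j : Fin p.Kcs) : Finset (Fin p.Kcs) :=
  Finset.univ.filter fun i => (i : ℕ) / p.q = (j : ℕ) / p.q

lemma mem_lobe {i j : Fin p.Kcs} : i ∈ p.lobe j ↔ (i : ℕ) / p.q = (j : ℕ) / p.q := by
  simp [lobe]

/-- The lobe is a block of `q` consecutive indices; because `q * N = K` the last block is complete.
-/
lemma Valid.card_lobe (hp : p.Valid) (j : Fin p.Kcs) : (p.lobe j).card = p.q := by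
  have hq := hp.q_pos
  have h1 : (p.lobe j).map Fin.valEmbedding =
      Finset.Ico ((j : ℕ) / p.q * p.q) (((j : ℕ) / p.q + 1) * p.q) := by
    ext i
    simp only [Finset.mem_map, mem_lobe, Fin.valEmbedding_apply, Finset.mem_Ico]
    have key : ∀ i : ℕ, i / p.q = (j : ℕ) / p.q ↔
        (j : ℕ) / p.q * p.q ≤ i ∧ i < ((j : ℕ) / p.q + 1) * p.q := by
      intro i
      rw [← Nat.le_div_iff_mul_le hq, ← Nat.div_lt_iff_lt_mul hq]
      omega
    constructor
    · rintro ⟨i, hi, rfl⟩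
      exact (key i).1 hi
    · intro hi
      have hlt : i < p.Kcs := by
        have h2 : (j : ℕ) / p.q < p.N := by
          rw [Nat.div_lt_iff_lt_mul hq, mul_comm, hp.q_mul_N]
          exact j.2
        calc i < ((j : ℕ) / p.q + 1) * p.q := hi.2
          _ ≤ p.N * p.q := Nat.mul_le_mul_right _ h2
          _ = p.Kcs := by rw [mul_comm, hp.q_mul_N]
      exact ⟨⟨i, hlt⟩, (key i).2 hi, rfl⟩
  rw [← Finset.card_map Fin.valEmbedding, h1, Nat.card_Ico, add_mul, one_mul, Nat.add_sub_cancel_left]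

/-- User positions are relative to the base station, so a user at `x` sees it in direction `-x`. For
omnidirectional reception this region plays the role of the random lobe indicator. -/
lemma isRadialPart_neg_sectors (s : Finset (Fin p.Kcs)) :
    IsRadialPart {x | ∃ i ∈ s, -x ∈ p.bsSector i} (s.card / p.Kcs) := by
  have hset : {x : ℂ | ∃ i ∈ s, -x ∈ p.bsSector i} = ⋃ i ∈ s, (Neg.neg ⁻¹' p.bsSector i) := by
    ext x; simp
  have hm : ∀ i, MeasurableSet (Neg.neg ⁻¹' p.bsSector i) := fun i =>
    measurable_neg (measurableSet_bsSector i)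
  rw [hset]
  refine ⟨Finset.measurableSet_biUnion _ fun i _ => hm i, fun ψ hψ => ?_⟩
  rw [lintegral_biUnion_finset _ fun i _ => hm i]
  · have h1 : ∀ i ∈ s, ∫⁻ x in Neg.neg ⁻¹' p.bsSector i, ψ ‖x‖ =
        ENNReal.ofReal (2 * π * (1 / p.Kcs)) * ∫⁻ r in Ioi (0 : ℝ), ENNReal.ofReal r * ψ r := by
      intro i _
      rw [← (isRadialPart_eqSector i).2 ψ hψ]
      have h2 := (Measure.measurePreserving_neg (volume : Measure ℂ)).setLIntegral_comp_preimage
        (measurableSet_bsSector i) (hψ.comp measurable_norm)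
      simp only [Function.comp_apply, norm_neg] at h2
      exact h2
    rw [Finset.sum_congr rfl h1, Finset.sum_const, nsmul_eq_mul, ← mul_assoc, ← ENNReal.ofReal_natCast,
      ← ENNReal.ofReal_mul (Nat.cast_nonneg _)]
    congr 2
    ring
  · intro i _ j _ hij
    exact (pairwise_disjoint_eqSector p.Kcs hij).preimage _

/-! ## Laplace transforms of interference -/

/-- The common computation behind random access and data interference: the region thins the density
by `c`, the marks by `c'`, and the fading average at `s = T z / l` is the kernel of `U` and `V`, cut
off to path losses in `B`. -/
lemma Valid.lintegral_one_sub_lap_interference (hp : p.Valid) {lam : ℝ} (hlam : 0 ≤ lam) {A : Set ℂ}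
    {c : ℝ} (hc : 0 ≤ c) (hA : IsRadialPart A c) {α : Type*} [MeasurableSpace α] (M : Measure α)
    [SFinite M] {S : Set α} (hS : MeasurableSet S) {φ : α → ℝ} (hφ : Measurable φ) {c' : ℝ}
    (hM : ∀ s, 0 ≤ s → ∫⁻ m in S, (1 - lap (ENNReal.ofReal (s * φ m))) ∂M =
      ENNReal.ofReal c' * ENNReal.ofReal (s / (1 + s)))
    {B : Set ℝ} (hB : MeasurableSet B) {T z : ℝ} (hT : 0 ≤ T) (hz : 0 < z) :
    ∫⁻ y in {y : (ℂ × Bool) × α | y.1.1 ∈ A ∧ y.2 ∈ S ∧ p.loss y.1 ∈ B},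
      (1 - lap (ENNReal.ofReal (T * z * φ y.2 / p.loss y.1))) ∂((p.linkIntensity lam).prod M) =
      ENNReal.ofReal (2 * π * (lam * c * c')) *
        p.radial (B.indicator fun l => ENNReal.ofReal (T * z / (T * z + l))) := by
  have hpi := Real.pi_pos
  have hR : MeasurableSet {q : ℝ × α | q.2 ∈ S ∧ q.1 ∈ B} :=
    (measurable_snd hS).inter (measurable_fst hB)
  let f : ℝ × α → ℝ≥0∞ := {q : ℝ × α | q.2 ∈ S ∧ q.1 ∈ B}.indicator
    fun q => 1 - lap (ENNReal.ofReal (T * z * φ q.2 / q.1))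
  have hf : Measurable f := by
    refine Measurable.indicator ?_ hR
    have h1 : Measurable fun q : ℝ × α => ENNReal.ofReal (T * z * φ q.2 / q.1) := by fun_prop
    exact measurable_const.sub (measurable_lap.comp h1)
  have hmA : MeasurableSet {y : (ℂ × Bool) × α | y.1.1 ∈ A} :=
    hA.1.preimage (measurable_fst.comp measurable_fst)
  have hmR : MeasurableSet {y : (ℂ × Bool) × α | y.2 ∈ S ∧ p.loss y.1 ∈ B} :=
    (measurable_snd hS).inter ((p.measurable_loss.comp measurable_fst) hB)
  have h1 : ∫⁻ y in {y : (ℂ × Bool) × α | y.1.1 ∈ A ∧ y.2 ∈ S ∧ p.loss y.1 ∈ B},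
      (1 - lap (ENNReal.ofReal (T * z * φ y.2 / p.loss y.1))) ∂((p.linkIntensity lam).prod M) =
      ∫⁻ y in {y : (ℂ × Bool) × α | y.1.1 ∈ A}, f (p.loss y.1, y.2) ∂((p.linkIntensity lam).prod M) := by
    have h2 : {y : (ℂ × Bool) × α | y.1.1 ∈ A ∧ y.2 ∈ S ∧ p.loss y.1 ∈ B} =
        {y : (ℂ × Bool) × α | y.2 ∈ S ∧ p.loss y.1 ∈ B} ∩ {y : (ℂ × Bool) × α | y.1.1 ∈ A} := by
      ext y
      exact and_comm
    rw [h2, ← Measure.restrict_restrict hmR, ← lintegral_indicator hmR]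
    rfl
  rw [h1, hp.lintegral_loss_mark hlam hA M hf]
  have h3 : p.radial (fun l => ∫⁻ m, f (l, m) ∂M) =
      p.radial fun l => ENNReal.ofReal c' * B.indicator (fun l => ENNReal.ofReal (T * z / (T * z + l))) l := by
    refine hp.radial_congr fun l hl => ?_
    by_cases hlB : l ∈ B
    · rw [indicator_of_mem hlB]
      have h4 : ∫⁻ m, f (l, m) ∂M = ∫⁻ m in S, (1 - lap (ENNReal.ofReal (T * z / l * φ m))) ∂M := by
        rw [← lintegral_indicator hS]
        refine lintegral_congr fun m => ?_
        by_cases hm : m ∈ S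
        · rw [indicator_of_mem hm]
          refine (indicator_of_mem (s := {q : ℝ × α | q.2 ∈ S ∧ q.1 ∈ B}) (a := (l, m)) ⟨hm, hlB⟩ _).trans ?_
          rw [div_mul_eq_mul_div]
        · rw [indicator_of_notMem hm]
          exact indicator_of_notMem (fun h => hm h.1) _
      rw [h4, hM _ (by positivity)]
      congr 2
      have hT' : 0 < T * z + l := by positivity
      have hT2 : 0 < 1 + T * z / l := by positivity
      field_simp
      ring
    · rw [indicator_of_notMem hlB, mul_zero]
      have h4 : ∀ m, f (l, m) = 0 := fun m => indicator_of_notMem (fun h => hlB h.2) _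
      simp_rw [h4, lintegral_zero]
  have hmeas : Measurable fun l => ENNReal.ofReal (T * z / (T * z + l)) := by fun_prop
  rw [h3, hp.radial_const_mul _ (hmeas.indicator hB), ← mul_assoc,
    ← ENNReal.ofReal_mul (show 0 ≤ 2 * π * (lam * c) by positivity), mul_assoc (2 * π)]

lemma setLIntegral_coin_exp (n : ℕ) (b : Bool) {s : ℝ} (hs : 0 ≤ s) :
    ∫⁻ m in {m : Bool × ℝ | m.1 = b}, (1 - lap (ENNReal.ofReal (s * m.2)))
      ∂((coin n).prod (expMeasure 1)) = coin n {b} * ENNReal.ofReal (s / (1 + s)) := by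
  have h1 : {m : Bool × ℝ | m.1 = b} = {b} ×ˢ univ := by ext m; simp
  have hm : Measurable fun m : Bool × ℝ => 1 - lap (ENNReal.ofReal (s * m.2)) := by
    have h2 : Measurable fun m : Bool × ℝ => ENNReal.ofReal (s * m.2) := by fun_prop
    exact measurable_const.sub (measurable_lap.comp h2)
  rw [h1, setLIntegral_prod _ hm.aemeasurable]
  simp only [Measure.restrict_univ, lintegral_one_sub_lap_expMeasure hs]
  rw [lintegral_const, Measure.restrict_apply_univ, mul_comm]

lemma setLIntegral_uniform_coin_exp {l : ℕ} (n : ℕ) (k : Fin l) (t : Set Bool) {s : ℝ} (hs : 0 ≤ s) :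
    ∫⁻ m in {m : Fin l × Bool × ℝ | m.1 = k ∧ m.2.1 ∈ t}, (1 - lap (ENNReal.ofReal (s * m.2.2)))
      ∂((uniformOn univ).prod ((coin n).prod (expMeasure 1))) =
      ENNReal.ofReal (1 / l) * coin n t * ENNReal.ofReal (s / (1 + s)) := by
  have := isFiniteMeasure_uniformOn_univ (n := l)
  have h1 : {m : Fin l × Bool × ℝ | m.1 = k ∧ m.2.1 ∈ t} = {k} ×ˢ (t ×ˢ univ) := by ext m; simp
  have hm : Measurable fun m : Bool × ℝ => 1 - lap (ENNReal.ofReal (s * m.2)) := by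
    have h2 : Measurable fun m : Bool × ℝ => ENNReal.ofReal (s * m.2) := by fun_prop
    exact measurable_const.sub (measurable_lap.comp h2)
  rw [h1, setLIntegral_prod (f := fun m : Fin l × Bool × ℝ => 1 - lap (ENNReal.ofReal (s * m.2.2)))
    (hm.comp measurable_snd).aemeasurable]
  simp only [setLIntegral_prod _ hm.aemeasurable.restrict, Measure.restrict_univ,
    lintegral_one_sub_lap_expMeasure hs]
  rw [lintegral_const, lintegral_const, Measure.restrict_apply_univ, Measure.restrict_apply_univ,
    uniformOn_univ_singleton]
  ring

lemma Valid.lap_radial_U (hp : p.Valid) (z T lam : ℝ) :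
    lap (ENNReal.ofReal (2 * π * lam) * p.radial (univ.indicator fun l => ENNReal.ofReal (T * z / (T * z + l)))) =
      ENNReal.ofReal (p.U z T lam) := by
  rw [hp.U_eq, lap, indicator_univ]

lemma Valid.lap_radial_V (hp : p.Valid) {z : ℝ} (hz : 0 < z) (T lam : ℝ) :
    lap (ENNReal.ofReal (2 * π * lam) * p.radial ((Ioi z).indicator fun l => ENNReal.ofReal (T * z / (T * z + l)))) =
      ENNReal.ofReal (p.V z T lam) := by
  rw [hp.V_eq hz, lap]

end Params

end

end MmWave


namespace MmWave

noncomputable section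

open Filter Topology

namespace Params

variable {p : Params}

/-! ## Random access -/

section RandomAccess

variable {Ω : Type*} [MeasurableSpace Ω] {μ : Measure Ω}

/-- The probability of no collision, when `a` is the success probability of cell search. -/
lemma Valid.measure_noCollision (hp : p.Valid) {X : Ω → Measure (ℂ × Fin p.Npa × Fin p.Mra)} {a : ℝ}
    (ha : 0 ≤ a)
    (h : IsPPP X ((ENNReal.ofReal (p.lamU * a) • (volume : Measure ℂ)).prod
      ((uniformOn univ).prod (uniformOn univ))) μ)
    {cell : Set ℂ} (hcell : MeasurableSet cell) (hvol : volume cell = ENNReal.ofReal (1.28 / p.lam))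
    (k : Fin p.Npa) (m : Fin p.Mra) :
    μ {ω | X ω {y | y.1 ∈ cell ∧ y.2.1 = k ∧ y.2.2 = m} = 0} =
      ENNReal.ofReal (Real.exp (-(1.28 * p.lamU * a / (p.lam * p.Npa * p.Mra)))) := by
  have h1 := hp.lam_pos
  have h2 := hp.lamU_pos
  have hset : {y : ℂ × Fin p.Npa × Fin p.Mra | y.1 ∈ cell ∧ y.2.1 = k ∧ y.2.2 = m} =
      cell ×ˢ ({k} ×ˢ {m}) := rfl
  have hB : MeasurableSet (cell ×ˢ (({k} : Set (Fin p.Npa)) ×ˢ ({m} : Set (Fin p.Mra)))) :=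
    hcell.prod ((measurableSet_singleton k).prod (measurableSet_singleton m))
  have := isFiniteMeasure_uniformOn_univ (n := p.Npa)
  have := isFiniteMeasure_uniformOn_univ (n := p.Mra)
  have hL : ((ENNReal.ofReal (p.lamU * a) • (volume : Measure ℂ)).prod
      ((uniformOn univ).prod (uniformOn univ))) (cell ×ˢ (({k} : Set (Fin p.Npa)) ×ˢ ({m} : Set (Fin p.Mra)))) =
      ENNReal.ofReal (1.28 * p.lamU * a / (p.lam * p.Npa * p.Mra)) := by
    rw [Measure.prod_prod, Measure.prod_prod, Measure.smul_apply, smul_eq_mul, hvol,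
      uniformOn_univ_singleton, uniformOn_univ_singleton, ← ENNReal.ofReal_mul (by positivity),
      ← ENNReal.ofReal_mul (by positivity), ← ENNReal.ofReal_mul (by positivity)]
    congr 1
    field_simp
  have hP := h.poisson _ hB (by rw [hL]; exact ENNReal.ofReal_ne_top) 0
  rw [hset]
  simp only [Nat.cast_zero, pow_zero, mul_one, Nat.factorial_zero, Nat.cast_one, div_one, hL] at hP
  rw [hP, ENNReal.toReal_ofReal (by positivity)]

/-- The positions and lobe indicators of users whose main lobe covers the tagged base station, when
`s` are the sectors in the user beam that contains it. -/
def coverSet (p : Params) (s : Finset (Fin p.Kcs)) : Set (ℂ × Bool) :=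
  match p.protocol with
  | .omniRX => {x | ∃ i ∈ s, -x.1 ∈ p.bsSector i}
  | _ => {x | x.2 = true}

lemma measurableSet_coverSet (s : Finset (Fin p.Kcs)) : MeasurableSet (p.coverSet s) := by
  have h1 : MeasurableSet {x : ℂ × Bool | ∃ i ∈ s, -x.1 ∈ p.bsSector i} :=
    (isRadialPart_neg_sectors s).1.preimage measurable_fst
  have h2 : MeasurableSet {x : ℂ × Bool | x.2 = true} := measurable_snd (measurableSet_singleton true)
  unfold coverSet
  cases p.protocol <;> assumption

/-- Users with preamble `k` in the `m`-th beam whose position and lobe indicator are in `C`. -/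
def raSet (p : Params) (m : Fin p.Mra) (k : Fin p.Npa) (C : Set (ℂ × Bool)) :
    Set ((ℂ × Bool) × Fin p.Npa × Bool × ℝ) :=
  {y | y.1.1 ∈ eqSector p.Mra m ∧ y.2.1 = k ∧ (y.1.1, y.2.2.1) ∈ C}

lemma measurableSet_raSet (m : Fin p.Mra) (k : Fin p.Npa) {C : Set (ℂ × Bool)} (hC : MeasurableSet C) :
    MeasurableSet (p.raSet m k C) := by
  have h1 : MeasurableSet {y : (ℂ × Bool) × Fin p.Npa × Bool × ℝ | y.1.1 ∈ eqSector p.Mra m} :=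
    (measurableSet_eqSector m).preimage (measurable_fst.comp measurable_fst)
  have h2 : MeasurableSet {y : (ℂ × Bool) × Fin p.Npa × Bool × ℝ | y.2.1 = k} :=
    (measurable_fst.comp measurable_snd) (measurableSet_singleton k)
  have h3 : Measurable fun y : (ℂ × Bool) × Fin p.Npa × Bool × ℝ => (y.1.1, y.2.2.1) := by fun_prop
  exact h1.inter (h2.inter (h3 hC))

open Classical in
/-- Interference with the preamble `k` received under the `m`-th beam. -/
def interfRA (p : Params) (m : Fin p.Mra) (k : Fin p.Npa) (s : Finset (Fin p.Kcs))
    (ν : Measure ((ℂ × Bool) × Fin p.Npa × Bool × ℝ)) : ℝ≥0∞ :=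
  ∫⁻ y in p.raSet m k univ, ENNReal.ofReal (p.Pu * p.Mra *
    (if (y.1.1, y.2.2.1) ∈ p.coverSet s then p.G else p.g) * y.2.2.2 / p.loss y.1) ∂ν

open Classical in
lemma measurable_raGain (s : Finset (Fin p.Kcs)) :
    Measurable fun y : (ℂ × Bool) × Fin p.Npa × Bool × ℝ => ENNReal.ofReal (p.Pu * p.Mra *
      (if (y.1.1, y.2.2.1) ∈ p.coverSet s then p.G else p.g) * y.2.2.2 / p.loss y.1) := by
  have h3 : Measurable fun y : (ℂ × Bool) × Fin p.Npa × Bool × ℝ => (y.1.1, y.2.2.1) := by fun_prop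
  have h1 : Measurable fun y : (ℂ × Bool) × Fin p.Npa × Bool × ℝ =>
      if (y.1.1, y.2.2.1) ∈ p.coverSet s then p.G else p.g :=
    Measurable.ite (h3 (measurableSet_coverSet s)) measurable_const measurable_const
  have h2 : Measurable fun y : (ℂ × Bool) × Fin p.Npa × Bool × ℝ => p.loss y.1 :=
    p.measurable_loss.comp measurable_fst
  fun_prop

lemma measurable_interfRA (m : Fin p.Mra) (k : Fin p.Npa) (s : Finset (Fin p.Kcs)) :
    Measurable (p.interfRA m k s) := by
  have hS := measurableSet_raSet m k (MeasurableSet.univ (α := ℂ × Bool))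
  have := Measure.measurable_lintegral ((measurable_raGain s).indicator hS)
  simp only [lintegral_indicator hS] at this
  exact this

lemma mem_eqSector_one {K : ℕ} (hK : K = 1) (m : Fin K) {x : ℂ} : x ∈ eqSector K m ↔ x ≠ 0 := by
  subst hK
  have h := iUnion_eqSector (K := 1) one_pos
  have h2 : eqSector 1 m = {0}ᶜ := by
    rw [← h]
    ext y
    rw [mem_iUnion]
    exact ⟨fun hy => ⟨m, hy⟩, fun ⟨i, hi⟩ => by rwa [Subsingleton.elim m i]⟩
  rw [h2]
  rfl

/-- Integrals over the users whose main lobe covers, or does not cover, the tagged base station. -/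
lemma Valid.lintegral_raSet_coverSet (hp : p.Valid) {lam : ℝ} (hlam : 0 ≤ lam) (m : Fin p.Mra)
    (k : Fin p.Npa) (j : Fin p.Kcs) {T z : ℝ} (hT : 0 ≤ T) (hz : 0 < z) (b : Bool) :
    ∫⁻ y in p.raSet m k (if b then p.coverSet (p.lobe j) else (p.coverSet (p.lobe j))ᶜ),
      (1 - lap (ENNReal.ofReal (T * z * y.2.2.2 / p.loss y.1)))
      ∂((p.linkIntensity lam).prod ((uniformOn univ).prod ((coin p.N).prod (expMeasure 1)))) =
    ENNReal.ofReal (2 * π * (lam / (p.Mra * p.Npa) * (if b then 1 / (p.N : ℝ) else 1 - 1 / (p.N : ℝ)))) *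
      p.radial (univ.indicator fun l => ENNReal.ofReal (T * z / (T * z + l))) := by
  have := isFiniteMeasure_uniformOn_univ (n := p.Npa)
  have hN : (1 : ℝ) ≤ p.N := by exact_mod_cast hp.N_pos
  have hN1 : 1 / (p.N : ℝ) ≤ 1 := by rw [div_le_one (by linarith)]; exact hN
  have hNpa : (0 : ℝ) < p.Npa := by exact_mod_cast hp.Npa_pos
  have hφ : Measurable fun m : Fin p.Npa × Bool × ℝ => m.2.2 := by fun_prop
  have hmk : MeasurableSet {m : Fin p.Npa × Bool × ℝ | m.1 = k} :=
    measurable_fst (measurableSet_singleton k)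
  -- With omnidirectional reception the fraction `1 / N` is geometric: `q` of `K` reflected sectors,
  -- under a single receive beam. Otherwise it comes from the lobe mark.
  by_cases hprot : p.protocol = .omniRX
  · have hMra : p.Mra = 1 := by simp [Mra, hprot]
    have hcov : p.coverSet (p.lobe j) = {x | ∃ i ∈ p.lobe j, -x.1 ∈ p.bsSector i} := by
      simp [coverSet, hprot]
    have hcard : ((p.lobe j).card : ℝ) / p.Kcs = 1 / p.N := by
      have h1 : (0 : ℝ) < p.q := by exact_mod_cast hp.q_pos
      rw [hp.card_lobe, ← hp.q_mul_N, Nat.cast_mul]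
      field_simp
    have hcard' : (((p.lobe j)ᶜ.card : ℕ) : ℝ) / p.Kcs = 1 - 1 / p.N := by
      have h1 : (0 : ℝ) < p.Kcs := by exact_mod_cast hp.Kcs_pos
      rw [← hcard, Finset.card_compl, Fintype.card_fin, Nat.cast_sub
        (by simpa using Finset.card_le_univ (p.lobe j)), sub_div, div_self h1.ne']
    obtain ⟨s, hs, hsc⟩ : ∃ s : Finset (Fin p.Kcs), (if b then p.lobe j else (p.lobe j)ᶜ) = s ∧
        ((s.card : ℕ) : ℝ) / p.Kcs = if b then 1 / (p.N : ℝ) else 1 - 1 / (p.N : ℝ) := by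
      refine ⟨_, rfl, ?_⟩
      cases b <;> simp only [if_true, Bool.false_eq_true, if_false]
      · exact hcard'
      · exact hcard
    have hset : p.raSet m k (if b then p.coverSet (p.lobe j) else (p.coverSet (p.lobe j))ᶜ) =
        {y | y.1.1 ∈ {x | ∃ i ∈ s, -x ∈ p.bsSector i} ∧
          y.2 ∈ {m : Fin p.Npa × Bool × ℝ | m.1 = k ∧ m.2.1 ∈ univ} ∧ p.loss y.1 ∈ univ} := by
      ext y
      -- The single beam is the punctured plane and the reflected sectors partition it, so the
      -- complement of the covering region is the union of the reflected sectors outside the lobe.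
      have key : (y.1.1 ∈ eqSector p.Mra m ∧
          (y.1.1, y.2.2.1) ∈ (if b then p.coverSet (p.lobe j) else (p.coverSet (p.lobe j))ᶜ)) ↔
          ∃ i ∈ s, -y.1.1 ∈ p.bsSector i := by
        rw [mem_eqSector_one hMra, hcov]
        have hne : ∀ i, -y.1.1 ∈ p.bsSector i → y.1.1 ≠ 0 := fun i hi h0 =>
          zero_notMem_eqSector i (by rw [h0, neg_zero] at hi; exact hi)
        subst hs
        cases b <;> simp only [if_true, Bool.false_eq_true, if_false]
        · constructor
          · rintro ⟨h0, h1⟩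
            have h2 : -y.1.1 ∈ ⋃ i, eqSector p.Kcs i := by
              rw [iUnion_eqSector hp.Kcs_pos]
              simpa using h0
            obtain ⟨i, hi⟩ := mem_iUnion.1 h2
            refine ⟨i, ?_, hi⟩
            rw [Finset.mem_compl]
            exact fun hil => h1 ⟨i, hil, hi⟩
          · rintro ⟨i, hi, hy⟩
            refine ⟨hne i hy, ?_⟩
            rintro ⟨i', hi', hy'⟩
            rw [Finset.mem_compl] at hi
            have hii : i ≠ i' := fun h => hi (h ▸ hi')
            exact Set.disjoint_left.1 (pairwise_disjoint_eqSector p.Kcs hii) hy hy'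
        · constructor
          · rintro ⟨-, h1⟩
            exact h1
          · rintro ⟨i, hi, hy⟩
            exact ⟨hne i hy, i, hi, hy⟩
      constructor
      · rintro ⟨h1, h2, h3⟩
        exact ⟨key.1 ⟨h1, h3⟩, ⟨h2, trivial⟩, trivial⟩
      · rintro ⟨h1, ⟨h2, -⟩, -⟩
        exact ⟨(key.2 h1).1, h2, (key.2 h1).2⟩
    rw [hset, hp.lintegral_one_sub_lap_interference hlam
      (div_nonneg (Nat.cast_nonneg _) (Nat.cast_nonneg _)) (isRadialPart_neg_sectors s)
      ((uniformOn univ).prod ((coin p.N).prod (expMeasure 1)))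
      (S := {m : Fin p.Npa × Bool × ℝ | m.1 = k ∧ m.2.1 ∈ univ}) (φ := fun m => m.2.2)
      (c' := 1 / p.Npa) (hmk.inter ((measurable_fst.comp measurable_snd) MeasurableSet.univ)) hφ ?_ MeasurableSet.univ hT hz]
    · rw [hsc, hMra]
      congr 3
      push_cast
      ring
    · intro s hs
      rw [setLIntegral_uniform_coin_exp p.N k univ hs, coin_univ hp.N_pos, mul_one]
  · have hcov : p.coverSet (p.lobe j) = {x | x.2 = true} := by
      unfold coverSet
      split
      · exact absurd ‹_› hprot
      · rfl
    have hset : p.raSet m k (if b then p.coverSet (p.lobe j) else (p.coverSet (p.lobe j))ᶜ) =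
        {y | y.1.1 ∈ eqSector p.Mra m ∧
          y.2 ∈ {m : Fin p.Npa × Bool × ℝ | m.1 = k ∧ m.2.1 ∈ ({b} : Set Bool)} ∧ p.loss y.1 ∈ univ} := by
      ext y
      rw [hcov]
      cases b <;> simp [raSet]
    have hmb : MeasurableSet {m : Fin p.Npa × Bool × ℝ | m.1 = k ∧ m.2.1 ∈ ({b} : Set Bool)} :=
      hmk.inter ((measurable_fst.comp measurable_snd) (measurableSet_singleton b))
    have hcb : coin p.N {b} = ENNReal.ofReal (if b then 1 / (p.N : ℝ) else 1 - 1 / (p.N : ℝ)) := by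
      cases b
      · simpa using coin_false p.N
      · simpa using coin_true p.N
    rw [hset, hp.lintegral_one_sub_lap_interference hlam (by positivity) (isRadialPart_eqSector m)
      ((uniformOn univ).prod ((coin p.N).prod (expMeasure 1)))
      (S := {m : Fin p.Npa × Bool × ℝ | m.1 = k ∧ m.2.1 ∈ ({b} : Set Bool)}) (φ := fun m => m.2.2)
      (c' := 1 / p.Npa * (if b then 1 / (p.N : ℝ) else 1 - 1 / (p.N : ℝ))) hmb hφ ?_ MeasurableSet.univ hT hz]
    · congr 3
      ring
    · intro s hs
      rw [setLIntegral_uniform_coin_exp p.N k {b} hs, hcb, ← ENNReal.ofReal_mul (by positivity)]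

/-- The users are split by whether their main lobe covers the base station. After division by the
signal gain the covering ones have `T = Γra` and the others `T = (g / G) Γra`, with densities
thinned by `1 / N` and `1 - 1 / N`. -/
lemma Valid.lintegral_lap_interfRA [IsProbabilityMeasure μ] (hp : p.Valid)
    {X : Ω → Measure ((ℂ × Bool) × Fin p.Npa × Bool × ℝ)} {lam : ℝ} (hlam : 0 ≤ lam)
    (h : IsPPP X ((p.linkIntensity lam).prod ((uniformOn univ).prod ((coin p.N).prod (expMeasure 1)))) μ)
    (m : Fin p.Mra) (k : Fin p.Npa) (j : Fin p.Kcs) {z : ℝ} (hz : 0 < z) :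
    ∫⁻ ω, lap (ENNReal.ofReal (p.Γra * z / (p.Pu * p.Mra * p.G)) * p.interfRA m k (p.lobe j) (X ω)) ∂μ =
      ENNReal.ofReal (p.U z p.Γra (lam / (p.N * p.Mra * p.Npa))) *
        ENNReal.ofReal (p.U z (p.g / p.G * p.Γra) ((1 - 1 / (p.N : ℝ)) * (lam / (p.Mra * p.Npa)))) := by
  classical
  have := isFiniteMeasure_uniformOn_univ (n := p.Npa)
  have := hp.sigmaFinite_linkIntensity lam
  have hG := hp.G_pos
  have hg := hp.g_nonneg
  have hPu := hp.Pu_pos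
  have hΓ := hp.Γra_pos
  have hM : (0 : ℝ) < p.Mra := by exact_mod_cast hp.Mra_pos
  have hN : (0 : ℝ) < p.N := by exact_mod_cast hp.N_pos
  set a := p.Γra * z / (p.Pu * p.Mra * p.G) with ha
  have ha0 : 0 ≤ a := by positivity
  set C := p.coverSet (p.lobe j) with hCdef
  have hC : MeasurableSet C := measurableSet_coverSet _
  have hS := measurableSet_raSet m k (MeasurableSet.univ (α := ℂ × Bool))
  have hS1 := measurableSet_raSet m k hC
  have hS2 := measurableSet_raSet m k hC.compl
  let f : (ℂ × Bool) × Fin p.Npa × Bool × ℝ → ℝ≥0∞ := fun y => ENNReal.ofReal (p.Pu * p.Mra *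
      (if (y.1.1, y.2.2.1) ∈ C then p.G else p.g) * y.2.2.2 / p.loss y.1)
  have hf : Measurable f := measurable_raGain (p.lobe j)
  have h1 : ∀ ω, ENNReal.ofReal a * p.interfRA m k (p.lobe j) (X ω) =
      ∫⁻ y, ENNReal.ofReal a * (p.raSet m k univ).indicator f y ∂(X ω) := by
    intro ω
    rw [lintegral_const_mul _ (hf.indicator hS), lintegral_indicator hS]
    rfl
  simp_rw [h1]
  rw [h.lintegral_lap_lintegral ((hf.indicator hS).const_mul _)]
  have hle : ∀ T : ℝ, Measurable fun y : (ℂ × Bool) × Fin p.Npa × Bool × ℝ =>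
      1 - lap (ENNReal.ofReal (T * z * y.2.2.2 / p.loss y.1)) := by
    intro T
    have h2 : Measurable fun y : (ℂ × Bool) × Fin p.Npa × Bool × ℝ => p.loss y.1 :=
      p.measurable_loss.comp measurable_fst
    have h3 : Measurable fun y : (ℂ × Bool) × Fin p.Npa × Bool × ℝ =>
      ENNReal.ofReal (T * z * y.2.2.2 / p.loss y.1) := by fun_prop
    exact measurable_const.sub (measurable_lap.comp h3)
  have h2 : ∀ y, 1 - lap (ENNReal.ofReal a * (p.raSet m k univ).indicator f y) =
      (p.raSet m k C).indicator (fun y => 1 - lap (ENNReal.ofReal (p.Γra * z * y.2.2.2 / p.loss y.1))) y +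
      (p.raSet m k Cᶜ).indicator
        (fun y => 1 - lap (ENNReal.ofReal (p.g / p.G * p.Γra * z * y.2.2.2 / p.loss y.1))) y := by
    intro y
    by_cases hy : y ∈ p.raSet m k univ
    · rw [indicator_of_mem hy]
      by_cases hyC : (y.1.1, y.2.2.1) ∈ C
      · rw [indicator_of_mem (show y ∈ p.raSet m k C from ⟨hy.1, hy.2.1, hyC⟩),
          indicator_of_notMem (fun h' => h'.2.2 hyC), add_zero]
        simp only [f, if_pos hyC]
        rw [← ENNReal.ofReal_mul ha0]
        congr 3
        rw [ha]
        field_simp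
      · rw [indicator_of_mem (show y ∈ p.raSet m k Cᶜ from ⟨hy.1, hy.2.1, hyC⟩),
          indicator_of_notMem (fun h' => hyC h'.2.2), zero_add]
        simp only [f, if_neg hyC]
        rw [← ENNReal.ofReal_mul ha0]
        congr 3
        rw [ha]
        field_simp
    · rw [indicator_of_notMem hy, indicator_of_notMem (fun h' => hy ⟨h'.1, h'.2.1, trivial⟩),
        indicator_of_notMem (fun h' => hy ⟨h'.1, h'.2.1, trivial⟩), mul_zero, lap_zero, add_zero, tsub_self]
  simp_rw [h2]
  have h3 := hp.lintegral_raSet_coverSet hlam m k j hΓ.le hz true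
  have h4 := hp.lintegral_raSet_coverSet hlam m k j (T := p.g / p.G * p.Γra) (by positivity) hz false
  simp only [if_true, Bool.false_eq_true, if_false] at h3 h4
  rw [lintegral_add_left ((hle _).indicator hS1), lintegral_indicator hS1, lintegral_indicator hS2, lap_add,
    h3, h4, hp.lap_radial_U, hp.lap_radial_U]
  congr 3
  · field_simp
  · ring

end RandomAccess

end Params

end

end MmWave


namespace MmWave

noncomputable section

open Filter Topology

/-! ### SINR conditions under Rayleigh fading -/

lemma le_sinr_ofReal_iff {Γ z c n : ℝ} (hΓ : 0 ≤ Γ) (hz : 0 < z) (hc : 0 < c) (hn : 0 < n) (F : ℝ)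
    (I : ℝ≥0∞) :
    ENNReal.ofReal Γ ≤ ENNReal.ofReal (c * F) / ENNReal.ofReal z / (I + ENNReal.ofReal n) ↔
      ENNReal.ofReal (Γ * z / c) * I + ENNReal.ofReal (Γ * z * n / c) ≤ ENNReal.ofReal F := by
  rw [Params.le_sinr_iff ENNReal.ofReal_ne_top (ENNReal.ofReal_pos.2 hz).ne' (ENNReal.ofReal_pos.2 hn).ne']
  have h1 : ENNReal.ofReal Γ * (I + ENNReal.ofReal n) * ENNReal.ofReal z =
      ENNReal.ofReal c * (ENNReal.ofReal (Γ * z / c) * I + ENNReal.ofReal (Γ * z * n / c)) := by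
    rw [mul_add, mul_add, ← mul_assoc, ← ENNReal.ofReal_mul hc.le, ← ENNReal.ofReal_mul hc.le, add_mul,
      mul_div_cancel₀ _ hc.ne', mul_div_cancel₀ _ hc.ne', ← ENNReal.ofReal_mul hΓ,
      ← ENNReal.ofReal_mul (by positivity), ENNReal.ofReal_mul hΓ]
    congr 1
    · ring
    · congr 1
      ring
  rw [h1, ENNReal.ofReal_mul hc.le]
  exact ENNReal.mul_le_mul_iff_right (ENNReal.ofReal_pos.2 hc).ne' ENNReal.ofReal_ne_top

/-- Probability that the SINR exceeds a threshold under Rayleigh fading. -/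
lemma measure_le_sinr {Ω : Type*} [MeasurableSpace Ω] {μ : Measure Ω} [IsProbabilityMeasure μ]
    {Γ z c n : ℝ} (hΓ : 0 ≤ Γ) (hz : 0 < z) (hc : 0 < c) (hn : 0 < n) {I : Ω → ℝ≥0∞} {F : Ω → ℝ}
    (h : IndepFun I F μ) (hI : Measurable I) (hF : Measurable F) (hlaw : μ.map F = expMeasure 1) :
    μ {ω | ENNReal.ofReal Γ ≤ ENNReal.ofReal (c * F ω) / ENNReal.ofReal z / (I ω + ENNReal.ofReal n)} =
      ENNReal.ofReal (Real.exp (-(Γ * z * n / c))) * ∫⁻ ω, lap (ENNReal.ofReal (Γ * z / c) * I ω) ∂μ := by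
  simp_rw [le_sinr_ofReal_iff hΓ hz hc hn]
  have hm : Measurable fun ω => lap (ENNReal.ofReal (Γ * z / c) * I ω) :=
    measurable_lap.comp (hI.const_mul _)
  have hg : Measurable fun x => ENNReal.ofReal (Γ * z / c) * x + ENNReal.ofReal (Γ * z * n / c) :=
    (measurable_id.const_mul _).add_const _
  rw [measure_le_exp (F := F) (I := fun ω => ENNReal.ofReal (Γ * z / c) * I ω + ENNReal.ofReal (Γ * z * n / c))
    (h.comp hg measurable_id) (hg.comp hI) hF hlaw]
  simp_rw [lap_add]
  rw [lintegral_mul_const _ hm, lap_ofReal (by positivity), mul_comm]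

namespace Params

variable {p : Params}

/-! ## Data transmission -/

section DataTransmission

variable {Ω : Type*} [MeasurableSpace Ω] {μ : Measure Ω}

/-- The received power from a base station in data transmission, if its beam covers the user. -/
def dlPower (p : Params) (gain : ℝ) (y : (ℂ × Bool) × Bool × ℝ) : ℝ≥0∞ :=
  {y : (ℂ × Bool) × Bool × ℝ | y.2.1 = true}.indicator
    (fun y => ENNReal.ofReal (p.Pb * p.M * gain * y.2.2 / p.loss y.1)) y

lemma measurableSet_beam : MeasurableSet {y : (ℂ × Bool) × Bool × ℝ | y.2.1 = true} :=
  (measurable_fst.comp measurable_snd) (measurableSet_singleton true)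

lemma measurable_dlPower (gain : ℝ) : Measurable (p.dlPower gain) := by
  have h2 : Measurable fun y : (ℂ × Bool) × Bool × ℝ => p.loss y.1 :=
    p.measurable_loss.comp measurable_fst
  have h3 : Measurable fun y : (ℂ × Bool) × Bool × ℝ =>
    ENNReal.ofReal (p.Pb * p.M * gain * y.2.2 / p.loss y.1) := by fun_prop
  exact h3.indicator measurableSet_beam

/-- Data phase interference from the points of path loss larger than `z` in a sector. -/
def interfSector (p : Params) (i : Fin p.Kcs) (z : ℝ≥0∞) (gain : ℝ)
    (ν : Measure ((ℂ × Bool) × Bool × ℝ)) : ℝ≥0∞ :=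
  ∫⁻ y in p.sectorSet i (Ioi z), p.dlPower gain y ∂ν

lemma measurable_interfSector (i : Fin p.Kcs) (z : ℝ≥0∞) (gain : ℝ) :
    Measurable (p.interfSector i z gain) := by
  have hS : MeasurableSet (p.sectorSet i (Ioi z) : Set ((ℂ × Bool) × Bool × ℝ)) :=
    measurableSet_sectorSet i measurableSet_Ioi
  have := Measure.measurable_lintegral ((p.measurable_dlPower gain).indicator hS)
  simp only [lintegral_indicator hS] at this
  exact this

lemma measurable_interfSector_kernel (i : Fin p.Kcs) (gain : ℝ)
    (κ : Kernel (Measure ((ℂ × Bool) × Bool × ℝ)) ((ℂ × Bool) × Bool × ℝ)) [IsSFiniteKernel κ] :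
    Measurable fun q : ℝ≥0∞ × Measure ((ℂ × Bool) × Bool × ℝ) => p.interfSector i q.1 gain (κ q.2) :=
  measurable_lintegral_sectorSet i κ (A := fun z => Ioi z)
    (measurableSet_lt measurable_fst measurable_snd) (p.measurable_dlPower gain)

lemma interfSector_restrict (i : Fin p.Kcs) (z : ℝ≥0∞) (gain : ℝ) (ν : Measure ((ℂ × Bool) × Bool × ℝ)) :
    p.interfSector i z gain (ν.restrict (p.sectorSet i univ)) = p.interfSector i z gain ν := by
  rw [interfSector, Measure.restrict_restrict (measurableSet_sectorSet i measurableSet_Ioi),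
    inter_eq_left.2 (sectorSet_mono i (subset_univ _)), interfSector]

variable [IsProbabilityMeasure μ] {X : Ω → Measure ((ℂ × Bool) × Bool × ℝ)}

/-- The beam indicator thins the density by `1 / M`. The relation `haT` absorbs the antenna gain
into `T`, so main and side lobe sectors are treated alike. -/
lemma Valid.lintegral_lap_interfSector (hp : p.Valid)
    (h : IsPPP X ((p.linkIntensity p.lam).prod ((coin p.M).prod (expMeasure 1))) μ) (i : Fin p.Kcs)
    (z' : ℝ≥0∞) {gain a T z : ℝ} (ha : 0 ≤ a) (hT : 0 ≤ T) (hz : 0 < z)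
    (haT : a * (p.Pb * p.M * gain) = T * z) :
    ∫⁻ ω, lap (ENNReal.ofReal a * p.interfSector i z' gain (X ω)) ∂μ =
      lap (ENNReal.ofReal (2 * π * (p.lam / (p.M * p.Kcs))) *
        p.radial ((ENNReal.ofReal ⁻¹' (Ioi z')).indicator fun l => ENNReal.ofReal (T * z / (T * z + l)))) := by
  have := hp.sigmaFinite_linkIntensity p.lam
  have hS : MeasurableSet (p.sectorSet i (Ioi z') : Set ((ℂ × Bool) × Bool × ℝ)) :=
    measurableSet_sectorSet i measurableSet_Ioi
  have hB : MeasurableSet (ENNReal.ofReal ⁻¹' (Ioi z')) := ENNReal.measurable_ofReal measurableSet_Ioi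
  have hbm : MeasurableSet {m : Bool × ℝ | m.1 = true} := measurable_fst (measurableSet_singleton true)
  have hf := (p.measurable_dlPower gain).indicator hS
  have h1 : ∀ ω, ENNReal.ofReal a * p.interfSector i z' gain (X ω) =
      ∫⁻ y, ENNReal.ofReal a * (p.sectorSet i (Ioi z')).indicator (p.dlPower gain) y ∂(X ω) := by
    intro ω
    rw [lintegral_const_mul _ hf, lintegral_indicator hS]
    rfl
  simp_rw [h1]
  rw [h.lintegral_lap_lintegral (hf.const_mul _)]
  have hS' : MeasurableSet {y : (ℂ × Bool) × Bool × ℝ | y.1.1 ∈ eqSector p.Kcs i ∧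
      y.2 ∈ {m : Bool × ℝ | m.1 = true} ∧ p.loss y.1 ∈ ENNReal.ofReal ⁻¹' (Ioi z')} := by
    have h2 : MeasurableSet {y : (ℂ × Bool) × Bool × ℝ | y.1.1 ∈ eqSector p.Kcs i} :=
      (measurableSet_eqSector i).preimage (measurable_fst.comp measurable_fst)
    exact h2.inter ((measurable_snd hbm).inter ((p.measurable_loss.comp measurable_fst) hB))
  have h2 := hp.lintegral_one_sub_lap_interference hp.lam_pos.le
    (div_nonneg zero_le_one (Nat.cast_nonneg _)) (isRadialPart_eqSector i)
    ((coin p.M).prod (expMeasure 1)) hbm (φ := fun m => m.2) (c' := 1 / p.M) measurable_snd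
    (fun s hs => by rw [setLIntegral_coin_exp p.M true hs, coin_true]) hB hT hz
  rw [← lintegral_indicator hS'] at h2
  have h3 : p.lam / (p.M * p.Kcs) = p.lam * (1 / (p.Kcs : ℝ)) * (1 / (p.M : ℝ)) := by
    rw [mul_one_div, mul_one_div, div_div, mul_comm (p.M : ℝ)]
  rw [h3, ← h2]
  congr 1
  refine lintegral_congr fun y => ?_
  by_cases hy : y ∈ (p.sectorSet i (Ioi z') : Set ((ℂ × Bool) × Bool × ℝ))
  · rw [indicator_of_mem hy, dlPower]
    by_cases hb : y.2.1 = true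
    · rw [indicator_of_mem (by exact hb), indicator_of_mem (by exact ⟨hy.1, hb, hy.2⟩),
        ← ENNReal.ofReal_mul ha, ← haT]
      congr 3
      ring
    · rw [indicator_of_notMem (by exact hb), indicator_of_notMem (fun h' => hb h'.2.1), mul_zero, lap_zero,
        tsub_self]
  · rw [indicator_of_notMem hy, indicator_of_notMem (fun h' => hy ⟨h'.1, h'.2.2⟩), mul_zero, lap_zero,
      tsub_self]

open Classical in
/-- Data phase interference, when `s` are the sectors in the user beam and the interferers in the
`i`-th sector have path loss larger than `w i`. -/
def interfDL (p : Params) (s : Finset (Fin p.Kcs)) (w : Fin p.Kcs → ℝ≥0∞)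
    (ν : Measure ((ℂ × Bool) × Bool × ℝ)) : ℝ≥0∞ :=
  ∑ i, p.interfSector i (w i) (if i ∈ s then p.G else p.g) ν

lemma measurable_interfDL (s : Finset (Fin p.Kcs)) (w : Fin p.Kcs → ℝ≥0∞) :
    Measurable (p.interfDL s w) := by
  unfold interfDL
  exact Finset.measurable_sum _ fun i _ => measurable_interfSector i _ _

open Classical in
/-- The Laplace transform of the interference from a detected or undetected sector. -/
def dlFactor (p : Params) (Γ z : ℝ) (s : Finset (Fin p.Kcs)) (i : Fin p.Kcs) (b : Bool) : ℝ :=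
  if b then p.V z (if i ∈ s then Γ else p.g / p.G * Γ) (p.lam / (p.M * p.Kcs))
  else p.U z (if i ∈ s then Γ else p.g / p.G * Γ) (p.lam / (p.M * p.Kcs))

/-- Restrictions of the process to distinct sectors are independent, so the Laplace transform is a
product. A detected sector is cut off at `z` and gives `V`; an undetected one is complete and gives
`U`. -/
theorem Valid.lintegral_lap_interfDL (hp : p.Valid)
    (h : IsPPP X ((p.linkIntensity p.lam).prod ((coin p.M).prod (expMeasure 1))) μ)
    (s : Finset (Fin p.Kcs)) (b : Fin p.Kcs → Bool) {Γ z : ℝ} (hΓ : 0 ≤ Γ) (hz : 0 < z) :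
    ∫⁻ ω, lap (ENNReal.ofReal (Γ * z / (p.Pb * p.M * p.G)) *
      p.interfDL s (fun i => if b i then ENNReal.ofReal z else 0) (X ω)) ∂μ =
      ∏ i, ENNReal.ofReal (p.dlFactor Γ z s i (b i)) := by
  classical
  have := hp.sigmaFinite_linkIntensity p.lam
  have hG := hp.G_pos
  have hg := hp.g_nonneg
  have hPb := hp.Pb_pos
  have hM : (0 : ℝ) < p.M := by exact_mod_cast hp.M_pos
  have hS : ∀ i, MeasurableSet (p.sectorSet i univ : Set ((ℂ × Bool) × Bool × ℝ)) := fun i =>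
    measurableSet_sectorSet i MeasurableSet.univ
  set a := Γ * z / (p.Pb * p.M * p.G) with ha
  have ha0 : 0 ≤ a := by positivity
  let w : Fin p.Kcs → ℝ≥0∞ := fun i => if b i then ENNReal.ofReal z else 0
  let φ : Fin p.Kcs → Measure ((ℂ × Bool) × Bool × ℝ) → ℝ≥0∞ := fun i ν =>
    lap (ENNReal.ofReal a * p.interfSector i (w i) (if i ∈ s then p.G else p.g) ν)
  have hφ : ∀ i, Measurable (φ i) := fun i =>
    measurable_lap.comp ((measurable_interfSector i _ _).const_mul _)
  have hi := (h.iIndepFun_restrict _ hS (pairwise_disjoint_sectorSet univ)).comp φ hφ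
  have h1 : ∀ ω, lap (ENNReal.ofReal a * p.interfDL s w (X ω)) =
      ∏ i, (φ i ∘ fun ω => (X ω).restrict (p.sectorSet i univ)) ω := by
    intro ω
    rw [interfDL, Finset.mul_sum, lap_sum]
    refine Finset.prod_congr rfl fun i _ => ?_
    simp only [φ, Function.comp_apply, interfSector_restrict]
  have h2 : ∀ i, Measurable (φ i ∘ fun ω => (X ω).restrict (p.sectorSet i univ)) := fun i =>
    (hφ i).comp ((measurable_measure_restrict (hS i)).comp h.measurable)
  change ∫⁻ ω, lap (ENNReal.ofReal a * p.interfDL s w (X ω)) ∂μ = _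
  simp_rw [h1]
  rw [lintegral_prod_eq_prod_lintegral_of_indepFun _ _ hi h2]
  refine Finset.prod_congr rfl fun i _ => ?_
  simp only [φ, Function.comp_apply, interfSector_restrict]
  have hT0 : 0 ≤ (if i ∈ s then Γ else p.g / p.G * Γ) := by split_ifs <;> positivity
  have haT : a * (p.Pb * p.M * (if i ∈ s then p.G else p.g)) =
      (if i ∈ s then Γ else p.g / p.G * Γ) * z := by
    rw [ha]
    split_ifs <;> field_simp
  rw [hp.lintegral_lap_interfSector h i (w i) ha0 hT0 hz haT]
  cases hb : b i
  · have hw : w i = 0 := by simp [w, hb]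
    have h3 : p.radial ((ENNReal.ofReal ⁻¹' (Ioi (w i))).indicator fun l => ENNReal.ofReal
        ((if i ∈ s then Γ else p.g / p.G * Γ) * z / ((if i ∈ s then Γ else p.g / p.G * Γ) * z + l))) =
        p.radial (univ.indicator fun l => ENNReal.ofReal
        ((if i ∈ s then Γ else p.g / p.G * Γ) * z / ((if i ∈ s then Γ else p.g / p.G * Γ) * z + l))) := by
      refine hp.radial_congr fun l hl => ?_
      rw [indicator_of_mem (mem_univ l), indicator_of_mem]
      rw [hw]
      exact ENNReal.ofReal_pos.2 hl
    rw [h3, hp.lap_radial_U]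
    simp [dlFactor]
  · have hw : ENNReal.ofReal ⁻¹' (Ioi (w i)) = Ioi z := by
      ext l
      simp only [w, hb, if_true, mem_preimage, mem_Ioi]
      exact ENNReal.ofReal_lt_ofReal_iff_of_nonneg hz.le
    rw [hw, hp.lap_radial_V hz]
    simp [dlFactor]

end DataTransmission

end Params

end

end MmWave


namespace MmWave

noncomputable section

open Filter Topology

namespace Params

variable {p : Params}

namespace Network

variable {Ω : Type*} (X : p.Network Ω)

/-! ## The network in terms of the path losses of the detected sectors -/

/-- The path loss of the `j`-th sector if it is detected, and `∞` otherwise. -/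
def det (j : Fin p.Kcs) (ω : Ω) : ℝ≥0∞ := p.detLoss j (X.cs ω)

lemma minLoss_eq (j : Fin p.Kcs) (ω : Ω) : X.minLoss j ω = p.minLossOf j (X.cs ω) := rfl

lemma sinrSS_eq (j : Fin p.Kcs) (ω : Ω) :
    X.sinrSS j ω = p.sinrOf j (p.minLossOf j (X.cs ω)) (X.cs ω) := rfl

lemma mem_detected (j : Fin p.Kcs) (ω : Ω) : j ∈ X.detected ω ↔ ENNReal.ofReal p.Γcs ≤ X.sinrSS j ω := by
  simp [detected]

lemma det_of_mem {j : Fin p.Kcs} {ω : Ω} (h : j ∈ X.detected ω) : X.det j ω = X.minLoss j ω := by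
  rw [mem_detected, sinrSS_eq] at h
  rw [det, detLoss, if_pos h, minLoss_eq]

lemma det_of_notMem {j : Fin p.Kcs} {ω : Ω} (h : j ∉ X.detected ω) : X.det j ω = ∞ := by
  rw [mem_detected, sinrSS_eq] at h
  rw [det, detLoss, if_neg h]

/-- A minimum path loss `∞` forces SINR `0`, below the positive threshold, so the value `∞` of `det`
unambiguously marks undetected sectors. -/
lemma mem_detected_iff (hp : p.Valid) (j : Fin p.Kcs) (ω : Ω) : j ∈ X.detected ω ↔ X.det j ω ≠ ∞ := by
  constructor
  · intro h
    rw [X.det_of_mem h]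
    intro htop
    rw [mem_detected, sinrSS, htop, ENNReal.div_top, ENNReal.zero_div] at h
    exact absurd h (not_le.2 (ENNReal.ofReal_pos.2 hp.Γcs_pos))
  · intro h
    by_contra h'
    exact h (X.det_of_notMem h')

/-- The event that the `j`-th sector has the smallest path loss of the detected sectors. -/
def _root_.MmWave.Params.servingSet (p : Params) (j : Fin p.Kcs) : Set (Fin p.Kcs → ℝ≥0∞) :=
  {y | y j ≠ ∞ ∧ ∀ i, i ≠ j → y j < y i}

variable {X} {ω : Ω} {j : Fin p.Kcs}

lemma servingLoss_eq (hp : p.Valid) (h : (fun i => X.det i ω) ∈ p.servingSet j) :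
    X.servingLoss ω = X.det j ω := by
  have hj : j ∈ X.detected ω := (X.mem_detected_iff hp j ω).2 h.1
  refine le_antisymm ?_ ?_
  · rw [X.det_of_mem hj]
    exact iInf₂_le j hj
  · refine le_iInf₂ fun i hi => ?_
    rw [← X.det_of_mem hi]
    by_cases hij : i = j
    · rw [hij]
    · exact (h.2 i hij).le

lemma mainLobe_eq (hp : p.Valid) (h : (fun i => X.det i ω) ∈ p.servingSet j) :
    X.mainLobe ω = p.lobe j := by
  have hj : j ∈ X.detected ω := (X.mem_detected_iff hp j ω).2 h.1
  ext i
  rw [mem_lobe]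
  simp only [mainLobe, Finset.mem_filter, Finset.mem_univ, true_and]
  rw [servingLoss_eq hp h]
  constructor
  · rintro ⟨j', hj', heq, hi⟩
    rw [← X.det_of_mem hj'] at heq
    by_cases hjj : j' = j
    · rw [← hjj, hi]
    · exact absurd heq (h.2 j' hjj).ne'
  · intro hi
    exact ⟨j, hj, (X.det_of_mem hj).symm, hi⟩

/-- The path loss beyond which data phase interferers are found. -/
def _root_.MmWave.Params.dlThreshold (p : Params) (j : Fin p.Kcs) (y : Fin p.Kcs → ℝ≥0∞) (i : Fin p.Kcs) :
    ℝ≥0∞ := if y i = ∞ then 0 else y j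

lemma sectorInterference_eq (i : Fin p.Kcs) (z : ℝ≥0∞) (gain : ℝ) (ω : Ω) :
    X.sectorInterference i z gain ω = p.interfSector i z gain (X.dl ω) := by
  have hset : {y : (ℂ × Bool) × Bool × ℝ | y.1.1 ∈ p.bsSector i ∧ z < ENNReal.ofReal (p.loss y.1) ∧ y.2.1 = true} =
      {y | y.2.1 = true} ∩ p.sectorSet i (Ioi z) := by
    ext y
    exact ⟨fun h => ⟨h.2.2, h.1, h.2.1⟩, fun h => ⟨h.2.1, h.2.2, h.1⟩⟩
  rw [sectorInterference, hset, ← Measure.restrict_restrict measurableSet_beam,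
    ← lintegral_indicator measurableSet_beam]
  rfl

/-- The four groups partition the sectors, so they merge into one sum in which lobe membership sets
the gain and detection sets the threshold. -/
lemma interferenceDL_eq (hp : p.Valid) (h : (fun i => X.det i ω) ∈ p.servingSet j) :
    X.interferenceDL ω = p.interfDL (p.lobe j) (p.dlThreshold j fun i => X.det i ω) (X.dl ω) := by
  classical
  rw [interferenceDL, mainLobe_eq hp h, servingLoss_eq hp h, interfDL]
  simp only [sectorInterference_eq]
  have key : ∀ (s : Finset (Fin p.Kcs)) (f : Fin p.Kcs → ℝ≥0∞), ∑ i ∈ s, f i = ∑ i, if i ∈ s then f i else 0 := by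
    intro s f
    rw [Finset.sum_ite_mem, Finset.univ_inter]
  rw [key, key (_ \ _), key (X.detected ω \ _), key (_ᶜ), ← Finset.sum_add_distrib, ← Finset.sum_add_distrib,
    ← Finset.sum_add_distrib]
  refine Finset.sum_congr rfl fun i _ => ?_
  by_cases h1 : i ∈ p.lobe j <;> by_cases h2 : i ∈ X.detected ω
  · simp [h1, h2, dlThreshold, (X.mem_detected_iff hp i ω).1 h2]
  · simp [h1, h2, dlThreshold, X.det_of_notMem h2]
  · simp [h1, h2, dlThreshold, (X.mem_detected_iff hp i ω).1 h2]
  · simp [h1, h2, dlThreshold, X.det_of_notMem h2]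

lemma covers_iff (x : ℂ) (δ : Bool) : X.covers ω x δ ↔ (x, δ) ∈ p.coverSet (X.mainLobe ω) := by
  unfold covers coverSet
  cases p.protocol <;> rfl

lemma sinrRA_eq (hp : p.Valid) (h : (fun i => X.det i ω) ∈ p.servingSet j) (m : Fin p.Mra) :
    X.sinrRA m ω = ENNReal.ofReal (p.Pu * p.Mra * p.G * X.fadingRA ω) / X.det j ω /
      (p.interfRA m (X.preamble ω) (p.lobe j) (X.ra ω) + ENNReal.ofReal p.noise) := by
  have hset : {y : (ℂ × Bool) × Fin p.Npa × Bool × ℝ |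
      y.1.1 ∈ sector 0 (2 * π * (m : ℝ) / p.Mra) (2 * π * ((m : ℝ) + 1) / p.Mra) ∧ y.2.1 = X.preamble ω} =
      p.raSet m (X.preamble ω) univ := by
    ext y
    exact ⟨fun h => ⟨h.1, h.2, trivial⟩, fun h => ⟨h.1, h.2.1⟩⟩
  rw [sinrRA, servingLoss_eq hp h, hset, interfRA, ← mainLobe_eq hp h]
  congr 2
  refine lintegral_congr fun y => ?_
  by_cases hy : X.covers ω y.1.1 y.2.2.1
  · rw [if_pos hy, if_pos ((covers_iff _ _).1 hy)]
  · rw [if_neg hy, if_neg (mt (covers_iff _ _).2 hy)]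

lemma sinrDL_eq (hp : p.Valid) (h : (fun i => X.det i ω) ∈ p.servingSet j) :
    X.sinrDL ω = ENNReal.ofReal (p.Pb * p.M * p.G * X.fadingDL ω) / X.det j ω /
      (p.interfDL (p.lobe j) (p.dlThreshold j fun i => X.det i ω) (X.dl ω) + ENNReal.ofReal p.noise) := by
  rw [sinrDL, servingLoss_eq hp h, interferenceDL_eq hp h]

lemma mem_csSuccess_of_servingSet (hp : p.Valid) (h : (fun i => X.det i ω) ∈ p.servingSet j) :
    ω ∈ X.csSuccess := ⟨j, (X.mem_detected_iff hp j ω).2 h.1⟩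

lemma mem_csSuccess_iff (hp : p.Valid) : ω ∈ X.csSuccess ↔ ∃ i, X.det i ω ≠ ∞ := by
  constructor
  · rintro ⟨j, hj⟩
    exact ⟨j, (X.mem_detected_iff hp j ω).1 hj⟩
  · rintro ⟨j, hj⟩
    exact ⟨j, (X.mem_detected_iff hp j ω).2 hj⟩

lemma _root_.MmWave.Params.exists_mem_servingSet {y : Fin p.Kcs → ℝ≥0∞} (h0 : ∃ i, y i ≠ ∞)
    (hne : ∀ i i', i ≠ i' → y i ≠ ∞ → y i ≠ y i') : ∃ j, y ∈ p.servingSet j := by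
  obtain ⟨i₀, hi₀⟩ := h0
  obtain ⟨j, -, hj⟩ := Finset.exists_min_image Finset.univ y ⟨i₀, Finset.mem_univ _⟩
  have hjt : y j ≠ ∞ := ((hj i₀ (Finset.mem_univ _)).trans_lt hi₀.lt_top).ne
  exact ⟨j, hjt, fun i hij => lt_of_le_of_ne (hj i (Finset.mem_univ _)) (hne j i hij.symm hjt)⟩

lemma _root_.MmWave.Params.servingSet_unique {y : Fin p.Kcs → ℝ≥0∞} {j j' : Fin p.Kcs}
    (h : y ∈ p.servingSet j) (h' : y ∈ p.servingSet j') : j = j' := by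
  by_contra hne
  exact lt_asymm (h.2 j' (Ne.symm hne)) (h'.2 j hne)

lemma _root_.MmWave.Params.measurableSet_servingSet (j : Fin p.Kcs) : MeasurableSet (p.servingSet j) := by
  have h1 : MeasurableSet {y : Fin p.Kcs → ℝ≥0∞ | y j ≠ ∞} :=
    (measurableSet_singleton ∞).compl.preimage (measurable_pi_apply j)
  have h2 : p.servingSet j = {y | y j ≠ ∞} ∩ ⋂ i, ⋂ (_ : i ≠ j), {y | y j < y i} := by
    ext y
    simp [servingSet]
  rw [h2]
  exact h1.inter (MeasurableSet.iInter fun i => MeasurableSet.iInter fun _ =>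
    measurableSet_lt (measurable_pi_apply j) (measurable_pi_apply i))

/-! ## Independence -/

/-- The information in the random elements of the model. -/
@[reducible]
def info (X : p.Network Ω) : Fin 7 → MeasurableSpace Ω :=
  ![MeasurableSpace.comap X.cs inferInstance, MeasurableSpace.comap X.co inferInstance,
    MeasurableSpace.comap X.ra inferInstance, MeasurableSpace.comap X.dl inferInstance,
    MeasurableSpace.comap X.preamble inferInstance, MeasurableSpace.comap X.fadingRA inferInstance,
    MeasurableSpace.comap X.fadingDL inferInstance]

lemma measurable_of_info {S : Set (Fin 7)} {i : Fin 7} (hi : i ∈ S) {α : Type*} [m : MeasurableSpace α]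
    {f : Ω → α} (hf : MeasurableSpace.comap f m = X.info i) : Measurable[⨆ i ∈ S, X.info i] f := by
  refine Measurable.mono (comap_measurable f) ?_ le_rfl
  rw [hf]
  exact le_iSup₂_of_le i hi le_rfl

variable [mΩ : MeasurableSpace Ω] {μ : Measure Ω}

lemma HasLaw.info_le (hX : X.HasLaw μ) (i : Fin 7) : X.info i ≤ mΩ := by
  fin_cases i
  · exact hX.cs_ppp.measurable.comap_le
  · exact hX.co_ppp.measurable.comap_le
  · exact hX.ra_ppp.measurable.comap_le
  · exact hX.dl_ppp.measurable.comap_le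
  · exact hX.preamble_meas.comap_le
  · exact hX.fadingRA_meas.comap_le
  · exact hX.fadingDL_meas.comap_le

/-- Functions of disjoint groups of random elements are independent. -/
lemma HasLaw.indepFun (hX : X.HasLaw μ) {α β : Type*} [MeasurableSpace α] [MeasurableSpace β]
    {f : Ω → α} {g : Ω → β} {S T : Set (Fin 7)} (hST : Disjoint S T)
    (hf : Measurable[⨆ i ∈ S, X.info i] f) (hg : Measurable[⨆ i ∈ T, X.info i] g) : IndepFun f g μ := by
  have h1 : Indep (⨆ i ∈ S, X.info i) (⨆ i ∈ T, X.info i) μ :=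
    indep_iSup_of_disjoint hX.info_le hX.indep hST
  rw [IndepFun_iff_Indep]
  exact indep_of_indep_of_le_left (indep_of_indep_of_le_right h1 hg.comap_le) hf.comap_le

end Network

end Params

end

end MmWave


namespace MmWave

noncomputable section

open Filter Topology

namespace Params

variable {p : Params}

namespace Network

variable {Ω : Type*} [MeasurableSpace Ω] {μ : Measure Ω} [IsProbabilityMeasure μ] {X : p.Network Ω}

/-! ## Success probabilities for given path losses -/

/-- The phases after cell search succeed, with preamble `k`, for given path losses `y` of the detected
sectors and with serving sector `j`. -/
def laterSuccess (X : p.Network Ω) (cell : Set ℂ) (m : Fin p.Mra) (Γ : ℝ) (j : Fin p.Kcs) (k : Fin p.Npa)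
    (y : Fin p.Kcs → ℝ≥0∞) : Set Ω :=
  {ω | X.preamble ω = k ∧ X.co ω {x | x.1 ∈ cell ∧ x.2.1 = k ∧ x.2.2 = m} = 0 ∧
    ENNReal.ofReal p.Γra ≤ ENNReal.ofReal (p.Pu * p.Mra * p.G * X.fadingRA ω) / y j /
      (p.interfRA m k (p.lobe j) (X.ra ω) + ENNReal.ofReal p.noise) ∧
    ENNReal.ofReal Γ ≤ ENNReal.ofReal (p.Pb * p.M * p.G * X.fadingDL ω) / y j /
      (p.interfDL (p.lobe j) (p.dlThreshold j y) (X.dl ω) + ENNReal.ofReal p.noise)}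

lemma HasLaw.measure_sinrRA (hp : p.Valid) (hX : X.HasLaw μ) (hPhat : μ.real X.csSuccess = p.Phat)
    (m : Fin p.Mra) (k : Fin p.Npa) (j : Fin p.Kcs) {z : ℝ} (hz : 0 < z) :
    μ {ω | ENNReal.ofReal p.Γra ≤ ENNReal.ofReal (p.Pu * p.Mra * p.G * X.fadingRA ω) / ENNReal.ofReal z /
      (p.interfRA m k (p.lobe j) (X.ra ω) + ENNReal.ofReal p.noise)} = ENNReal.ofReal (p.Pra z) := by
  have hG := hp.G_pos
  have hPu := hp.Pu_pos
  have hM : (0 : ℝ) < p.Mra := by exact_mod_cast hp.Mra_pos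
  have h0 : 0 ≤ p.Phat := by rw [← hPhat]; exact measureReal_nonneg
  have hind : IndepFun (fun ω => p.interfRA m k (p.lobe j) (X.ra ω)) X.fadingRA μ :=
    (hX.indepFun (S := {2}) (T := {5}) (by simp) (measurable_of_info (i := 2) (by simp) rfl)
      (measurable_of_info (i := 5) (by simp) rfl)).comp (measurable_interfRA m k (p.lobe j)) measurable_id
  have hra := hX.ra_ppp
  rw [hPhat] at hra
  rw [measure_le_sinr (F := X.fadingRA) (I := fun ω => p.interfRA m k (p.lobe j) (X.ra ω)) hp.Γra_pos.le hz
    (by positivity) hp.noise_pos hind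
    ((measurable_interfRA m k (p.lobe j)).comp hX.ra_ppp.measurable) hX.fadingRA_meas hX.fadingRA_law,
    hp.lintegral_lap_interfRA (mul_nonneg hp.lamU_pos.le h0) hra m k j hz, ← mul_assoc,
    ← ENNReal.ofReal_mul (Real.exp_pos _).le]
  exact (ENNReal.ofReal_mul (mul_nonneg (Real.exp_pos _).le (expNeg_nonneg _))).symm

open Classical in
lemma HasLaw.measure_sinrDL (hp : p.Valid) (hX : X.HasLaw μ) {Γ : ℝ} (hΓ : 0 ≤ Γ) (j : Fin p.Kcs)
    {y : Fin p.Kcs → ℝ≥0∞} {z : ℝ} (hz : 0 < z) (hy : y j = ENNReal.ofReal z) :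
    μ {ω | ENNReal.ofReal Γ ≤ ENNReal.ofReal (p.Pb * p.M * p.G * X.fadingDL ω) / y j /
      (p.interfDL (p.lobe j) (p.dlThreshold j y) (X.dl ω) + ENNReal.ofReal p.noise)} =
      ENNReal.ofReal (Real.exp (-(Γ * z * p.noise / (p.Pb * p.M * p.G)))) *
        ∏ i, ENNReal.ofReal (p.dlFactor Γ z (p.lobe j) i (decide (y i ≠ ∞))) := by
  have hG := hp.G_pos
  have hPb := hp.Pb_pos
  have hM : (0 : ℝ) < p.M := by exact_mod_cast hp.M_pos
  have hind : IndepFun (fun ω => p.interfDL (p.lobe j) (p.dlThreshold j y) (X.dl ω)) X.fadingDL μ :=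
    (hX.indepFun (S := {3}) (T := {6}) (by simp) (measurable_of_info (i := 3) (by simp) rfl)
      (measurable_of_info (i := 6) (by simp) rfl)).comp (measurable_interfDL (p.lobe j) _) measurable_id
  have hthr : p.dlThreshold j y = fun i => if decide (y i ≠ ∞) then ENNReal.ofReal z else 0 := by
    ext i
    rw [dlThreshold, hy]
    by_cases h : y i = ∞ <;> simp [h]
  rw [hy, measure_le_sinr (F := X.fadingDL) (I := fun ω => p.interfDL (p.lobe j) (p.dlThreshold j y) (X.dl ω))
    hΓ hz (by positivity) hp.noise_pos hind
    ((measurable_interfDL (p.lobe j) _).comp hX.dl_ppp.measurable) hX.fadingDL_meas hX.fadingDL_law, hthr,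
    hp.lintegral_lap_interfDL hX.dl_ppp (p.lobe j) _ hΓ hz]

open Classical in
lemma HasLaw.measure_laterSuccess (hp : p.Valid) (hX : X.HasLaw μ) (hPhat : μ.real X.csSuccess = p.Phat)
    {cell : Set ℂ} (hcell : MeasurableSet cell) (hvol : volume cell = ENNReal.ofReal (1.28 / p.lam))
    (m : Fin p.Mra) {Γ : ℝ} (hΓ : 0 ≤ Γ) (j : Fin p.Kcs) (k : Fin p.Npa)
    {y : Fin p.Kcs → ℝ≥0∞} {z : ℝ} (hz : 0 < z) (hy : y j = ENNReal.ofReal z) :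
    μ (X.laterSuccess cell m Γ j k y) = ENNReal.ofReal (1 / p.Npa) * (ENNReal.ofReal p.Pco *
      (ENNReal.ofReal (p.Pra z) * (ENNReal.ofReal (Real.exp (-(Γ * z * p.noise / (p.Pb * p.M * p.G)))) *
        ∏ i, ENNReal.ofReal (p.dlFactor Γ z (p.lobe j) i (decide (y i ≠ ∞)))))) := by
  have h0 : 0 ≤ p.Phat := by rw [← hPhat]; exact measureReal_nonneg
  have hco := hX.co_ppp
  rw [hPhat] at hco
  have hB : MeasurableSet {x : ℂ × Fin p.Npa × Fin p.Mra | x.1 ∈ cell ∧ x.2.1 = k ∧ x.2.2 = m} :=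
    hcell.prod ((measurableSet_singleton k).prod (measurableSet_singleton m))
  let Sco : Set (Measure (ℂ × Fin p.Npa × Fin p.Mra)) :=
    {ν | ν {x | x.1 ∈ cell ∧ x.2.1 = k ∧ x.2.2 = m} = 0}
  have hSco : MeasurableSet Sco := Measure.measurable_coe hB (measurableSet_singleton 0)
  let Sra : Set (Measure ((ℂ × Bool) × Fin p.Npa × Bool × ℝ) × ℝ) :=
    {q | ENNReal.ofReal p.Γra ≤ ENNReal.ofReal (p.Pu * p.Mra * p.G * q.2) / y j /
      (p.interfRA m k (p.lobe j) q.1 + ENNReal.ofReal p.noise)}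
  have hSra : MeasurableSet Sra := by
    refine measurableSet_le measurable_const (Measurable.div ?_
      (((measurable_interfRA m k _).comp measurable_fst).add_const _))
    exact (measurable_snd.const_mul _).ennreal_ofReal.div_const _
  let Sdl : Set (Measure ((ℂ × Bool) × Bool × ℝ) × ℝ) :=
    {q | ENNReal.ofReal Γ ≤ ENNReal.ofReal (p.Pb * p.M * p.G * q.2) / y j /
      (p.interfDL (p.lobe j) (p.dlThreshold j y) q.1 + ENNReal.ofReal p.noise)}
  have hSdl : MeasurableSet Sdl := by
    refine measurableSet_le measurable_const (Measurable.div ?_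
      (((measurable_interfDL _ _).comp measurable_fst).add_const _))
    exact (measurable_snd.const_mul _).ennreal_ofReal.div_const _
  let fra : Ω → Measure ((ℂ × Bool) × Fin p.Npa × Bool × ℝ) × ℝ := fun ω => (X.ra ω, X.fadingRA ω)
  let fdl : Ω → Measure ((ℂ × Bool) × Bool × ℝ) × ℝ := fun ω => (X.dl ω, X.fadingDL ω)
  have m1 : ∀ S : Set (Fin 7), 4 ∈ S → Measurable[⨆ i ∈ S, X.info i] X.preamble := fun S h =>
    measurable_of_info h rfl
  have m2 : ∀ S : Set (Fin 7), 1 ∈ S → Measurable[⨆ i ∈ S, X.info i] X.co := fun S h =>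
    measurable_of_info h rfl
  have m3 : ∀ S : Set (Fin 7), 2 ∈ S → 5 ∈ S → Measurable[⨆ i ∈ S, X.info i] fra := fun S h h' =>
    (measurable_of_info (i := 2) h rfl).prodMk (measurable_of_info (i := 5) h' rfl)
  have m4 : ∀ S : Set (Fin 7), 3 ∈ S → 6 ∈ S → Measurable[⨆ i ∈ S, X.info i] fdl := fun S h h' =>
    (measurable_of_info (i := 3) h rfl).prodMk (measurable_of_info (i := 6) h' rfl)
  -- With the preamble and the losses fixed, collision, preamble SINR and data SINR involve disjoint
  -- groups of random elements, and the probability factors one group at a time.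
  have i1 : IndepFun X.preamble (fun ω => (X.co ω, fra ω, fdl ω)) μ :=
    hX.indepFun (S := {4}) (T := {1, 2, 5, 3, 6}) (by simp) (m1 _ (by simp))
      ((m2 _ (by simp)).prodMk ((m3 _ (by simp) (by simp)).prodMk (m4 _ (by simp) (by simp))))
  have i2 : IndepFun X.co (fun ω => (fra ω, fdl ω)) μ :=
    hX.indepFun (S := {1}) (T := {2, 5, 3, 6}) (by simp) (m2 _ (by simp))
      ((m3 _ (by simp) (by simp)).prodMk (m4 _ (by simp) (by simp)))
  have i3 : IndepFun fra fdl μ :=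
    hX.indepFun (S := {2, 5}) (T := {3, 6}) (by simp) (m3 _ (by simp) (by simp)) (m4 _ (by simp) (by simp))
  have e1 := i1.measure_inter_preimage_eq_mul _ _ (measurableSet_singleton k) (hSco.prod (hSra.prod hSdl))
  have e2 := i2.measure_inter_preimage_eq_mul _ _ hSco (hSra.prod hSdl)
  have e3 := i3.measure_inter_preimage_eq_mul _ _ hSra hSdl
  have f1 : μ (X.preamble ⁻¹' {k}) = ENNReal.ofReal (1 / p.Npa) := by
    rw [← Measure.map_apply hX.preamble_meas (measurableSet_singleton k), hX.preamble_law,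
      uniformOn_univ_singleton]
  have f2 : μ (X.co ⁻¹' Sco) = ENNReal.ofReal p.Pco := hp.measure_noCollision h0 hco hcell hvol k m
  have f3 : μ (fra ⁻¹' Sra) = ENNReal.ofReal (p.Pra z) := by
    have := hX.measure_sinrRA hp hPhat m k j hz
    rw [← hy] at this
    exact this
  have f4 := hX.measure_sinrDL hp hΓ j hz hy
  have f4' : μ (fdl ⁻¹' Sdl) = _ := f4
  rw [← f1, ← f2, ← f3, ← f4', ← e3]
  exact e1.trans (congrArg _ e2)

end Network

end Params

end

end MmWave


namespace MmWave

noncomputable section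

open Filter Topology

namespace Params

variable {p : Params}

/-! ## Averaging over the path losses -/

lemma Valid.measurable_dlFactor (hp : p.Valid) (Γ : ℝ) (s : Finset (Fin p.Kcs)) (i : Fin p.Kcs) (b : Bool) :
    Measurable fun z => p.dlFactor Γ z s i b := by
  unfold dlFactor
  cases b
  · exact hp.measurable_U _ _
  · exact hp.measurable_V _ _

lemma dlFactor_nonneg (Γ z : ℝ) (s : Finset (Fin p.Kcs)) (i : Fin p.Kcs) (b : Bool) :
    0 ≤ p.dlFactor Γ z s i b := by
  cases b <;> exact expNeg_nonneg _

/-- The contribution of a sector of path loss `x` when the serving sector has path loss `u`. -/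
def sectorFactor (p : Params) (Γ : ℝ) (j i : Fin p.Kcs) (u x : ℝ≥0∞) : ℝ≥0∞ :=
  if u < x then (if x = ∞ then ENNReal.ofReal (p.dlFactor Γ u.toReal (p.lobe j) i false)
    else ENNReal.ofReal (p.dlFactor Γ u.toReal (p.lobe j) i true)) else 0

lemma Valid.measurable_sectorFactor (hp : p.Valid) (Γ : ℝ) (j i : Fin p.Kcs) :
    Measurable fun q : ℝ≥0∞ × ℝ≥0∞ => p.sectorFactor Γ j i q.1 q.2 := by
  have h1 : ∀ b, Measurable fun q : ℝ≥0∞ × ℝ≥0∞ =>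
      ENNReal.ofReal (p.dlFactor Γ q.1.toReal (p.lobe j) i b) := fun b =>
    ((hp.measurable_dlFactor Γ (p.lobe j) i b).comp measurable_fst.ennreal_toReal).ennreal_ofReal
  exact Measurable.ite (measurableSet_lt measurable_fst measurable_snd)
    (Measurable.ite (measurable_snd (measurableSet_singleton ∞)) (h1 false) (h1 true)) measurable_const

/-- The contribution of the serving sector of path loss `u`. -/
def servingFactor (p : Params) (Γ : ℝ) (j : Fin p.Kcs) (u : ℝ≥0∞) : ℝ≥0∞ :=
  if u = ∞ then 0 else ENNReal.ofReal p.Pco * (ENNReal.ofReal (p.Pra u.toReal) *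
    ENNReal.ofReal (Real.exp (-(Γ * u.toReal * p.noise / (p.Pb * p.M * p.G))))) *
    ENNReal.ofReal (p.dlFactor Γ u.toReal (p.lobe j) j true)

lemma Valid.measurable_Pra (hp : p.Valid) : Measurable p.Pra := by
  have h1 := hp.measurable_U p.Γra (p.lamU * p.Phat / (p.N * p.Mra * p.Npa))
  have h2 := hp.measurable_U (p.g / p.G * p.Γra) ((1 - 1 / (p.N : ℝ)) * (p.lamU * p.Phat / (p.Mra * p.Npa)))
  unfold Pra
  fun_prop

lemma Pra_nonneg (z : ℝ) : 0 ≤ p.Pra z :=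
  mul_nonneg (mul_nonneg (Real.exp_pos _).le (expNeg_nonneg _)) (expNeg_nonneg _)

lemma Valid.measurable_servingFactor (hp : p.Valid) (Γ : ℝ) (j : Fin p.Kcs) :
    Measurable (p.servingFactor Γ j) := by
  have h1 := hp.measurable_Pra
  have h2 := hp.measurable_dlFactor Γ (p.lobe j) j true
  refine Measurable.ite (measurableSet_singleton ∞) measurable_const ?_
  fun_prop

open Classical in
-- The event that `j` serves is an intersection of conditions `y j < y i`, one per other sector;
-- distributing them over the factors makes the expression a product to which independence applies.
lemma servingSet_indicator_eq (Γ : ℝ) (j : Fin p.Kcs) (y : Fin p.Kcs → ℝ≥0∞) :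
    (p.servingSet j).indicator (fun y => ENNReal.ofReal p.Pco * (ENNReal.ofReal (p.Pra (y j).toReal) *
      ENNReal.ofReal (Real.exp (-(Γ * (y j).toReal * p.noise / (p.Pb * p.M * p.G))))) *
      ∏ i, ENNReal.ofReal (p.dlFactor Γ (y j).toReal (p.lobe j) i (decide (y i ≠ ∞)))) y =
    p.servingFactor Γ j (y j) * ∏ i ∈ Finset.univ.erase j, p.sectorFactor Γ j i (y j) (y i) := by
  by_cases hy : y ∈ p.servingSet j
  · rw [indicator_of_mem hy, servingFactor, if_neg hy.1, mul_assoc _ (ENNReal.ofReal (p.dlFactor _ _ _ _ _)),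
      ← Finset.mul_prod_erase _ _ (Finset.mem_univ j)]
    congr 2
    · simp [hy.1]
    · refine Finset.prod_congr rfl fun i hi => ?_
      rw [sectorFactor, if_pos (hy.2 i (Finset.ne_of_mem_erase hi))]
      by_cases h : y i = ∞ <;> simp [h]
  · rw [indicator_of_notMem hy]
    by_cases h1 : y j = ∞
    · rw [servingFactor, if_pos h1, zero_mul]
    · have h2 : ∃ i, i ≠ j ∧ ¬ y j < y i := by
        by_contra! hcon
        exact hy ⟨h1, hcon⟩
      obtain ⟨i, hij, hi⟩ := h2
      rw [Finset.prod_eq_zero (Finset.mem_erase.2 ⟨hij, Finset.mem_univ i⟩), mul_zero]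
      rw [sectorFactor, if_neg hi]

section Average

variable {Ω : Type*} [MeasurableSpace Ω] {μ : Measure Ω} [IsProbabilityMeasure μ]
  {Y : Fin p.Kcs → Ω → ℝ≥0∞}

/-- Conditionally on the loss `z` of sector `j`, the other sectors contribute independent factors,
each averaged over a detected loss above `z` and the atom at `∞`. -/
lemma Valid.lintegral_servingFactor (hp : p.Valid) (hY : ∀ i, p.IsDetLoss (Y i) μ) (hi : iIndepFun Y μ)
    (Γ : ℝ) (j : Fin p.Kcs) :
    ∫⁻ ω, p.servingFactor Γ j (Y j ω) * ∏ i ∈ Finset.univ.erase j, p.sectorFactor Γ j i (Y j ω) (Y i ω) ∂μ =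
    ∫⁻ z in Ioi (0 : ℝ), ENNReal.ofReal (p.Ptilde z * p.fZ₁ z) * (p.servingFactor Γ j (ENNReal.ofReal z) *
      ∏ i ∈ Finset.univ.erase j,
        (ENNReal.ofReal (p.dlFactor Γ z (p.lobe j) i true) * ENNReal.ofReal (p.Ptail z) +
          ENNReal.ofReal (p.dlFactor Γ z (p.lobe j) i false) * ENNReal.ofReal (1 - p.Pdet))) := by
  classical
  have hm : ∀ i, Measurable (Y i) := fun i => (hY i).measurable
  let s : Finset (Fin p.Kcs) := Finset.univ.erase j
  have hind0 := hi.indepFun_finset {j} s (by simp [s]) hm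
  have hind : IndepFun (Y j) (fun ω (i : s) => Y i ω) μ :=
    hind0.comp (φ := fun v : ({j} : Finset (Fin p.Kcs)) → ℝ≥0∞ => v ⟨j, Finset.mem_singleton_self j⟩)
      (measurable_pi_apply _) measurable_id
  let F : ℝ≥0∞ × (s → ℝ≥0∞) → ℝ≥0∞ := fun q =>
    p.servingFactor Γ j q.1 * ∏ i : s, p.sectorFactor Γ j i q.1 (q.2 i)
  have hsf : ∀ i, Measurable fun q : ℝ≥0∞ × ℝ≥0∞ => p.sectorFactor Γ j i q.1 q.2 := fun i =>
    hp.measurable_sectorFactor Γ j i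
  have hF : Measurable F := by
    refine ((hp.measurable_servingFactor Γ j).comp measurable_fst).mul
      (Finset.measurable_prod _ fun i _ => ?_)
    exact (hsf i).comp (measurable_fst.prodMk ((measurable_pi_apply i).comp measurable_snd))
  have h1 : ∀ ω, p.servingFactor Γ j (Y j ω) *
      ∏ i ∈ Finset.univ.erase j, p.sectorFactor Γ j i (Y j ω) (Y i ω) =
      F (Y j ω, fun i : s => Y i ω) := by
    intro ω
    simp only [F]
    rw [← Finset.prod_coe_sort]
  simp_rw [h1]
  rw [lintegral_indepFun hind (hm j) (measurable_pi_lambda _ fun i => hm i) hF]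
  let φ : ℝ≥0∞ → ℝ≥0∞ := fun u => p.servingFactor Γ j u *
    ∏ i ∈ Finset.univ.erase j, ∫⁻ ω, p.sectorFactor Γ j i u (Y i ω) ∂μ
  have hsfY : ∀ u i, Measurable fun ω => p.sectorFactor Γ j i u (Y i ω) := fun u i =>
    (hsf i).comp (measurable_const.prodMk (hm i))
  have h2 : ∀ u, ∫⁻ ω', F (u, fun i : s => Y i ω') ∂μ = φ u := by
    intro u
    have h3 : ∀ ω', F (u, fun i : s => Y i ω') = p.servingFactor Γ j u *
        ∏ i ∈ Finset.univ.erase j, p.sectorFactor Γ j i u (Y i ω') := by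
      intro ω'
      simp only [F]
      rw [← Finset.prod_coe_sort (Finset.univ.erase j)]
    simp_rw [h3]
    rw [lintegral_const_mul _ (Finset.measurable_prod _ fun i _ => hsfY u i)]
    have hi' : iIndepFun (fun i ω => p.sectorFactor Γ j i u (Y i ω)) μ :=
      hi.comp (fun i x => p.sectorFactor Γ j i u x) fun i => (hsf i).comp measurable_prodMk_left
    rw [lintegral_prod_eq_prod_lintegral_of_indepFun _ _ hi' (hsfY u)]
  simp_rw [h2]
  have hφ : Measurable φ := by
    refine (hp.measurable_servingFactor Γ j).mul (Finset.measurable_prod _ fun i _ => ?_)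
    have h3 : Measurable fun q : ℝ≥0∞ × Ω => p.sectorFactor Γ j i q.1 (Y i q.2) :=
      (hsf i).comp (measurable_fst.prodMk ((hm i).comp measurable_snd))
    exact h3.lintegral_prod_right'
  rw [(hY j).lintegral_of_top φ hφ (by simp [φ, servingFactor])]
  refine setLIntegral_congr_fun measurableSet_Ioi fun z hz => ?_
  have hz' : 0 < z := hz
  simp only [φ]
  congr 2
  refine Finset.prod_congr rfl fun i _ => ?_
  have h4 := (hY i).lintegral_of_lt hp hz'.le (ENNReal.ofReal (p.dlFactor Γ z (p.lobe j) i true))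
    (ENNReal.ofReal (p.dlFactor Γ z (p.lobe j) i false))
  rw [← h4]
  refine lintegral_congr fun ω => ?_
  rw [sectorFactor, ENNReal.toReal_ofReal hz'.le]

/-- The density of the path loss to the tagged base station on the event of success in all phases. -/
def successDensity (p : Params) (Γ z : ℝ) : ℝ :=
  Real.exp (-(Γ * z * p.noise / (p.Pb * p.M * p.G))) * p.Kcs
    * (p.V z Γ (p.lam / (p.M * p.Kcs)) * p.Ptail z
        + p.U z Γ (p.lam / (p.M * p.Kcs)) * (1 - p.Pdet)) ^ (p.q - 1)
    * (p.Ptail z * p.V z (p.g / p.G * Γ) (p.lam / (p.M * p.Kcs))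
        + (1 - p.Pdet) * p.U z (p.g / p.G * Γ) (p.lam / (p.M * p.Kcs))) ^ (p.Kcs - p.q)
    * p.V z Γ (p.lam / (p.M * p.Kcs)) * p.Ptilde z * p.Pra z * p.Pco * p.fZ₁ z

lemma Valid.successDensity_nonneg (hp : p.Valid) (h1 : p.Pdet ≤ 1) {z : ℝ} (hz : 0 ≤ z) (Γ : ℝ) :
    0 ≤ p.successDensity Γ z := by
  have hV : ∀ T lam, 0 ≤ p.V z T lam := fun _ _ => expNeg_nonneg _
  have hU : ∀ T lam, 0 ≤ p.U z T lam := fun _ _ => expNeg_nonneg _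
  have h2 := hp.Ptail_nonneg hz
  have h3 := hp.fZ₁_nonneg hz
  have h4 := hp.Ptilde_nonneg z
  have h5 := p.Pra_nonneg z
  have h6 : 0 ≤ p.Pco := (Real.exp_pos _).le
  have h7 : 0 ≤ 1 - p.Pdet := by linarith
  have h8 := hV Γ (p.lam / (p.M * p.Kcs))
  have h9 := hV (p.g / p.G * Γ) (p.lam / (p.M * p.Kcs))
  have h10 := hU Γ (p.lam / (p.M * p.Kcs))
  have h11 := hU (p.g / p.G * Γ) (p.lam / (p.M * p.Kcs))
  unfold successDensity
  positivity

open Classical in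
-- Apart from `j`, there are `q - 1` sectors in its lobe and `K - q` outside. The result does not
-- depend on `j`, so `K` times one contribution is the whole density.
lemma Valid.sum_servingFactor (hp : p.Valid) (h1 : p.Pdet ≤ 1) (Γ : ℝ) {z : ℝ} (hz : 0 < z) (j : Fin p.Kcs) :
    (p.Kcs : ℝ≥0∞) * (ENNReal.ofReal (p.Ptilde z * p.fZ₁ z) * (p.servingFactor Γ j (ENNReal.ofReal z) *
      ∏ i ∈ Finset.univ.erase j,
        (ENNReal.ofReal (p.dlFactor Γ z (p.lobe j) i true) * ENNReal.ofReal (p.Ptail z) +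
          ENNReal.ofReal (p.dlFactor Γ z (p.lobe j) i false) * ENNReal.ofReal (1 - p.Pdet)))) =
      ENNReal.ofReal (p.successDensity Γ z) := by
  have hV : ∀ T lam, 0 ≤ p.V z T lam := fun _ _ => expNeg_nonneg _
  have hU : ∀ T lam, 0 ≤ p.U z T lam := fun _ _ => expNeg_nonneg _
  have h2 := hp.Ptail_nonneg hz.le
  have h3 := hp.fZ₁_nonneg hz.le
  have h4 := hp.Ptilde_nonneg z
  have h5 := p.Pra_nonneg z
  have h6 : 0 ≤ p.Pco := (Real.exp_pos _).le
  have h7 : 0 ≤ 1 - p.Pdet := by linarith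
  set r := p.lam / (p.M * p.Kcs) with hr
  have hj : j ∈ p.lobe j := mem_lobe.2 rfl
  set A := p.V z Γ r * p.Ptail z + p.U z Γ r * (1 - p.Pdet) with hA
  set B := p.Ptail z * p.V z (p.g / p.G * Γ) r + (1 - p.Pdet) * p.U z (p.g / p.G * Γ) r with hB
  have hA0 : 0 ≤ A := add_nonneg (mul_nonneg (hV _ _) h2) (mul_nonneg (hU _ _) h7)
  have hB0 : 0 ≤ B := add_nonneg (mul_nonneg h2 (hV _ _)) (mul_nonneg h7 (hU _ _))
  have hprod : ∏ i ∈ Finset.univ.erase j,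
        (ENNReal.ofReal (p.dlFactor Γ z (p.lobe j) i true) * ENNReal.ofReal (p.Ptail z) +
          ENNReal.ofReal (p.dlFactor Γ z (p.lobe j) i false) * ENNReal.ofReal (1 - p.Pdet)) =
      ENNReal.ofReal (A ^ (p.q - 1) * B ^ (p.Kcs - p.q)) := by
    have h8 : ∀ i ∈ Finset.univ.erase j,
        (ENNReal.ofReal (p.dlFactor Γ z (p.lobe j) i true) * ENNReal.ofReal (p.Ptail z) +
          ENNReal.ofReal (p.dlFactor Γ z (p.lobe j) i false) * ENNReal.ofReal (1 - p.Pdet)) =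
        ENNReal.ofReal (if i ∈ p.lobe j then A else B) := by
      intro i _
      rw [← ENNReal.ofReal_mul (dlFactor_nonneg _ _ _ _ _), ← ENNReal.ofReal_mul (dlFactor_nonneg _ _ _ _ _),
        ← ENNReal.ofReal_add (mul_nonneg (dlFactor_nonneg _ _ _ _ _) h2)
          (mul_nonneg (dlFactor_nonneg _ _ _ _ _) h7)]
      congr 1
      by_cases hi : i ∈ p.lobe j
      · simp [dlFactor, hi, hA, hr]
      · simp only [dlFactor, hi, hB, hr, if_true, if_false, Bool.false_eq_true]
        ring
    rw [Finset.prod_congr rfl h8, ← ENNReal.ofReal_prod_of_nonneg (fun i _ => by split_ifs <;> assumption),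
      Finset.prod_ite, Finset.prod_const, Finset.prod_const]
    have c1 : (Finset.filter (fun i => i ∈ p.lobe j) (Finset.univ.erase j)).card = p.q - 1 := by
      have : Finset.filter (fun i => i ∈ p.lobe j) (Finset.univ.erase j) = (p.lobe j).erase j := by
        ext i; simp
      rw [this, Finset.card_erase_of_mem hj, hp.card_lobe]
    have c2 : (Finset.filter (fun i => i ∉ p.lobe j) (Finset.univ.erase j)).card = p.Kcs - p.q := by
      have : Finset.filter (fun i => i ∉ p.lobe j) (Finset.univ.erase j) = (p.lobe j)ᶜ := by
        ext i
        simp only [Finset.mem_filter, Finset.mem_erase, Finset.mem_univ, and_true, Finset.mem_compl]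
        exact ⟨fun h => h.2, fun h => ⟨fun h' => h (h' ▸ hj), h⟩⟩
      rw [this, Finset.card_compl, Fintype.card_fin, hp.card_lobe]
    rw [c1, c2]
  have hd : p.dlFactor Γ z (p.lobe j) j true = p.V z Γ r := by simp [dlFactor, hj, hr]
  rw [hprod, servingFactor, if_neg ENNReal.ofReal_ne_top, ENNReal.toReal_ofReal hz.le, hd,
    ← ENNReal.ofReal_mul h5, ← ENNReal.ofReal_mul h6, ← ENNReal.ofReal_mul
      (mul_nonneg h6 (mul_nonneg h5 (Real.exp_pos _).le)),
    ← ENNReal.ofReal_mul (mul_nonneg (mul_nonneg h6 (mul_nonneg h5 (Real.exp_pos _).le)) (hV _ _)),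
    ← ENNReal.ofReal_mul (mul_nonneg h4 h3), ← ENNReal.ofReal_natCast,
    ← ENNReal.ofReal_mul (Nat.cast_nonneg _)]
  congr 1
  rw [successDensity, ← hr, ← hA, ← hB]
  ring

/-- The tail integral is a probability depending on a parameter, hence measurable in it. -/
lemma IsDetLoss.aemeasurable_Ptail (hp : p.Valid) {Y : Ω → ℝ≥0∞} (h : p.IsDetLoss Y μ) :
    AEMeasurable p.Ptail (volume.restrict (Ioi 0)) := by
  have hS : MeasurableSet {q : ℝ × Ω | ENNReal.ofReal q.1 < Y q.2 ∧ Y q.2 ≠ ∞} := by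
    have h1 : MeasurableSet {q : ℝ × Ω | Y q.2 ≠ ∞} :=
      (measurableSet_singleton ∞).compl.preimage (h.measurable.comp measurable_snd)
    exact (measurableSet_lt measurable_fst.ennreal_ofReal (h.measurable.comp measurable_snd)).inter h1
  have hm : Measurable fun z : ℝ => (μ {ω | ENNReal.ofReal z < Y ω ∧ Y ω ≠ ∞}).toReal :=
    (measurable_measure_prodMk_left hS).ennreal_toReal
  refine ⟨_, hm, ?_⟩
  filter_upwards [ae_restrict_mem measurableSet_Ioi] with z hz
  have hz' : 0 ≤ z := le_of_lt hz
  rw [h.measure_Ioo_top hp hz', ENNReal.toReal_ofReal (hp.Ptail_nonneg hz')]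

lemma IsDetLoss.aemeasurable_successDensity (hp : p.Valid) {Y : Ω → ℝ≥0∞} (h : p.IsDetLoss Y μ) (Γ : ℝ) :
    AEMeasurable (p.successDensity Γ) (volume.restrict (Ioi 0)) := by
  have h1 := h.aemeasurable_Ptail hp
  have h2 := hp.aemeasurable_fZ₁
  have h3 := hp.measurable_Ptilde
  have h4 := hp.measurable_Pra
  have h5 := hp.measurable_V Γ (p.lam / (p.M * p.Kcs))
  have h6 := hp.measurable_U Γ (p.lam / (p.M * p.Kcs))
  have h7 := hp.measurable_V (p.g / p.G * Γ) (p.lam / (p.M * p.Kcs))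
  have h8 := hp.measurable_U (p.g / p.G * Γ) (p.lam / (p.M * p.Kcs))
  unfold successDensity
  fun_prop

end Average

end Params

end

end MmWave


namespace MmWave

noncomputable section

open Filter Topology

namespace Params

variable {p : Params}

namespace Network

variable {Ω : Type*} {X : p.Network Ω}

/-! ## Success in all phases -/

/-- Success in all phases, with the serving sector `j` and the preamble `k`, as an event for the path
losses of the detected sectors and the other random elements; data phase interference is evaluated
through the kernel `κ`. -/
def successSet (p : Params) (κ : Kernel (Measure ((ℂ × Bool) × Bool × ℝ)) ((ℂ × Bool) × Bool × ℝ))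
    (cell : Set ℂ) (m : Fin p.Mra) (Γ : ℝ) (j : Fin p.Kcs) (k : Fin p.Npa) :
    Set ((Fin p.Kcs → ℝ≥0∞) × Fin p.Npa × Measure (ℂ × Fin p.Npa × Fin p.Mra) ×
      (Measure ((ℂ × Bool) × Fin p.Npa × Bool × ℝ) × ℝ) × (Measure ((ℂ × Bool) × Bool × ℝ) × ℝ)) :=
  {q | q.1 ∈ p.servingSet j ∧ q.2.1 = k ∧ q.2.2.1 {x | x.1 ∈ cell ∧ x.2.1 = k ∧ x.2.2 = m} = 0 ∧
    ENNReal.ofReal p.Γra ≤ ENNReal.ofReal (p.Pu * p.Mra * p.G * q.2.2.2.1.2) / q.1 j /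
      (p.interfRA m k (p.lobe j) q.2.2.2.1.1 + ENNReal.ofReal p.noise) ∧
    ENNReal.ofReal Γ ≤ ENNReal.ofReal (p.Pb * p.M * p.G * q.2.2.2.2.2) / q.1 j /
      (p.interfDL (p.lobe j) (p.dlThreshold j q.1) (κ q.2.2.2.2.1) + ENNReal.ofReal p.noise)}

/-- The data interference threshold varies with the losses, so the integral has a varying domain;
this is why the configuration passes through an s-finite kernel. -/
lemma measurableSet_successSet
    (κ : Kernel (Measure ((ℂ × Bool) × Bool × ℝ)) ((ℂ × Bool) × Bool × ℝ)) [IsSFiniteKernel κ]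
    {cell : Set ℂ} (hcell : MeasurableSet cell) (m : Fin p.Mra) (Γ : ℝ) (j : Fin p.Kcs) (k : Fin p.Npa) :
    MeasurableSet (successSet p κ cell m Γ j k) := by
  let Q := (Fin p.Kcs → ℝ≥0∞) × Fin p.Npa × Measure (ℂ × Fin p.Npa × Fin p.Mra) ×
      (Measure ((ℂ × Bool) × Fin p.Npa × Bool × ℝ) × ℝ) × (Measure ((ℂ × Bool) × Bool × ℝ) × ℝ)
  have hy : Measurable fun q : Q => q.1 := measurable_fst
  have hyj : ∀ i, Measurable fun q : Q => q.1 i := fun i => (measurable_pi_apply i).comp hy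
  have hpre : Measurable fun q : Q => q.2.1 := measurable_fst.comp measurable_snd
  have hco : Measurable fun q : Q => q.2.2.1 := measurable_fst.comp (measurable_snd.comp measurable_snd)
  have h3 : Measurable fun q : Q => q.2.2.2 := measurable_snd.comp (measurable_snd.comp measurable_snd)
  have hra : Measurable fun q : Q => q.2.2.2.1.1 := measurable_fst.comp (measurable_fst.comp h3)
  have hfra : Measurable fun q : Q => q.2.2.2.1.2 := measurable_snd.comp (measurable_fst.comp h3)
  have hdl : Measurable fun q : Q => q.2.2.2.2.1 := measurable_fst.comp (measurable_snd.comp h3)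
  have hfdl : Measurable fun q : Q => q.2.2.2.2.2 := measurable_snd.comp (measurable_snd.comp h3)
  have hB : MeasurableSet {x : ℂ × Fin p.Npa × Fin p.Mra | x.1 ∈ cell ∧ x.2.1 = k ∧ x.2.2 = m} :=
    hcell.prod ((measurableSet_singleton k).prod (measurableSet_singleton m))
  have hthr : ∀ i, Measurable fun q : Q => p.dlThreshold j q.1 i := fun i =>
    Measurable.ite ((hyj i) (measurableSet_singleton ∞)) measurable_const (hyj j)
  have hI : Measurable fun q : Q => p.interfDL (p.lobe j) (p.dlThreshold j q.1) (κ q.2.2.2.2.1) := by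
    unfold interfDL
    refine Finset.measurable_sum _ fun i _ => ?_
    have := (measurable_interfSector_kernel i (if i ∈ p.lobe j then p.G else p.g) κ).comp
      ((hthr i).prodMk hdl)
    simp only [Function.comp_def] at this
    convert this
  have s1 := hy (measurableSet_servingSet j)
  have s2 := hpre (measurableSet_singleton k)
  have s3 := ((Measure.measurable_coe hB).comp hco) (measurableSet_singleton 0)
  have hA : Measurable fun q : Q => ENNReal.ofReal (p.Pu * p.Mra * p.G * q.2.2.2.1.2) / q.1 j /
      (p.interfRA m k (p.lobe j) q.2.2.2.1.1 + ENNReal.ofReal p.noise) :=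
    ((hfra.const_mul _).ennreal_ofReal.div (hyj j)).div
      (((measurable_interfRA m k _).comp hra).add_const _)
  have hD : Measurable fun q : Q => ENNReal.ofReal (p.Pb * p.M * p.G * q.2.2.2.2.2) / q.1 j /
      (p.interfDL (p.lobe j) (p.dlThreshold j q.1) (κ q.2.2.2.2.1) + ENNReal.ofReal p.noise) :=
    ((hfdl.const_mul _).ennreal_ofReal.div (hyj j)).div (hI.add_const _)
  have s4 := measurableSet_le (measurable_const (a := ENNReal.ofReal p.Γra)) hA
  have s5 := measurableSet_le (measurable_const (a := ENNReal.ofReal Γ)) hD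
  exact s1.inter (s2.inter (s3.inter (s4.inter s5)))

/-- The random elements other than the base stations in cell search. -/
def rest (X : p.Network Ω) (ω : Ω) : Fin p.Npa × Measure (ℂ × Fin p.Npa × Fin p.Mra) ×
    (Measure ((ℂ × Bool) × Fin p.Npa × Bool × ℝ) × ℝ) × (Measure ((ℂ × Bool) × Bool × ℝ) × ℝ) :=
  (X.preamble ω, X.co ω, (X.ra ω, X.fadingRA ω), (X.dl ω, X.fadingDL ω))

lemma measurable_rest_info (X : p.Network Ω) : Measurable[⨆ i ∈ ({0}ᶜ : Set (Fin 7)), X.info i] X.rest :=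
  (measurable_of_info (i := 4) (by simp) rfl).prodMk
    ((measurable_of_info (i := 1) (by simp) rfl).prodMk
      (((measurable_of_info (i := 2) (by simp) rfl).prodMk (measurable_of_info (i := 5) (by simp) rfl)).prodMk
        ((measurable_of_info (i := 3) (by simp) rfl).prodMk (measurable_of_info (i := 6) (by simp) rfl))))

variable [MeasurableSpace Ω] {μ : Measure Ω}

lemma HasLaw.measurable_rest (hX : X.HasLaw μ) : Measurable X.rest :=
  hX.preamble_meas.prodMk (hX.co_ppp.measurable.prodMk
    ((hX.ra_ppp.measurable.prodMk hX.fadingRA_meas).prodMk (hX.dl_ppp.measurable.prodMk hX.fadingDL_meas)))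

/-- The success event splits, up to a null set, into disjoint events indexed by serving sector and
preamble. Only null measurability is claimed, because `det` is replaced by a measurable version
almost everywhere. -/
theorem HasLaw.measure_success [IsProbabilityMeasure μ] (hp : p.Valid) (hX : X.HasLaw μ)
    {cell : Set ℂ} (hcell : MeasurableSet cell) (hvol : volume cell = ENNReal.ofReal (1.28 / p.lam))
    (m : Fin p.Mra) {Γ : ℝ} (hΓ : 0 ≤ Γ) :
    NullMeasurableSet (X.iaSuccess cell m ∩ {ω | ENNReal.ofReal Γ ≤ X.sinrDL ω}) μ ∧
      IntegrableOn (p.successDensity Γ) (Ioi 0) ∧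
      (∀ z ∈ Ioi (0 : ℝ), 0 ≤ p.successDensity Γ z) ∧
      μ.real (X.iaSuccess cell m ∩ {ω | ENNReal.ofReal Γ ≤ X.sinrDL ω}) =
        ∫ z in Ioi (0 : ℝ), p.successDensity Γ z := by
  classical
  have := hp.sigmaFinite_linkIntensity p.lam
  obtain ⟨D, hD, hDe, hDi⟩ := hp.exists_iIndepFun_detLoss hX.cs_ppp
  let Y : Fin p.Kcs → Ω → ℝ≥0∞ := fun i ω => D i (X.cs ω)
  have hYm : ∀ i, Measurable (Y i) := fun i => (hD i).comp hX.cs_ppp.measurable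
  have hYe : ∀ᵐ ω ∂μ, ∀ i, Y i ω = X.det i ω := ae_all_iff.2 hDe
  have hY : ∀ i, p.IsDetLoss (Y i) μ := fun i => ⟨hYm i, fun φ hφ h0 => by
    rw [← hp.lintegral_detLoss hX.cs_ppp i hφ h0]
    refine lintegral_congr_ae ?_
    filter_upwards [hDe i] with ω hω
    simp only [Y, hω]⟩
  have hYi : iIndepFun Y μ := hDi
  have hP1 : p.Pdet ≤ 1 := (hY ⟨0, hp.Kcs_pos⟩).Pdet_le_one hp
  -- The user densities in the model involve the true success probability; this identifies it with
  -- the analytic one.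
  have hPhat : μ.real X.csSuccess = p.Phat := by
    rw [← measure_exists_ne_top hp hY hYi]
    refine measureReal_congr ?_
    filter_upwards [hYe] with ω hω
    refine propext ((X.mem_csSuccess_iff hp).trans ?_)
    simp only [← hω]
    rfl
  have hne : ∀ᵐ ω ∂μ, ∀ i i', i ≠ i' → Y i ω ≠ ∞ → Y i ω ≠ Y i' ω := by
    simp only [ae_all_iff, eventually_imp_distrib_left]
    intro i i' hii
    exact ae_ne_of_indepFun (hY i) (hY i') (hYi.indepFun hii)
  have hpos : ∀ᵐ ω ∂μ, ∀ i, Y i ω ≠ 0 := by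
    rw [ae_all_iff]
    intro i
    rw [ae_iff]
    simpa using (hY i).measure_singleton ENNReal.zero_ne_top
  let κ := tame ((p.linkIntensity p.lam).prod ((coin p.M).prod (expMeasure 1)))
  have hκ : ∀ᵐ ω ∂μ, κ (X.dl ω) = X.dl ω := hX.dl_ppp.ae_tame
  let Yv : Ω → Fin p.Kcs → ℝ≥0∞ := fun ω i => Y i ω
  have hYv : Measurable Yv := measurable_pi_lambda _ hYm
  have hRm := hX.measurable_rest
  let E : Fin p.Kcs × Fin p.Npa → Set Ω := fun jk =>
    {ω | (Yv ω, X.rest ω) ∈ successSet p κ cell m Γ jk.1 jk.2}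
  have hEm : ∀ jk, MeasurableSet (E jk) := fun jk =>
    (hYv.prodMk hRm) (measurableSet_successSet κ hcell m Γ jk.1 jk.2)
  have hEd : Pairwise fun a b => Disjoint (E a) (E b) := by
    intro a b hab
    rw [Set.disjoint_left]
    intro ω ha hb
    exact hab (Prod.ext (servingSet_unique ha.1 hb.1) (ha.2.1.symm.trans hb.2.1))
  have hEe : (X.iaSuccess cell m ∩ {ω | ENNReal.ofReal Γ ≤ X.sinrDL ω} : Set Ω) =ᵐ[μ] ⋃ jk, E jk := by
    filter_upwards [hYe, hne, hκ] with ω h1 h2 h3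
    have hYd : Yv ω = fun i => X.det i ω := funext h1
    refine propext ?_
    change ω ∈ X.iaSuccess cell m ∩ {ω | ENNReal.ofReal Γ ≤ X.sinrDL ω} ↔ ω ∈ ⋃ jk, E jk
    rw [mem_iUnion]
    have key : ∀ j k, Yv ω ∈ p.servingSet j → (ω ∈ E (j, k) ↔ X.preamble ω = k ∧
        ω ∈ X.noCollision cell m ∧ ENNReal.ofReal p.Γra ≤ X.sinrRA m ω ∧ ENNReal.ofReal Γ ≤ X.sinrDL ω) := by
      intro j k hj
      have hj' := hj
      rw [hYd] at hj'
      rw [sinrRA_eq hp hj', sinrDL_eq hp hj']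
      have hE : ω ∈ E (j, k) ↔ Yv ω ∈ p.servingSet j ∧ X.preamble ω = k ∧
          X.co ω {x | x.1 ∈ cell ∧ x.2.1 = k ∧ x.2.2 = m} = 0 ∧
          ENNReal.ofReal p.Γra ≤ ENNReal.ofReal (p.Pu * p.Mra * p.G * X.fadingRA ω) / Yv ω j /
            (p.interfRA m k (p.lobe j) (X.ra ω) + ENNReal.ofReal p.noise) ∧
          ENNReal.ofReal Γ ≤ ENNReal.ofReal (p.Pb * p.M * p.G * X.fadingDL ω) / Yv ω j /
            (p.interfDL (p.lobe j) (p.dlThreshold j (Yv ω)) (κ (X.dl ω)) + ENNReal.ofReal p.noise) := Iff.rfl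
      rw [hE, h3, hYd]
      constructor
      · rintro ⟨-, rfl, h4, h5, h6⟩
        exact ⟨rfl, h4, h5, h6⟩
      · rintro ⟨rfl, h4, h5, h6⟩
        exact ⟨hj', rfl, h4, h5, h6⟩
    constructor
    · rintro ⟨⟨⟨hcs, hco⟩, hra⟩, hdl⟩
      obtain ⟨j, hj⟩ := exists_mem_servingSet (p := p) (y := Yv ω)
        (by rw [hYd]; exact (X.mem_csSuccess_iff hp).1 hcs) h2
      exact ⟨(j, X.preamble ω), (key j _ hj).2 ⟨rfl, hco, hra, hdl⟩⟩
    · rintro ⟨⟨j, k⟩, h⟩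
      obtain ⟨-, hco, hra, hdl⟩ := (key j k h.1).1 h
      have hj := h.1
      change Yv ω ∈ p.servingSet j at hj
      rw [hYd] at hj
      exact ⟨⟨⟨mem_csSuccess_of_servingSet hp hj, hco⟩, hra⟩, hdl⟩
  have hind : IndepFun Yv X.rest μ := by
    refine hX.indepFun (S := {0}) (T := {0}ᶜ) disjoint_compl_right ?_ X.measurable_rest_info
    have h0 : Measurable[⨆ i ∈ ({0} : Set (Fin 7)), X.info i] X.cs :=
      measurable_of_info (i := 0) (mem_singleton _) rfl
    exact (measurable_pi_lambda (fun ν i => D i ν) hD).comp h0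
  have hEμ : ∀ j k, μ (E (j, k)) = ENNReal.ofReal (1 / p.Npa) *
      ∫⁻ z in Ioi (0 : ℝ), ENNReal.ofReal (p.Ptilde z * p.fZ₁ z) *
        (p.servingFactor Γ j (ENNReal.ofReal z) * ∏ i ∈ Finset.univ.erase j,
          (ENNReal.ofReal (p.dlFactor Γ z (p.lobe j) i true) * ENNReal.ofReal (p.Ptail z) +
            ENNReal.ofReal (p.dlFactor Γ z (p.lobe j) i false) * ENNReal.ofReal (1 - p.Pdet))) := by
    intro j k
    have hT := measurableSet_successSet κ hcell m Γ j k
    have h1 := lintegral_indepFun hind hYv hRm (measurable_one.indicator hT)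
    have h2 : ∫⁻ ω, (successSet p κ cell m Γ j k).indicator 1 (Yv ω, X.rest ω) ∂μ = μ (E (j, k)) :=
      lintegral_indicator_one (hEm (j, k))
    have h3 : ∀ ω, ∫⁻ ω', (successSet p κ cell m Γ j k).indicator 1 (Yv ω, X.rest ω') ∂μ =
        μ {ω' | (Yv ω, X.rest ω') ∈ successSet p κ cell m Γ j k} := fun ω =>
      lintegral_indicator_one ((measurable_const.prodMk hRm) hT)
    rw [h2] at h1
    simp_rw [h3] at h1
    -- By independence the losses are frozen and the later phases averaged first. Almost surely no
    -- loss is `0`, so the formulas for positive `z` apply.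
    rw [h1, ← hp.lintegral_servingFactor hY hYi, ← lintegral_const_mul' _ _ ENNReal.ofReal_ne_top]
    refine lintegral_congr_ae ?_
    filter_upwards [hpos] with ω hω
    rw [← servingSet_indicator_eq Γ j (Yv ω)]
    by_cases hj : Yv ω ∈ p.servingSet j
    · rw [indicator_of_mem hj]
      have hz : 0 < (Yv ω j).toReal := ENNReal.toReal_pos (hω j) hj.1
      have h4 := hX.measure_laterSuccess hp hPhat hcell hvol m hΓ j k hz (ENNReal.ofReal_toReal hj.1).symm
      rw [mul_assoc (ENNReal.ofReal p.Pco), mul_assoc (ENNReal.ofReal (p.Pra _)), ← h4]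
      refine measure_congr ?_
      filter_upwards [hκ] with ω' hκ'
      refine propext ?_
      change (Yv ω, X.rest ω') ∈ successSet p κ cell m Γ j k ↔ ω' ∈ X.laterSuccess cell m Γ j k (Yv ω)
      have hS : (Yv ω, X.rest ω') ∈ successSet p κ cell m Γ j k ↔ Yv ω ∈ p.servingSet j ∧ X.preamble ω' = k ∧
          X.co ω' {x | x.1 ∈ cell ∧ x.2.1 = k ∧ x.2.2 = m} = 0 ∧
          ENNReal.ofReal p.Γra ≤ ENNReal.ofReal (p.Pu * p.Mra * p.G * X.fadingRA ω') / Yv ω j /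
            (p.interfRA m k (p.lobe j) (X.ra ω') + ENNReal.ofReal p.noise) ∧
          ENNReal.ofReal Γ ≤ ENNReal.ofReal (p.Pb * p.M * p.G * X.fadingDL ω') / Yv ω j /
            (p.interfDL (p.lobe j) (p.dlThreshold j (Yv ω)) (κ (X.dl ω')) + ENNReal.ofReal p.noise) := Iff.rfl
      rw [hS, hκ']
      exact and_iff_right hj
    · rw [indicator_of_notMem hj, mul_zero]
      have h5 : {ω' | (Yv ω, X.rest ω') ∈ successSet p κ cell m Γ j k} = ∅ :=
        eq_empty_of_forall_notMem fun ω' h' => hj h'.1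
      rw [h5, measure_empty]
  have hμ : μ (X.iaSuccess cell m ∩ {ω | ENNReal.ofReal Γ ≤ X.sinrDL ω}) =
      ∫⁻ z in Ioi (0 : ℝ), ENNReal.ofReal (p.successDensity Γ z) := by
    have hNpa : (0 : ℝ) < p.Npa := by exact_mod_cast hp.Npa_pos
    have hK0 : (p.Kcs : ℝ≥0∞) ≠ 0 := by exact_mod_cast hp.Kcs_pos.ne'
    -- Summing over preambles cancels `1 / Npa`, and each serving sector accounts for a share `1 /
    -- K`.
    have h1 : ∀ j, (∑ k, μ (E (j, k))) = (p.Kcs : ℝ≥0∞)⁻¹ *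
        ∫⁻ z in Ioi (0 : ℝ), ENNReal.ofReal (p.successDensity Γ z) := by
      intro j
      simp_rw [hEμ]
      rw [Finset.sum_const, Finset.card_univ, Fintype.card_fin, nsmul_eq_mul, ← mul_assoc,
        ← ENNReal.ofReal_natCast p.Npa, ← ENNReal.ofReal_mul (Nat.cast_nonneg _),
        mul_one_div_cancel hNpa.ne', ENNReal.ofReal_one, one_mul,
        ← lintegral_const_mul' _ _ (ENNReal.inv_ne_top.2 hK0)]
      refine setLIntegral_congr_fun measurableSet_Ioi fun z hz => ?_
      rw [← hp.sum_servingFactor hP1 Γ hz j, ← mul_assoc (p.Kcs : ℝ≥0∞)⁻¹,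
        ENNReal.inv_mul_cancel hK0 (ENNReal.natCast_ne_top _), one_mul]
    rw [measure_congr hEe, measure_iUnion hEd hEm, tsum_fintype, Fintype.sum_prod_type]
    simp_rw [h1]
    rw [Finset.sum_const, Finset.card_univ, Fintype.card_fin, nsmul_eq_mul, ← mul_assoc,
      ENNReal.mul_inv_cancel hK0 (ENNReal.natCast_ne_top _), one_mul]
  have hnn : ∀ z ∈ Ioi (0 : ℝ), 0 ≤ p.successDensity Γ z := fun z hz =>
    hp.successDensity_nonneg hP1 (le_of_lt hz) Γ
  have hnn' : 0 ≤ᵐ[volume.restrict (Ioi (0 : ℝ))] p.successDensity Γ := by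
    filter_upwards [ae_restrict_mem measurableSet_Ioi] with z hz using hnn z hz
  have hsm : AEStronglyMeasurable (p.successDensity Γ) (volume.restrict (Ioi 0)) :=
    ((hY ⟨0, hp.Kcs_pos⟩).aemeasurable_successDensity hp Γ).aestronglyMeasurable
  refine ⟨(MeasurableSet.iUnion hEm).nullMeasurableSet.congr hEe.symm, ⟨hsm, ?_⟩, hnn, ?_⟩
  · rw [hasFiniteIntegral_iff_ofReal hnn', ← hμ]
    exact measure_lt_top _ _
  · rw [Measure.real, hμ, integral_eq_lintegral_of_nonneg_ae hnn' hsm]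

/-- At `T = 0` both `U` and `V` equal `1`, and the exponents `q - 1` and `K - q` combine to `K - 1`.
-/
lemma _root_.MmWave.Params.Valid.etaIA_eq (hp : p.Valid) :
    p.etaIA = ∫ z in Ioi (0 : ℝ), p.successDensity 0 z := by
  have hU : ∀ z lam, p.U z 0 lam = 1 := by
    intro z lam
    simp [U, expNeg_zero]
  have hV : ∀ z lam, p.V z 0 lam = 1 := by
    intro z lam
    simp [V, expNeg_zero]
  have hq := hp.q_pos
  have hqK := hp.q_le_Kcs
  unfold etaIA
  congr 1
  ext z
  rw [successDensity, mul_zero, hU, hV, show p.Kcs - 1 = (p.q - 1) + (p.Kcs - p.q) by omega, pow_add]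
  simp only [zero_mul, zero_div, neg_zero, Real.exp_zero]
  have h1 : 1 * p.Ptail z + 1 * (1 - p.Pdet) = p.Ptail z + 1 - p.Pdet := by ring
  have h2 : p.Ptail z * 1 + (1 - p.Pdet) * 1 = p.Ptail z + 1 - p.Pdet := by ring
  rw [h1, h2]
  ring

end Network

end Params

end

end MmWave

/-! ### The conditional coverage probability -/

theorem mainTheorem8 (p : MmWave.Params) (hp : p.Valid)
    {Ω : Type*} [MeasurableSpace Ω] (μ : Measure Ω) [IsProbabilityMeasure μ]
    (X : p.Network Ω) (hX : X.HasLaw μ)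
    (cell : Set ℂ) (hcell : MeasurableSet cell) (hvol : volume cell = ENNReal.ofReal (1.28 / p.lam))
    (m : Fin p.Mra)
    (hpos : 0 < μ (X.iaSuccess cell m))
    (Γ : ℝ) (hΓ : 0 ≤ Γ) :
    let integrand : ℝ → ℝ := fun z =>
      Real.exp (-(Γ * z * p.noise / (p.Pb * p.M * p.G))) * p.Kcs
        * (p.V z Γ (p.lam / (p.M * p.Kcs)) * p.Ptail z
            + p.U z Γ (p.lam / (p.M * p.Kcs)) * (1 - p.Pdet)) ^ (p.q - 1)
        * (p.Ptail z * p.V z (p.g / p.G * Γ) (p.lam / (p.M * p.Kcs))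
            + (1 - p.Pdet) * p.U z (p.g / p.G * Γ) (p.lam / (p.M * p.Kcs))) ^ (p.Kcs - p.q)
        * p.V z Γ (p.lam / (p.M * p.Kcs)) * p.Ptilde z * p.Pra z * p.Pco * p.fZ₁ z
    0 < p.etaIA ∧ IntegrableOn integrand (Ioi 0) ∧
      (μ[|X.iaSuccess cell m]).real {ω | ENNReal.ofReal Γ ≤ X.sinrDL ω}
        = 1 / p.etaIA * ∫ z in Ioi (0 : ℝ), integrand z := by
  intro integrand
  have hint : integrand = p.successDensity Γ := rfl
  -- At threshold `0` the data condition is void, so this is the probability of initial access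
  -- success alone, the denominator of the conditional probability.
  obtain ⟨h0m, -, -, h0⟩ := hX.measure_success hp hcell hvol m le_rfl
  obtain ⟨-, hi, -, hΓr⟩ := hX.measure_success hp hcell hvol m hΓ
  have huniv : {ω | ENNReal.ofReal 0 ≤ X.sinrDL ω} = univ := by
    ext ω
    simp
  rw [huniv, inter_univ] at h0m h0
  rw [← hp.etaIA_eq] at h0
  have heta : 0 < p.etaIA := by
    rw [← h0]
    exact ENNReal.toReal_pos hpos.ne' (measure_ne_top _ _)
  refine ⟨heta, hint ▸ hi, ?_⟩
  rw [hint, ← hΓr, ← h0, ProbabilityTheory.cond, Measure.real, Measure.smul_apply,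
    Measure.restrict_apply₀' h0m, inter_comm, smul_eq_mul, ENNReal.toReal_mul, ENNReal.toReal_inv, one_div]
  rfl
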